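/- **Conventions.** Let $M$ be a smooth manifold of dimension $n\ge 2$. A *conical region* $\mathcal D$ of $TU\setminus\{0\}$ ($U\subset M$ open) is an open subset of $TU\setminus\{0\}$ all of whose fibres $\mathcal D_x=\mathcal D\cap T_xM$, $x\in U$, are non-empty, connected and closed under multiplication by positive numbers. A *spray* $\mathbf G$ on $M$ is a smooth vector field on a conical region $\mathcal C$ of $TM\setminus\{0\}$ which in local coordinates $(x^i,y^i)$ has the form $\mathbf G=y^i\partial_{x^i}-2G^i\partial_{y^i}$ with $G^i(x,cy)=c^2G^i(x,y)$ for $c>0$. Its Riemann curvature is $$R^i{}_k=2\,\partial_{x^k}G^i-y^j\partial_{x^j}\partial_{y^k}G^i+2G^j\partial_{y^j}\partial_{y^k}G^i-\partial_{y^j}G^i\,\partial_{y^k}G^j ,$$ and for a function $f(x,y)$ one writes $f_{.k}=\partial_{y^k}f$ and $f_{;k}=\partial_{x^k}f-(\partial_{y^k}G^r)\,\partial_{y^r}f$. A *Finsler metric* on a conical region $\mathcal D$ is a smooth function $L$ on $\mathcal D$, positively homogeneous of degree two in $y$, such that $g_{ij}=(\tfrac12L)_{.i.j}$ is everywhere non-degenerate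 (no definiteness or positivity is required). It *induces* $\mathbf G$ on $\mathcal D\subset\mathcal C$ if $G^i=\frac14g^{il}\{L_{x^ky^l}y^k-L_{x^l}\}$ on $\mathcal D$, and it has *flag curvature* $K$ if the Riemann curvature of the spray it induces is $R^i{}_k=K(L\delta^i_k-\tfrac12L_{.k}y^i)$. The spray $\mathbf G$ is *Finsler-metrizable* if a Finsler metric on $\mathcal C$ induces it, and *locally Finsler-metrizable* if every $(x,y)\in\mathcal C$ lies in a conical region $\mathcal D\subset\mathcal C$ of $TU\setminus\{0\}$, for some open $U\ni x$, on which a Finsler metric induces $\mathbf G$. **Theorem.** Let $\mathbf G$ be a spray of isotropic curvature on $M$, i.e. $R^i{}_k=R\,\delta^i_k-\frac12R_{.k}y^i$ with a smooth function $R$ on $\mathcal C$, positively homogeneous of degree two in $y$. (i) If $R=0$ on $\mathcal C$, then $\mathbf G$ is locally Finsler-metrizable. (ii) If $R$ vanishes identically on no fibre $\mathcal C_x$ and $R$ is not a Finsler metric on $\mathcal C$, then $\mathbf G$ is neither Finsler-metrizable nor locally Finsler-metrizable. (iii) If $R$ is a Finsler metric on $\mathcal C$, then $\mathbf G$ is locally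 Finsler-metrizable if and only if $R_{;i}=R\,\omega_i$ on $\mathcal C$ for some smooth closed 1-form $\omega=\omega_i(x)dx^i$ on $M$. For every such $\omega$: (a) if $n\ge3$, then $R_{;i}=0$ and $\omega=0$; (b) if $\omega=0$, then $\mathbf G$ is induced on $\mathcal C$ by the Finsler metric $R$, whose flag curvature is $1$; (c) every point of $M$ has an open neighbourhood $U$ with a smooth nowhere vanishing function $\lambda$ on $U$ such that $\omega_i=(\ln|\lambda|)_{;i}=\partial_{x^i}\ln|\lambda|$ on $U$; and whenever $U\subset M$ is open and $\lambda$ is such a function on $U$, the spray $\mathbf G$ is induced on $\mathcal C\cap TU$ by the Finsler metric $R/\lambda$, whose flag curvature is $\lambda$. The case $\omega\neq0$ occurs only if $n=2$. -/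

import Mathlib

open Set
open scoped Manifold ContDiff Topology

noncomputable section

namespace SprayGeometry

/-- The model space `ℝⁿ`. -/
abbrev E (n : ℕ) : Type := EuclideanSpace ℝ (Fin n)

/-! ### Calculus in local coordinates `(x, y)` on `TM` -/

section Local

variable {n : ℕ}

/-- `∂_k f = ∂f/∂x^k` for a function `f(x, y)`. -/
def dx (k : Fin n) (f : E n → E n → ℝ) : E n → E n → ℝ :=
  fun x y => fderiv ℝ (fun x' => f x' y) x (EuclideanSpace.single k 1)

/-- `∂̇_k f = ∂f/∂y^k = f_{.k}` for a function `f(x, y)`. -/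
def dy (k : Fin n) (f : E n → E n → ℝ) : E n → E n → ℝ :=
  fun x y => fderiv ℝ (fun y' => f x y') y (EuclideanSpace.single k 1)

/-- The component functions `G^i(x, y)`. -/
def comp (G : E n → E n → E n) (i : Fin n) : E n → E n → ℝ :=
  fun x y => G x y i

/-- The Riemann curvature of spray coefficients `G^i`:
`R^i_k = 2 ∂_k G^i - y^j ∂_j ∂̇_k G^i + 2 G^j ∂̇_j ∂̇_k G^i - (∂̇_j G^i)(∂̇_k G^j)`. -/
def riemann (G : E n → E n → E n) (i k : Fin n) (x y : E n) : ℝ :=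
  2 * dx k (comp G i) x y
    - ∑ j, y j * dx j (dy k (comp G i)) x y
    + 2 * ∑ j, G x y j * dy j (dy k (comp G i)) x y
    - ∑ j, dy j (comp G i) x y * dy k (comp G j) x y

/-- The horizontal derivative of a scalar function with respect to the Berwald connection:
`f_{;i} = δ_i f = ∂_i f - (∂̇_i G^r) ∂̇_r f`. -/
def hderiv (G : E n → E n → E n) (f : E n → E n → ℝ) (i : Fin n) (x y : E n) : ℝ :=
  dx i f x y - ∑ r, dy i (comp G r) x y * dy r f x y

/-- The fundamental tensor `g_{ij} = (L/2)_{y^i y^j}`. -/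
def fundTensor (L : E n → E n → ℝ) (x y : E n) : Matrix (Fin n) (Fin n) ℝ :=
  Matrix.of fun i j => dy i (dy j (fun x' y' => L x' y' / 2)) x y

/-- The coefficients `G^i = (1/4) g^{il} (L_{x^k y^l} y^k - L_{x^l})` induced by `L`. -/
def inducedCoeff (L : E n → E n → ℝ) (x y : E n) : E n :=
  WithLp.toLp 2 fun i =>
    (1 / 4 : ℝ) * ∑ l, (fundTensor L x y)⁻¹ i l *
      ((∑ k, dx k (dy l L) x y * y k) - dx l L x y)

end Local

/-! ### Sprays and Finsler metrics on a manifold -/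

section Global

variable {n : ℕ} {M : Type*} [TopologicalSpace M] [ChartedSpace (E n) M]

/-- `e` is a local coordinate system of the smooth manifold `M`. -/
def IsCoord (e : OpenPartialHomeomorph M (E n)) : Prop :=
  e ∈ IsManifold.maximalAtlas (𝓡 n) ∞ M

/-- The point of `TM` whose coordinates in the coordinate system induced by `e` are `(ξ, η)`. -/
def tangentPoint (e : OpenPartialHomeomorph M (E n)) (ξ η : E n) : TangentBundle (𝓡 n) M :=
  ⟨e.symm ξ, mfderiv (𝓡 n) (𝓡 n) e.symm ξ η⟩

/-- The coordinate image of a subset of `TM`. -/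
def chartDom (e : OpenPartialHomeomorph M (E n)) (D : Set (TangentBundle (𝓡 n) M)) :
    Set (E n × E n) :=
  {p | p.1 ∈ e.target ∧ tangentPoint e p.1 p.2 ∈ D}

/-- The coordinate expression of a function on `TM`. -/
def rep (e : OpenPartialHomeomorph M (E n)) (f : TangentBundle (𝓡 n) M → ℝ) :
    E n → E n → ℝ :=
  fun ξ η => f (tangentPoint e ξ η)

/-- `f` is of class `C^∞` on the (open) subset `D` of `TM`. -/
def SmoothOnTM (D : Set (TangentBundle (𝓡 n) M)) (f : TangentBundle (𝓡 n) M → ℝ) : Prop :=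
  ∀ e : OpenPartialHomeomorph M (E n), IsCoord e →
    ContDiffOn ℝ ∞ (fun p : E n × E n => rep e f p.1 p.2) (chartDom e D)

/-- `f` is positively homogeneous of degree two on the fibres of `D`. -/
def HomogeneousTwo (D : Set (TangentBundle (𝓡 n) M)) (f : TangentBundle (𝓡 n) M → ℝ) : Prop :=
  ∀ (x : M) (y : TangentSpace (𝓡 n) x), (⟨x, y⟩ : TangentBundle (𝓡 n) M) ∈ D →
    ∀ c : ℝ, 0 < c → f ⟨x, c • y⟩ = c ^ 2 * f ⟨x, y⟩

/-- The fibre `D_x` of a subset `D` of `TM`. -/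
def fibre (D : Set (TangentBundle (𝓡 n) M)) (x : M) : Set (TangentSpace (𝓡 n) x) :=
  {y | (⟨x, y⟩ : TangentBundle (𝓡 n) M) ∈ D}

/-- The part of `D` that lies over `U`. -/
def restrictTo (D : Set (TangentBundle (𝓡 n) M)) (U : Set M) : Set (TangentBundle (𝓡 n) M) :=
  {u | u ∈ D ∧ u.1 ∈ U}

variable [IsManifold (𝓡 n) ∞ M]

/-- `D` is a conical region of `TU \ {0}`: an open set all of whose fibres over the open set `U`
are conical regions (non-empty, connected, closed under multiplication by positive numbers, and
not containing zero). -/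
structure IsConicalRegion (U : Set M) (D : Set (TangentBundle (𝓡 n) M)) : Prop where
  isOpen_base : IsOpen U
  isOpen : IsOpen D
  base_mem : ∀ u ∈ D, u.1 ∈ U
  isConnected_fibre : ∀ x ∈ U, IsConnected (fibre D x)
  ne_zero : ∀ (x : M), (0 : TangentSpace (𝓡 n) x) ∉ fibre D x
  smul_mem : ∀ (x : M), ∀ y ∈ fibre D x, ∀ c : ℝ, 0 < c → c • y ∈ fibre D x

/-- The change `(x, y) ↦ (ψ(x), Dψ(x) y)`, `ψ = e' ∘ e⁻¹`, of the coordinates of `TM`. -/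
def tangentTransition (e e' : OpenPartialHomeomorph M (E n)) (p : E n × E n) : E n × E n :=
  (e' (e.symm p.1), fderiv ℝ (fun ξ => e' (e.symm ξ)) p.1 p.2)

variable (n M) in
/-- A spray on `M`: a smooth vector field `y^i ∂/∂x^i - 2 G^i ∂/∂y^i` on a conical region of
`TM \ {0}`, given by its coordinate expressions, with `G^i` positively homogeneous of degree two
in `y`. The field `compatible` says that the coordinate expressions are those of one vector
field: they are mapped to each other by the differentials of the coordinate changes of `TM`. -/
structure Spray where
  region : Set (TangentBundle (𝓡 n) M)
  isConicalRegion : IsConicalRegion univ region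
  coeff : OpenPartialHomeomorph M (E n) → E n → E n → E n
  smooth : ∀ e : OpenPartialHomeomorph M (E n), IsCoord e →
    ContDiffOn ℝ ∞ (fun p : E n × E n => coeff e p.1 p.2) (chartDom e region)
  homogeneous : ∀ e : OpenPartialHomeomorph M (E n), IsCoord e →
    ∀ p ∈ chartDom e region, ∀ c : ℝ, 0 < c → coeff e p.1 (c • p.2) = c ^ 2 • coeff e p.1 p.2
  compatible : ∀ e e' : OpenPartialHomeomorph M (E n), IsCoord e → IsCoord e' →
    ∀ p ∈ chartDom e region, e.symm p.1 ∈ e'.source →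
      fderiv ℝ (tangentTransition e e') p (p.2, (-2 : ℝ) • coeff e p.1 p.2) =
        ((tangentTransition e e' p).2,
          (-2 : ℝ) • coeff e' (tangentTransition e e' p).1 (tangentTransition e e' p).2)

/-- `L` is a (possibly singular) Finsler metric on the conical region `D`: it is smooth, positively
homogeneous of degree two, and its fundamental tensor is non-degenerate. -/
structure IsFinslerMetric (D : Set (TangentBundle (𝓡 n) M)) (L : TangentBundle (𝓡 n) M → ℝ) :
    Prop where
  smooth : SmoothOnTM D L
  homogeneous : HomogeneousTwo D L
  nondegenerate : ∀ e : OpenPartialHomeomorph M (E n), IsCoord e → ∀ p ∈ chartDom e D,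
    (fundTensor (rep e L) p.1 p.2).det ≠ 0

/-- On `D`, the Finsler metric `L` has scalar flag curvature `K`:
`R^i_k = K (L δ^i_k - y^i y_k)` with `y_k = (L/2)_{.k}`, where `R^i_k` is the Riemann curvature
of the spray induced by `L`. -/
def HasFlagCurvature (D : Set (TangentBundle (𝓡 n) M)) (L K : TangentBundle (𝓡 n) M → ℝ) : Prop :=
  ∀ e : OpenPartialHomeomorph M (E n), IsCoord e → ∀ p ∈ chartDom e D, ∀ i k : Fin n,
    riemann (inducedCoeff (rep e L)) i k p.1 p.2 =
      rep e K p.1 p.2 *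
        (rep e L p.1 p.2 * (if i = k then 1 else 0)
          - p.2 i * dy k (fun x y => rep e L x y / 2) p.1 p.2)

/-- A differential 1-form on `M` (not yet assumed smooth). -/
abbrev OneForm (n : ℕ) (M : Type*) [TopologicalSpace M] [ChartedSpace (E n) M] : Type _ :=
  ∀ x : M, TangentSpace (𝓡 n) x →L[ℝ] ℝ

/-- The components `θ_i(x)` of a 1-form in the coordinate system `e`. -/
def formComp (e : OpenPartialHomeomorph M (E n)) (θ : OneForm n M) (i : Fin n) (ξ : E n) : ℝ :=
  θ (e.symm ξ) (mfderiv (𝓡 n) (𝓡 n) e.symm ξ (EuclideanSpace.single i (1 : ℝ)))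

/-- `θ` is a smooth closed 1-form: `∂_j θ_i = ∂_i θ_j` in local coordinates. -/
structure IsClosedOneForm (θ : OneForm n M) : Prop where
  smooth : ∀ e : OpenPartialHomeomorph M (E n), IsCoord e → ∀ i : Fin n,
    ContDiffOn ℝ ∞ (formComp e θ i) e.target
  closed : ∀ e : OpenPartialHomeomorph M (E n), IsCoord e → ∀ ξ ∈ e.target, ∀ i j : Fin n,
    fderiv ℝ (formComp e θ i) ξ (EuclideanSpace.single j 1) =
      fderiv ℝ (formComp e θ j) ξ (EuclideanSpace.single i 1)

/-- On `U`, `lam` is a smooth nowhere vanishing function with `θ = d (ln |lam|)`. -/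
structure IsLogPotential (U : Set M) (θ : OneForm n M) (lam : M → ℝ) : Prop where
  smooth : ContMDiffOn (𝓡 n) 𝓘(ℝ, ℝ) ∞ lam U
  ne_zero : ∀ x ∈ U, lam x ≠ 0
  eq : ∀ x ∈ U, ∀ v : TangentSpace (𝓡 n) x,
    θ x v = mfderiv (𝓡 n) 𝓘(ℝ, ℝ) (fun z => Real.log |lam z|) x v

namespace Spray

/-- `G` is of isotropic curvature: `R^i_k = R δ^i_k - (1/2) R_{.k} y^i`, where `R` is a smooth
function on the region of `G`, positively homogeneous of degree two. -/
structure IsIsotropic (G : Spray n M) (R : TangentBundle (𝓡 n) M → ℝ) : Prop where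
  smooth : SmoothOnTM G.region R
  homogeneous : HomogeneousTwo G.region R
  curvature : ∀ e : OpenPartialHomeomorph M (E n), IsCoord e → ∀ p ∈ chartDom e G.region,
    ∀ i k : Fin n, riemann (G.coeff e) i k p.1 p.2 =
      rep e R p.1 p.2 * (if i = k then 1 else 0) - 1 / 2 * dy k (rep e R) p.1 p.2 * p.2 i

/-- On the part `D` of its region, `G` is induced by the Finsler metric `L`. -/
def IsInducedBy (G : Spray n M) (D : Set (TangentBundle (𝓡 n) M))
    (L : TangentBundle (𝓡 n) M → ℝ) : Prop :=
  IsFinslerMetric D L ∧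
    ∀ e : OpenPartialHomeomorph M (E n), IsCoord e → ∀ p ∈ chartDom e D,
      G.coeff e p.1 p.2 = inducedCoeff (rep e L) p.1 p.2

/-- `G` is (globally) Finsler-metrizable: it is induced by a Finsler metric on its region. -/
def IsMetrizable (G : Spray n M) : Prop :=
  ∃ L : TangentBundle (𝓡 n) M → ℝ, G.IsInducedBy G.region L

/-- `G` is locally Finsler-metrizable: around every `(x, y)` in its region, there are an open set
`U` of `M` containing `x`, a conical region `D` of `TU \ {0}` containing `(x, y)`, and a Finsler
metric on `D` that induces `G` there. -/
def IsLocallyMetrizable (G : Spray n M) : Prop :=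
  ∀ u ∈ G.region, ∃ (U : Set M) (D : Set (TangentBundle (𝓡 n) M)),
    IsConicalRegion U D ∧ D ⊆ G.region ∧ u ∈ D ∧
      ∃ L : TangentBundle (𝓡 n) M → ℝ, G.IsInducedBy D L

/-- `R_{;i} = R θ_i`, the horizontal derivative being taken with respect to `G`. -/
def HorizontalLog (G : Spray n M) (R : TangentBundle (𝓡 n) M → ℝ) (θ : OneForm n M) : Prop :=
  ∀ e : OpenPartialHomeomorph M (E n), IsCoord e → ∀ p ∈ chartDom e G.region, ∀ i : Fin n,
    hderiv (G.coeff e) (rep e R) i p.1 p.2 = rep e R p.1 p.2 * formComp e θ i p.1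

/-- `R_{;i} = 0`, the horizontal derivative being taken with respect to `G`. -/
def HorizontallyConstant (G : Spray n M) (R : TangentBundle (𝓡 n) M → ℝ) : Prop :=
  ∀ e : OpenPartialHomeomorph M (E n), IsCoord e → ∀ p ∈ chartDom e G.region, ∀ i : Fin n,
    hderiv (G.coeff e) (rep e R) i p.1 p.2 = 0

end Spray

end Global

end SprayGeometry

end

noncomputable section

namespace SprayGeometry

/-! ### Second derivatives and commutators -/

section Commutator

variable {X F : Type*} [NormedAddCommGroup X] [NormedSpace ℝ X]
  [NormedAddCommGroup F] [NormedSpace ℝ F]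

/-! Write δ_w for the horizontal lift of a vector w, that is, w minus the vertical vector `fderiv ℝ
G p (0, w)`. Two facts about δ reduce the theorem to the behaviour of functions constant along the
horizontal distribution.

First, a nondegenerate L that is homogeneous of degree two induces G exactly when δ_w L = 0 for all
w (`eulerLagrange_iff`, `eq_inducedCoeff_iff`). The Euler-Lagrange equations contracted with y say
that L is constant along the spray, and the vertical derivative of that statement turns them into
horizontal constancy.

Second, the bracket [δ_v, δ_w] is vertical, equal to minus `horCurv G v w`, and `horCurv G v y` is
the Riemann curvature. Conversely the Riemann curvature determines `horCurv` by vertical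
differentiation (`three_smul_horCurv`). In the isotropic case `horCurv G v w` is therefore (R_{.w} v
- R_{.v} w)/2.

If R = 0, the horizontal distribution is integrable. Frobenius' theorem yields first integrals Φ
with Φ(x₀, y) = y, which inherit homogeneity of degree one. The function |Φ|² is then horizontally
constant and has a nondegenerate vertical Hessian near the given direction. It extends by
homogeneity to a cone, which proves (i).

For general R, let L induce G. The commutator of δ_w and δ_y applied to L gives R L_{.w} = L R_{.w}
(`mul_vert_eq`), and nondegeneracy of L then forces R = c L on each connected fibre, with c
depending on x only (`exists_eq_mul_of_proportional`). Hence near each direction R either vanishes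
along the fibre or has a nondegenerate vertical Hessian. Connectedness of the fibre makes one
alternative hold throughout it, which proves (ii).

If R is a Finsler metric, then c does not vanish, and R = c L gives R_{;i} = R ∂_i ln|c|. The
covector is independent of the direction because fibres are connected and R vanishes on no open part
of a fibre. So these local differentials fit together to a closed 1-form. Conversely, if ω = d ln|λ|
locally, the Leibniz rule shows that R/λ is horizontally constant. It therefore induces G, and
dividing the curvature formula by λ shows that its flag curvature is λ.

In dimension at least three the Bianchi identity, projected along a functional that kills two given
vectors but not a third, makes R_{;u.w} symmetric in u and w (`vert_horDeriv_symm`). With R_{;u} = R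
ω(u) this reads R_{.w} ω(u) = R_{.u} ω(w). If ω were nonzero, a vector in its kernel would be
annihilated by the Hessian of R. Then ω would be injective, which the dimension forbids. -/

lemma _root_.ContDiffAt.differentiableAt_fderiv {f : X → F} {p : X} (hf : ContDiffAt ℝ ∞ f p) :
    DifferentiableAt ℝ (fderiv ℝ f) p :=
  (hf.fderiv_right (m := ∞) (by simp)).differentiableAt (by simp)

lemma fderiv_fderiv_apply {f : X → F} {B : X → X} {p : X} (hf : ContDiffAt ℝ ∞ f p)
    (hB : DifferentiableAt ℝ B p) (a : X) :
    fderiv ℝ (fun q => fderiv ℝ f q (B q)) p a =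
      fderiv ℝ (fderiv ℝ f) p a (B p) + fderiv ℝ f p (fderiv ℝ B p a) := by
  rw [fderiv_clm_apply hf.differentiableAt_fderiv hB]
  simp [add_comm]

lemma fderiv_fderiv_const {f : X → F} {p : X} (hf : ContDiffAt ℝ ∞ f p) (a b : X) :
    fderiv ℝ (fun q => fderiv ℝ f q b) p a = fderiv ℝ (fderiv ℝ f) p a b := by
  simpa using fderiv_fderiv_apply hf (differentiableAt_const b) a

lemma fderiv_fderiv_symm {f : X → F} {p : X} (hf : ContDiffAt ℝ ∞ f p) (a b : X) :
    fderiv ℝ (fderiv ℝ f) p a b = fderiv ℝ (fderiv ℝ f) p b a :=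
  (hf.isSymmSndFDerivAt (by simpa using ENat.LEInfty.out)).eq a b

/-- The Lie bracket of two vector fields acts as a first-order operator because the second
derivatives of `f` cancel. Every commutation rule for horizontal, vertical and radial derivatives
below is a special case. -/
lemma fderiv_fderiv_sub {f : X → F} {A B : X → X} {p : X} (hf : ContDiffAt ℝ ∞ f p)
    (hA : DifferentiableAt ℝ A p) (hB : DifferentiableAt ℝ B p) :
    fderiv ℝ (fun q => fderiv ℝ f q (B q)) p (A p)
        - fderiv ℝ (fun q => fderiv ℝ f q (A q)) p (B p) =
      fderiv ℝ f p (fderiv ℝ B p (A p) - fderiv ℝ A p (B p)) := by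
  rw [fderiv_fderiv_apply hf hB, fderiv_fderiv_apply hf hA, fderiv_fderiv_symm hf, map_sub]
  abel

lemma _root_.ContDiffOn.fderiv_apply_of_isOpen {f : X → F} {B : X → X} {W : Set X}
    (hf : ContDiffOn ℝ ∞ f W) (hW : IsOpen W) (hB : ContDiffOn ℝ ∞ B W) :
    ContDiffOn ℝ ∞ (fun q => fderiv ℝ f q (B q)) W :=
  (hf.fderiv_of_isOpen hW (m := ∞) (by simp)).clm_apply hB

lemma fderiv_congr_of_eqOn {f g : X → F} {W : Set X} (hW : IsOpen W) (h : EqOn f g W)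
    {p : X} (hp : p ∈ W) : fderiv ℝ f p = fderiv ℝ g p :=
  (h.eventuallyEq_of_mem (hW.mem_nhds hp)).fderiv_eq

end Commutator

/-! ### Sprays on open subsets of a vector space, without coordinates -/

section LocalSpray

variable {V F : Type*} [NormedAddCommGroup V] [NormedSpace ℝ V]
  [NormedAddCommGroup F] [NormedSpace ℝ F]

lemma map_zero_neg (T : V × V →L[ℝ] F) (a : V) : T (0, -a) = -T (0, a) := by
  rw [← map_neg]
  simp

lemma fderiv_zero_snd (p a : V × V) :
    fderiv ℝ (fun q : V × V => ((0 : V), q.2)) p a = (0, a.2) := by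
  rw [show (fun q : V × V => ((0 : V), q.2)) =
    ((ContinuousLinearMap.inr ℝ V V).comp (ContinuousLinearMap.snd ℝ V V)) from rfl,
    ContinuousLinearMap.fderiv]
  simp

/-- The horizontal lift of the vector `w` with respect to the spray coefficients `G`. -/
def horLift (G : V × V → V) (w : V) (p : V × V) : V × V := (w, -fderiv ℝ G p (0, w))

/-- The horizontal derivative of `f` in the direction `w`. -/
def horDeriv (G : V × V → V) (w : V) (f : V × V → F) (p : V × V) : F :=
  fderiv ℝ f p (horLift G w p)

/-- The curvature of the horizontal distribution. -/
def horCurv (G : V × V → V) (v w : V) (p : V × V) : V :=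
  horDeriv G v (fun q => fderiv ℝ G q (0, w)) p - horDeriv G w (fun q => fderiv ℝ G q (0, v)) p

/-- `f` is positively homogeneous of degree two in the second variable. -/
def HomTwoOn (W : Set (V × V)) (f : V × V → F) : Prop :=
  ∀ p ∈ W, ∀ c : ℝ, 0 < c → f (p.1, c • p.2) = c ^ 2 • f p

lemma HomTwoOn.euler {W : Set (V × V)} {f : V × V → F} (h : HomTwoOn W f) {p : V × V} (hp : p ∈ W)
    (hf : DifferentiableAt ℝ f p) : fderiv ℝ f p (0, p.2) = (2 : ℝ) • f p := by
  have h1 : HasDerivAt (fun c : ℝ => (p.1, c • p.2)) (0, p.2) 1 :=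
    (hasDerivAt_const _ _).prodMk (by simpa using (hasDerivAt_id (1 : ℝ)).smul_const p.2)
  have h2 : HasDerivAt (fun c : ℝ => f (p.1, c • p.2)) (fderiv ℝ f p (0, p.2)) 1 := by
    refine HasFDerivAt.comp_hasDerivAt (1 : ℝ) (l := f) ?_ h1
    simpa using hf.hasFDerivAt
  have h3 : HasDerivAt (fun c : ℝ => c ^ 2 • f p) ((2 : ℝ) • f p) 1 := by
    simpa using (hasDerivAt_pow 2 (1 : ℝ)).smul_const (f p)
  refine h2.unique (h3.congr_of_eventuallyEq ?_)
  filter_upwards [lt_mem_nhds (zero_lt_one' ℝ)] with c hc using h p hp c hc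

/-- A spray on an open subset `W` of `V × V`, given by its coefficients. -/
structure IsLocalSpray (W : Set (V × V)) (G : V × V → V) : Prop where
  isOpen : IsOpen W
  smooth : ContDiffOn ℝ ∞ G W
  hom : HomTwoOn W G

variable {W : Set (V × V)} {G : V × V → V} {f : V × V → F} {p : V × V}

lemma _root_.ContDiffOn.vert (hf : ContDiffOn ℝ ∞ f W) (hW : IsOpen W) (w : V) :
    ContDiffOn ℝ ∞ (fun q => fderiv ℝ f q (0, w)) W :=
  hf.fderiv_apply_of_isOpen hW contDiffOn_const

lemma _root_.ContDiffOn.at (hf : ContDiffOn ℝ ∞ f W) (hW : IsOpen W) (hp : p ∈ W) :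
    ContDiffAt ℝ ∞ f p := hf.contDiffAt (hW.mem_nhds hp)

/-- The Euler relation for the vertical derivatives of a function that satisfies the Euler
relation of degree `k + 1`. -/
lemma euler_vert {k : ℝ} (hW : IsOpen W) (hf : ContDiffOn ℝ ∞ f W)
    (h : ∀ q ∈ W, fderiv ℝ f q (0, q.2) = (k + 1) • f q) (hp : p ∈ W) (w : V) :
    fderiv ℝ (fun q => fderiv ℝ f q (0, w)) p (0, p.2) = k • fderiv ℝ f p (0, w) := by
  have hfp := hf.at hW hp
  have h1 : fderiv ℝ (fun q => fderiv ℝ f q (0, q.2)) p (0, w)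
      = (k + 1) • fderiv ℝ f p (0, w) := by
    rw [fderiv_congr_of_eqOn (g := fun q => (k + 1) • f q) hW h hp, fderiv_fun_const_smul]
    · rfl
    · exact hfp.differentiableAt (by simp)
  rw [fderiv_fderiv_apply hfp (by fun_prop), fderiv_zero_snd, fderiv_fderiv_symm hfp] at h1
  rw [fderiv_fderiv_const hfp, eq_sub_of_add_eq h1, add_smul, one_smul]
  abel

lemma horCurv_swap (v w : V) : horCurv G v w p = -horCurv G w v p := by
  simp [horCurv]

namespace IsLocalSpray

lemma euler (S : IsLocalSpray W G) (hp : p ∈ W) : fderiv ℝ G p (0, p.2) = (2 : ℝ) • G p :=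
  S.hom.euler hp ((S.smooth.at S.isOpen hp).differentiableAt (by simp))

lemma euler_vert (S : IsLocalSpray W G) (hp : p ∈ W) (w : V) :
    fderiv ℝ (fun q => fderiv ℝ G q (0, w)) p (0, p.2) = fderiv ℝ G p (0, w) := by
  simpa using SprayGeometry.euler_vert (k := 1) S.isOpen S.smooth
    (fun q hq => by rw [S.euler hq]; norm_num) hp w

lemma smooth_conn (S : IsLocalSpray W G) (w : V) :
    ContDiffOn ℝ ∞ (fun q => fderiv ℝ G q (0, w)) W :=
  S.smooth.vert S.isOpen w

lemma smooth_horLift (S : IsLocalSpray W G) (w : V) : ContDiffOn ℝ ∞ (horLift G w) W :=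
  contDiffOn_const.prodMk (S.smooth_conn w).neg

lemma smooth_horDeriv (S : IsLocalSpray W G) (hf : ContDiffOn ℝ ∞ f W) (w : V) :
    ContDiffOn ℝ ∞ (horDeriv G w f) W :=
  hf.fderiv_apply_of_isOpen S.isOpen (S.smooth_horLift w)

lemma fderiv_horLift (S : IsLocalSpray W G) (hp : p ∈ W) (w : V) (a : V × V) :
    fderiv ℝ (horLift G w) p a = (0, -fderiv ℝ (fun q => fderiv ℝ G q (0, w)) p a) := by
  have h := ((S.smooth_conn w).at S.isOpen hp).differentiableAt (by simp)
  have h1 : HasFDerivAt (horLift G w) _ p :=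
    (hasFDerivAt_const w p).prodMk h.hasFDerivAt.neg
  rw [h1.fderiv]
  simp

lemma differentiableAt_horLift (S : IsLocalSpray W G) (hp : p ∈ W) (w : V) :
    DifferentiableAt ℝ (horLift G w) p :=
  ((S.smooth_horLift w).at S.isOpen hp).differentiableAt (by simp)

/-- The base components of horizontal lifts are constant, so their bracket is vertical, and its
vertical part is the difference that defines `horCurv`. -/
lemma horDeriv_comm (S : IsLocalSpray W G) (hf : ContDiffOn ℝ ∞ f W) (hp : p ∈ W) (v w : V) :
    horDeriv G v (horDeriv G w f) p - horDeriv G w (horDeriv G v f) p =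
      -fderiv ℝ f p (0, horCurv G v w p) := by
  have h := fderiv_fderiv_sub (hf.at S.isOpen hp) (S.differentiableAt_horLift hp v)
    (S.differentiableAt_horLift hp w)
  rw [S.fderiv_horLift hp, S.fderiv_horLift hp] at h
  refine h.trans ?_
  rw [← map_zero_neg]
  congr 1
  simp [horCurv, horDeriv, sub_eq_add_neg, add_comm]

/-- Vertical and horizontal derivatives commute up to the Berwald connection. -/
lemma vert_horDeriv (S : IsLocalSpray W G) (hf : ContDiffOn ℝ ∞ f W) (hp : p ∈ W) (u w : V) :
    fderiv ℝ (horDeriv G w f) p (0, u) = horDeriv G w (fun q => fderiv ℝ f q (0, u)) p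
      - fderiv ℝ f p (0, fderiv ℝ (fun q => fderiv ℝ G q (0, w)) p (0, u)) := by
  have h := fderiv_fderiv_sub (hf.at S.isOpen hp) (differentiableAt_const ((0 : V), u))
    (S.differentiableAt_horLift hp w)
  rw [S.fderiv_horLift hp] at h
  rw [sub_eq_iff_eq_add] at h
  refine h.trans ?_
  simp only [fderiv_fun_const, Pi.zero_apply, zero_apply, sub_zero, horDeriv, map_zero_neg]
  rw [add_comm, sub_eq_add_neg]

/-- The Berwald connection coefficients are symmetric. -/
lemma vert_conn_symm (S : IsLocalSpray W G) (hp : p ∈ W) (u w : V) :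
    fderiv ℝ (fun q => fderiv ℝ G q (0, w)) p (0, u) =
      fderiv ℝ (fun q => fderiv ℝ G q (0, u)) p (0, w) := by
  have h := S.smooth.at S.isOpen hp
  rw [fderiv_fderiv_const h, fderiv_fderiv_const h, fderiv_fderiv_symm h]

lemma horLift_self (S : IsLocalSpray W G) (hp : p ∈ W) :
    horLift G p.2 p = (p.2, -(2 : ℝ) • G p) := by
  simp [horLift, S.euler hp]

/-- A horizontal derivative of a function with the Euler relation of degree one has it too. -/
lemma euler_horDeriv (S : IsLocalSpray W G) (hf : ContDiffOn ℝ ∞ f W)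
    (h : ∀ q ∈ W, fderiv ℝ f q (0, q.2) = f q) (hp : p ∈ W) (w : V) :
    fderiv ℝ (horDeriv G w f) p (0, p.2) = horDeriv G w f p := by
  have hfp := hf.at S.isOpen hp
  rw [S.vert_horDeriv hf hp, S.vert_conn_symm hp]
  have h1 := DFunLike.congr_fun
    (fderiv_congr_of_eqOn (f := fun q => fderiv ℝ f q (0, q.2)) S.isOpen h hp) (horLift G w p)
  rw [fderiv_fderiv_apply hfp (by fun_prop), fderiv_zero_snd] at h1
  rw [horDeriv, fderiv_fderiv_const hfp, horDeriv, ← h1, ← S.vert_conn_symm hp, S.euler_vert hp]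
  rw [sub_eq_add_neg, ← map_zero_neg]
  rfl

/-- The connection coefficients have degree one in y, and horizontal derivatives preserve that
degree. -/
lemma euler_horCurv (S : IsLocalSpray W G) (hp : p ∈ W) (v w : V) :
    fderiv ℝ (horCurv G v w) p (0, p.2) = horCurv G v w p := by
  have h1 := ((S.smooth_horDeriv (S.smooth_conn w) v).at S.isOpen hp).differentiableAt (by simp)
  have h2 := ((S.smooth_horDeriv (S.smooth_conn v) w).at S.isOpen hp).differentiableAt (by simp)
  have := fderiv_sub h1 h2
  change fderiv ℝ (horDeriv G v (fun q => fderiv ℝ G q (0, w))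
    - horDeriv G w (fun q => fderiv ℝ G q (0, v))) p _ = _
  rw [this, sub_apply,
    S.euler_horDeriv (S.smooth_conn w) (fun q hq => S.euler_vert hq w) hp,
    S.euler_horDeriv (S.smooth_conn v) (fun q hq => S.euler_vert hq v) hp]
  rfl

/-- `vert_horDeriv` splits each half of the curvature into derivatives and products of the symmetric
Berwald coefficients. This is the form in which the cyclic sum cancels. -/
lemma vert_horCurv (S : IsLocalSpray W G) (hp : p ∈ W) (v w u : V) :
    fderiv ℝ (horCurv G v w) p (0, u) =
      (horDeriv G v (fun q => fderiv ℝ (fun r => fderiv ℝ G r (0, w)) q (0, u)) p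
        - fderiv ℝ (fun q => fderiv ℝ G q (0, w)) p
            (0, fderiv ℝ (fun q => fderiv ℝ G q (0, v)) p (0, u)))
      - (horDeriv G w (fun q => fderiv ℝ (fun r => fderiv ℝ G r (0, v)) q (0, u)) p
        - fderiv ℝ (fun q => fderiv ℝ G q (0, v)) p
            (0, fderiv ℝ (fun q => fderiv ℝ G q (0, w)) p (0, u))) := by
  have h1 := ((S.smooth_horDeriv (S.smooth_conn w) v).at S.isOpen hp).differentiableAt (by simp)
  have h2 := ((S.smooth_horDeriv (S.smooth_conn v) w).at S.isOpen hp).differentiableAt (by simp)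
  have := fderiv_sub h1 h2
  change fderiv ℝ (horDeriv G v (fun q => fderiv ℝ G q (0, w))
    - horDeriv G w (fun q => fderiv ℝ G q (0, v))) p _ = _
  rw [this, sub_apply,
    S.vert_horDeriv (S.smooth_conn w) hp, S.vert_horDeriv (S.smooth_conn v) hp]

/-- The cyclic sum of the vertical derivatives of the curvature vanishes. -/
lemma vert_horCurv_cyclic (S : IsLocalSpray W G) (hp : p ∈ W) (u v w : V) :
    fderiv ℝ (horCurv G v w) p (0, u) + fderiv ℝ (horCurv G w u) p (0, v)
      + fderiv ℝ (horCurv G u v) p (0, w) = 0 := by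
  have key : ∀ a b c : V,
      horDeriv G c (fun q => fderiv ℝ (fun r => fderiv ℝ G r (0, a)) q (0, b)) p
      = horDeriv G c (fun q => fderiv ℝ (fun r => fderiv ℝ G r (0, b)) q (0, a)) p := by
    intro a b c
    rw [horDeriv, fderiv_congr_of_eqOn S.isOpen (fun q hq => S.vert_conn_symm hq b a) hp]
    rfl
  rw [S.vert_horCurv hp, S.vert_horCurv hp, S.vert_horCurv hp, key w u v, key v u w, key w v u,
    S.vert_conn_symm hp u v, S.vert_conn_symm hp v w, S.vert_conn_symm hp w u]
  abel

end IsLocalSpray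

end LocalSpray

/-! ### Riemann curvature, horizontal curvature, the Bianchi identity, and isotropic sprays. -/

section LocalCurvature

variable {V F : Type*} [NormedAddCommGroup V] [NormedSpace ℝ V]
  [NormedAddCommGroup F] [NormedSpace ℝ F]
  {W : Set (V × V)} {G : V × V → V} {f : V × V → F} {p : V × V}

lemma fderiv_clm_apply_snd {T : V × V → V →L[ℝ] F} (hT : DifferentiableAt ℝ T p) (a : V × V) :
    fderiv ℝ (fun q => T q q.2) p a = fderiv ℝ (fun q => T q p.2) p a + T p a.2 := by
  rw [fderiv_clm_apply hT differentiableAt_snd, fderiv_clm_apply hT (differentiableAt_const _)]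
  simp [add_comm, fderiv_snd]

namespace IsLocalSpray

lemma horCurv_eq (S : IsLocalSpray W G) (hp : p ∈ W) (v w : V) :
    horCurv G v w p = fderiv ℝ (fderiv ℝ G) p (horLift G v p) (0, w)
      - fderiv ℝ (fderiv ℝ G) p (horLift G w p) (0, v) := by
  have h := S.smooth.at S.isOpen hp
  rw [horCurv, horDeriv, horDeriv, fderiv_fderiv_const h, fderiv_fderiv_const h]

/-- The derivative of the Riemann curvature, as a contraction of the curvature of the horizontal
distribution. -/
lemma fderiv_horCurv_snd (S : IsLocalSpray W G) (hp : p ∈ W) (v : V) (a : V × V) :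
    fderiv ℝ (fun q => horCurv G v q.2 q) p a =
      fderiv ℝ (horCurv G v p.2) p a + horCurv G v a.2 p := by
  -- The curvature is written as a differentiable family of operators acting on `w`, so that the
  -- product rule applies when `w` is replaced by the fibre coordinate.
  let T : V × V → V →L[ℝ] V := fun q =>
    (fderiv ℝ (fderiv ℝ G) q (horLift G v q)).comp (ContinuousLinearMap.inr ℝ V V)
    - ((ContinuousLinearMap.apply ℝ V ((0 : V), v)).comp (fderiv ℝ (fderiv ℝ G) q)).comp
      (ContinuousLinearMap.inl ℝ V V - (ContinuousLinearMap.inr ℝ V V).comp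
        ((fderiv ℝ G q).comp (ContinuousLinearMap.inr ℝ V V)))
  have hT : ∀ q ∈ W, ∀ w, horCurv G v w q = T q w := by
    intro q hq w
    rw [S.horCurv_eq hq]
    have : horLift G w q = (w, 0) - (0, fderiv ℝ G q (0, w)) := by simp [horLift]
    rw [this, map_sub]
    simp [T]
  have h1 : ContDiffAt ℝ ∞ (fderiv ℝ G) p :=
    (S.smooth.at S.isOpen hp).fderiv_right (m := ∞) (by simp)
  have h2 := h1.differentiableAt_fderiv
  have h1 := h1.differentiableAt (by simp)
  have h3 := S.differentiableAt_horLift hp v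
  have hTd : DifferentiableAt ℝ T p := by
    refine ((h2.clm_apply h3).clm_comp (differentiableAt_const _)).sub ?_
    exact ((differentiableAt_const _).clm_comp h2).clm_comp ((differentiableAt_const _).sub
      ((differentiableAt_const _).clm_comp (h1.clm_comp (differentiableAt_const _))))
  rw [fderiv_congr_of_eqOn S.isOpen (fun q hq => hT q hq q.2) hp,
    fderiv_congr_of_eqOn S.isOpen (fun q hq => hT q hq p.2) hp,
    hT p hp]
  exact fderiv_clm_apply_snd hTd a

/-- The Riemann curvature determines the curvature of the horizontal distribution. -/
lemma three_smul_horCurv (S : IsLocalSpray W G) (hp : p ∈ W) (v w : V) :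
    (3 : ℝ) • horCurv G v w p = fderiv ℝ (fun q => horCurv G v q.2 q) p (0, w)
      - fderiv ℝ (fun q => horCurv G w q.2 q) p (0, v) := by
  -- Of the three copies of the curvature, two come from the product rule and antisymmetry. The
  -- third comes from the cyclic identity, whose radial term is evaluated by homogeneity of degree
  -- one.
  have hc := S.vert_horCurv_cyclic hp w v p.2
  rw [S.fderiv_horCurv_snd hp, S.fderiv_horCurv_snd hp]
  have h1 : fderiv ℝ (horCurv G w p.2) p (0, v) = -fderiv ℝ (horCurv G p.2 w) p (0, v) := by
    rw [show horCurv G w p.2 = -horCurv G p.2 w from funext fun q => horCurv_swap _ _, fderiv_neg]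
    rfl
  have h2 : fderiv ℝ (horCurv G w v) p (0, p.2) = -horCurv G v w p := by
    rw [S.euler_horCurv hp, horCurv_swap]
  rw [h2] at hc
  rw [h1, horCurv_swap w v]
  rw [show (3 : ℝ) = 1 + 1 + 1 by norm_num, add_smul, add_smul, one_smul]
  simp only
  rw [← sub_eq_zero, ← neg_eq_zero]
  refine Eq.trans ?_ hc
  abel

/-- Differentiating the Euler relation of `G` along the lift of `w` evaluates the second derivatives
contracted with y. What remains is the coordinate formula of the Riemann curvature. -/
lemma horCurv_snd (S : IsLocalSpray W G) (hp : p ∈ W) (w : V) :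
    horCurv G w p.2 p = (2 : ℝ) • fderiv ℝ G p (w, 0)
      - fderiv ℝ (fun q => fderiv ℝ G q (0, w)) p (p.2, -(2 : ℝ) • G p)
      - fderiv ℝ G p (0, fderiv ℝ G p (0, w)) := by
  have h := S.smooth.at S.isOpen hp
  rw [horCurv, horDeriv, horDeriv, S.horLift_self hp]
  have h1 := DFunLike.congr_fun
    (fderiv_congr_of_eqOn (f := fun q => fderiv ℝ G q (0, q.2)) (g := fun q => (2 : ℝ) • G q)
      S.isOpen (fun q hq => S.euler hq) hp) (horLift G w p)
  rw [fderiv_fderiv_apply h (by fun_prop), fderiv_zero_snd,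
    fderiv_fun_const_smul (h.differentiableAt (by simp))] at h1
  rw [fderiv_fderiv_const h, eq_sub_of_add_eq h1]
  simp only [horLift, smul_apply, map_zero_neg]
  rw [show (w, -fderiv ℝ G p (0, w)) = (w, (0 : V)) + (0, -fderiv ℝ G p (0, w)) by simp, map_add,
    map_zero_neg, two_smul, two_smul]
  abel

/-- The Bianchi identity. -/
lemma bianchi (S : IsLocalSpray W G) (hp : p ∈ W) (u v w : V) :
    (horDeriv G u (horCurv G v w) p
        + fderiv ℝ (fun q => fderiv ℝ G q (0, u)) p (0, horCurv G v w p))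
      + (horDeriv G v (horCurv G w u) p
        + fderiv ℝ (fun q => fderiv ℝ G q (0, v)) p (0, horCurv G w u p))
      + (horDeriv G w (horCurv G u v) p
        + fderiv ℝ (fun q => fderiv ℝ G q (0, w)) p (0, horCurv G u v p)) = 0 := by
  have hd : ∀ a b : V, DifferentiableAt ℝ (horDeriv G a (fun q => fderiv ℝ G q (0, b))) p :=
    fun a b => ((S.smooth_horDeriv (S.smooth_conn b) a).at S.isOpen hp).differentiableAt (by simp)
  have key : ∀ a b c : V, horDeriv G a (horCurv G b c) p =
      horDeriv G a (horDeriv G b (fun q => fderiv ℝ G q (0, c))) p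
      - horDeriv G a (horDeriv G c (fun q => fderiv ℝ G q (0, b))) p := by
    intro a b c
    change fderiv ℝ (horDeriv G b (fun q => fderiv ℝ G q (0, c))
      - horDeriv G c (fun q => fderiv ℝ G q (0, b))) p _ = _
    rw [fderiv_sub (hd b c) (hd c b)]
    rfl
  -- This is the Jacobi identity of horizontal lifts: the commutator relation is applied to the
  -- connection coefficients and summed cyclically.
  have h1 := S.horDeriv_comm (S.smooth_conn u) hp v w
  have h2 := S.horDeriv_comm (S.smooth_conn v) hp w u
  have h3 := S.horDeriv_comm (S.smooth_conn w) hp u v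
  rw [eq_neg_iff_add_eq_zero] at h1 h2 h3
  have h := congrArg₂ (· + ·) (congrArg₂ (· + ·) h1 h2) h3
  simp only [add_zero] at h
  rw [key, key, key]
  refine Eq.trans ?_ h
  abel

end IsLocalSpray

/-! ### Isotropic curvature -/

/-- The Riemann curvature of `G` on `W` is isotropic with curvature function `R`. -/
structure IsLocallyIsotropic (W : Set (V × V)) (G : V × V → V) (R : V × V → ℝ) : Prop where
  smooth : ContDiffOn ℝ ∞ R W
  hom : HomTwoOn W R
  curv : ∀ p ∈ W, ∀ w : V, horCurv G w p.2 p = R p • w - ((1 / 2 : ℝ) * fderiv ℝ R p (0, w)) • p.2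

namespace IsLocallyIsotropic

variable {R : V × V → ℝ}

/-- In the antisymmetrised vertical derivative of the isotropic Riemann curvature, the Hessian of
`R` cancels by symmetry. The other terms add up to 3/2 of the bracket, and `three_smul_horCurv`
divides by 3. -/
lemma horCurv_eq (S : IsLocalSpray W G) (I : IsLocallyIsotropic W G R) (hp : p ∈ W) (v w : V) :
    horCurv G v w p =
      (1 / 2 : ℝ) • (fderiv ℝ R p (0, w) • v - fderiv ℝ R p (0, v) • w) := by
  have hR := I.smooth.at S.isOpen hp
  have hRd := hR.differentiableAt (by simp)
  have key : ∀ a b : V, fderiv ℝ (fun q => horCurv G a q.2 q) p (0, b) =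
      fderiv ℝ R p (0, b) • a - (((1 / 2 : ℝ) * fderiv ℝ (fderiv ℝ R) p (0, b) (0, a)) • p.2
        + ((1 / 2 : ℝ) * fderiv ℝ R p (0, a)) • b) := by
    intro a b
    have hd : DifferentiableAt ℝ (fun q => fderiv ℝ R q (0, a)) p :=
      ((I.smooth.vert S.isOpen a).at S.isOpen hp).differentiableAt (by simp)
    rw [fderiv_congr_of_eqOn S.isOpen (fun q hq => I.curv q hq a) hp]
    have h1 : HasFDerivAt (fun q : V × V =>
        R q • a - ((1 / 2 : ℝ) * fderiv ℝ R q (0, a)) • q.2) _ p :=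
      (hRd.hasFDerivAt.smul_const a).sub ((hd.hasFDerivAt.const_mul (1 / 2 : ℝ)).smul
        (hasFDerivAt_snd (𝕜 := ℝ)))
    rw [h1.fderiv]
    simp [fderiv_fderiv_const hR]
    abel
  have h3 := S.three_smul_horCurv hp v w
  rw [key, key, fderiv_fderiv_symm hR] at h3
  have : horCurv G v w p = (1 / 3 : ℝ) • (3 : ℝ) • horCurv G v w p := by
    rw [smul_smul]; norm_num
  rw [this, h3]
  module

/-- A function that is horizontally constant has its vertical derivatives proportional to those
of the curvature function. -/
lemma mul_vert_eq (S : IsLocalSpray W G) (I : IsLocallyIsotropic W G R) {L : V × V → ℝ}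
    (hL : ContDiffOn ℝ ∞ L W) (hom : HomTwoOn W L) (hor : ∀ q ∈ W, ∀ w, horDeriv G w L q = 0)
    (hp : p ∈ W) (w : V) : R p * fderiv ℝ L p (0, w) = L p * fderiv ℝ R p (0, w) := by
  -- The left side vanishes. On the right, L is differentiated along the Riemann curvature of `w`,
  -- and Euler's relation evaluates its radial part.
  have h := S.horDeriv_comm hL hp w p.2
  have h0 : ∀ v, fderiv ℝ (horDeriv G v L) p = 0 := fun v => by
    rw [fderiv_congr_of_eqOn (g := fun _ => 0) S.isOpen (fun q hq => hor q hq v) hp]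
    simp
  rw [horDeriv, horDeriv, h0, h0, I.curv p hp] at h
  have h1 : ((0 : V), R p • w - ((1 / 2 : ℝ) * fderiv ℝ R p (0, w)) • p.2) =
    R p • (0, w) - ((1 / 2 : ℝ) * fderiv ℝ R p (0, w)) • (0, p.2) := by simp
  rw [h1, map_sub, map_smul, map_smul,
    hom.euler hp ((hL.at S.isOpen hp).differentiableAt (by simp))] at h
  simp only [zero_apply, sub_zero, smul_eq_mul] at h
  linarith

/-- Three linearly independent directions make the horizontal derivatives of the curvature
function symmetric. -/
lemma vert_horDeriv_symm (S : IsLocalSpray W G) (I : IsLocallyIsotropic W G R) (hp : p ∈ W)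
    (u v w : V) (φ : V →L[ℝ] ℝ) (hu : φ u = 0) (hv : φ v = 1) (hw : φ w = 0) :
    fderiv ℝ (horDeriv G u R) p (0, w) = fderiv ℝ (horDeriv G w R) p (0, u) := by
  have hR := I.smooth.at S.isOpen hp
  have hd : ∀ a : V, DifferentiableAt ℝ (fun q => fderiv ℝ R q (0, a)) p := fun a =>
      ((I.smooth.vert S.isOpen a).at S.isOpen hp).differentiableAt (by simp)
  have key : ∀ a b c : V, horDeriv G a (horCurv G b c) p =
      (1 / 2 : ℝ) • (horDeriv G a (fun q => fderiv ℝ R q (0, c)) p • b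
        - horDeriv G a (fun q => fderiv ℝ R q (0, b)) p • c) := by
    intro a b c
    rw [horDeriv, fderiv_congr_of_eqOn S.isOpen (fun q hq => I.horCurv_eq S hq b c) hp]
    have h1 : HasFDerivAt (fun q : V × V =>
        (1 / 2 : ℝ) • (fderiv ℝ R q (0, c) • b - fderiv ℝ R q (0, b) • c)) _ p :=
      (((hd c).hasFDerivAt.smul_const b).sub ((hd b).hasFDerivAt.smul_const c)).const_smul _
    rw [h1.fderiv]
    simp [horDeriv]
  have key2 : ∀ a b c : V, fderiv ℝ (fun q => fderiv ℝ G q (0, a)) p (0, horCurv G b c p) =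
      (1 / 2 : ℝ) • (fderiv ℝ R p (0, c) • fderiv ℝ (fun q => fderiv ℝ G q (0, a)) p (0, b)
        - fderiv ℝ R p (0, b) • fderiv ℝ (fun q => fderiv ℝ G q (0, a)) p (0, c)) := by
    intro a b c
    rw [I.horCurv_eq S hp]
    have : ((0 : V), (1 / 2 : ℝ) • (fderiv ℝ R p (0, c) • b - fderiv ℝ R p (0, b) • c)) =
      (1 / 2 : ℝ) • (fderiv ℝ R p (0, c) • ((0 : V), b) - fderiv ℝ R p (0, b) • (0, c)) := by
      simp
    rw [this, map_smul, map_sub, map_smul, map_smul]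
  -- Only the derivative terms whose vector is `v` survive `φ`. The Berwald terms cancel by symmetry
  -- whatever their `φ`-values are.
  have hb := congrArg φ (S.bianchi hp u v w)
  rw [key, key, key, key2, key2, key2, S.vert_conn_symm hp v u, S.vert_conn_symm hp w v,
    S.vert_conn_symm hp u w] at hb
  simp only [map_add, map_sub, map_smul, smul_eq_mul, hu, hv, hw, map_zero] at hb
  rw [S.vert_horDeriv I.smooth hp, S.vert_horDeriv I.smooth hp, S.vert_conn_symm hp u w]
  linarith

end IsLocallyIsotropic

/-! ### Euler–Lagrange equations -/

section EulerLagrange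

variable {L : V × V → ℝ}

/-- The Euler–Lagrange equations say that the vertical derivative of the derivative along the
spray equals twice the horizontal derivative. -/
lemma IsLocalSpray.vert_spray (S : IsLocalSpray W G) (hL : ContDiffOn ℝ ∞ L W) (hp : p ∈ W)
    (w : V) :
    fderiv ℝ (fun q => fderiv ℝ L q (q.2, -(2 : ℝ) • G q)) p (0, w) =
      fderiv ℝ (fun q => fderiv ℝ L q (0, w)) p (p.2, -(2 : ℝ) • G p)
        + fderiv ℝ L p (w, -(2 : ℝ) • fderiv ℝ G p (0, w)) := by
  have h := hL.at S.isOpen hp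
  have hG := (S.smooth.at S.isOpen hp).differentiableAt (by simp)
  have hB : HasFDerivAt (fun q : V × V => (q.2, -(2 : ℝ) • G q)) _ p :=
    (hasFDerivAt_snd (𝕜 := ℝ)).prodMk (hG.hasFDerivAt.const_smul (-(2 : ℝ)))
  rw [fderiv_fderiv_apply h hB.differentiableAt, fderiv_fderiv_const h, fderiv_fderiv_symm h,
    hB.fderiv]
  simp

/-- The Euler–Lagrange equations of `L`, contracted with `w`. -/
def EulerLagrange (G : V × V → V) (L : V × V → ℝ) (w : V) (p : V × V) : Prop :=
  fderiv ℝ (fun q => fderiv ℝ L q (0, w)) p (p.2, -(2 : ℝ) • G p) = fderiv ℝ L p (w, 0)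

lemma IsLocalSpray.horDeriv_eq (w : V) : horDeriv G w L p =
    fderiv ℝ L p (w, 0) - fderiv ℝ L p (0, fderiv ℝ G p (0, w)) := by
  rw [horDeriv, horLift, ← map_sub]
  simp

/-- The Euler–Lagrange equations hold if and only if `L` is horizontally constant. -/
theorem IsLocalSpray.eulerLagrange_iff (S : IsLocalSpray W G) (hL : ContDiffOn ℝ ∞ L W)
    (hom : HomTwoOn W L) :
    (∀ p ∈ W, ∀ w, EulerLagrange G L w p) ↔ ∀ p ∈ W, ∀ w, horDeriv G w L p = 0 := by
  have aux : ∀ p w, fderiv ℝ L p (w, -(2 : ℝ) • fderiv ℝ G p (0, w)) =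
      2 * horDeriv G w L p - fderiv ℝ L p (w, 0) := by
    intro p w
    rw [show (w, -(2 : ℝ) • fderiv ℝ G p (0, w)) =
      (2 : ℝ) • (w, -fderiv ℝ G p (0, w)) - (w, 0) by ext <;> simp [two_smul], map_sub, map_smul]
    rfl
  -- Once L is constant along the spray, the Euler-Lagrange defect is -2 times the horizontal
  -- derivative. Both directions then only have to establish that constancy.
  have main : (∀ q ∈ W, fderiv ℝ L q (q.2, -(2 : ℝ) • G q) = 0) → ∀ p ∈ W, ∀ w,
      fderiv ℝ (fun q => fderiv ℝ L q (0, w)) p (p.2, -(2 : ℝ) • G p) - fderiv ℝ L p (w, 0)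
        = -2 * horDeriv G w L p := by
    intro h p hp w
    have h1 := S.vert_spray hL hp w
    rw [fderiv_congr_of_eqOn (g := fun _ => 0) S.isOpen h hp, aux] at h1
    simp only [fderiv_fun_const, Pi.zero_apply, zero_apply] at h1
    linarith
  constructor
  · intro h
    -- Let s be the derivative of L along the spray. Differentiating the Euler relation along the
    -- spray and inserting the equations contracted with y gives s = 2s.
    have h0 : ∀ q ∈ W, fderiv ℝ L q (q.2, -(2 : ℝ) • G q) = 0 := by
      intro q hq
      have hLq := hL.at S.isOpen hq
      have h1 := DFunLike.congr_fun (fderiv_congr_of_eqOn (f := fun r => fderiv ℝ L r (0, r.2))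
        (g := fun r => (2 : ℝ) • L r) S.isOpen
        (fun r hr => hom.euler hr ((hL.at S.isOpen hr).differentiableAt (by simp))) hq)
        (q.2, -(2 : ℝ) • G q)
      rw [fderiv_fderiv_apply hLq (by fun_prop), fderiv_zero_snd,
        fderiv_fun_const_smul (hLq.differentiableAt (by simp)), ← fderiv_fderiv_const hLq,
        h q hq q.2, ← map_add] at h1
      simp only [Prod.mk_add_mk, add_zero, zero_add, smul_apply, smul_eq_mul] at h1
      linarith
    intro p hp w
    have := main h0 p hp w
    rw [h p hp w] at this
    linarith
  · intro h p hp w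
    have h0 : ∀ q ∈ W, fderiv ℝ L q (q.2, -(2 : ℝ) • G q) = 0 := by
      intro q hq
      rw [← S.horLift_self hq]
      exact h q hq q.2
    have := main h0 p hp w
    rw [h p hp w] at this
    exact sub_eq_zero.1 (by simpa using this)

end EulerLagrange

end LocalCurvature

/-! ### Composition operators on spaces of continuous maps -/

section Postcomp

universe u

variable {K : Type*} [TopologicalSpace K] [CompactSpace K]
  {X F : Type u} [NormedAddCommGroup X] [NormedSpace ℝ X]
  [NormedAddCommGroup F] [NormedSpace ℝ F]

/-- Pointwise evaluation of a continuous family of linear maps. -/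
def pointwiseEval (K X F : Type*) [TopologicalSpace K] [CompactSpace K]
    [NormedAddCommGroup X] [NormedSpace ℝ X] [NormedAddCommGroup F] [NormedSpace ℝ F] :
    C(K, X →L[ℝ] F) →L[ℝ] C(K, X) →L[ℝ] C(K, F) :=
  LinearMap.mkContinuous₂
    (LinearMap.mk₂ ℝ (fun (T : C(K, X →L[ℝ] F)) (h : C(K, X)) =>
        (⟨fun t => T t (h t), T.continuous.clm_apply h.continuous⟩ : C(K, F)))
      (fun _ _ _ => by ext; simp) (fun _ _ _ => by ext; simp) (fun _ _ _ => by ext; simp)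
      (fun _ _ _ => by ext; simp)) 1
    (fun T h => by
      rw [ContinuousMap.norm_le _ (by positivity)]
      intro t
      simp only [one_mul]
      exact (T t).le_of_opNorm_le_of_le (T.norm_coe_le_norm t) (h.norm_coe_le_norm t))

@[simp] lemma pointwiseEval_apply (T : C(K, X →L[ℝ] F)) (h : C(K, X)) (t : K) :
    pointwiseEval K X F T h t = T t (h t) := rfl

/-- Continuity of `f'` is uniform near the compact range of `γ`, so the mean value inequality bounds
the remainder by ε ‖γ' - γ‖ for all times at once. -/
lemma hasFDerivAt_postcomp {f : C(X, F)} {f' : C(X, X →L[ℝ] F)}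
    (hf : ∀ x, HasFDerivAt f (f' x) x) (γ : C(K, X)) :
    HasFDerivAt (fun γ : C(K, X) => f.comp γ) (pointwiseEval K X F (f'.comp γ)) γ := by
  rw [hasFDerivAt_iff_isLittleO, Asymptotics.isLittleO_iff]
  intro ε hε
  have huc := (isCompact_range γ.continuous).uniformContinuousAt_of_continuousAt f'
    (fun a _ => f'.continuous.continuousAt) (Metric.dist_mem_uniformity hε)
  obtain ⟨δ, hδ, H⟩ := Metric.mem_uniformity_dist.1 huc
  filter_upwards [Metric.ball_mem_nhds γ hδ] with γ' hγ'
  rw [ContinuousMap.norm_le _ (by positivity)]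
  intro t
  have hd : ‖γ' t - γ t‖ ≤ ‖γ' - γ‖ := (γ' - γ).norm_coe_le_norm t
  have hlt : dist (γ' t) (γ t) < δ := (ContinuousMap.dist_apply_le_dist t).trans_lt hγ'
  have := (convex_ball (γ t) δ).norm_image_sub_le_of_norm_fderiv_le' (𝕜 := ℝ) (f := f)
    (φ := f' (γ t)) (C := ε) (fun x _ => (hf x).differentiableAt)
    (fun x hx => by
      rw [(hf x).fderiv, ← dist_eq_norm, dist_comm]
      exact (H (by rwa [dist_comm] : dist (γ t) x < δ) (mem_range_self t)).le)
    (Metric.mem_ball_self hδ) (Metric.mem_ball.2 hlt)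
  refine this.trans ?_
  gcongr

/-- The derivative of postcomposition with `f` is postcomposition with `fderiv ℝ f` followed by a
bounded linear map, so induction applies with a new target space. This is why `F` is quantified
inside and shares the universe of `X`. -/
lemma contDiff_nat_postcomp (m : ℕ) : ∀ {F : Type u} [NormedAddCommGroup F] [NormedSpace ℝ F]
    {f : C(X, F)}, ContDiff ℝ ∞ f → ContDiff ℝ m (fun γ : C(K, X) => f.comp γ) := by
  induction m with
  | zero =>
    intro F _ _ f _
    exact contDiff_zero.2 (ContinuousMap.continuous_postcomp f)
  | succ m ih =>
    intro F _ _ f hf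
    have h' : ContDiff ℝ ∞ (fderiv ℝ f) := hf.fderiv_right (by simp)
    let f' : C(X, X →L[ℝ] F) := ⟨fderiv ℝ f, h'.continuous⟩
    have hf' : ContDiff ℝ ∞ f' := h'
    refine contDiff_succ_iff_hasFDerivAt.2 ⟨fun γ => pointwiseEval K X F (f'.comp γ), ?_,
      fun γ => hasFDerivAt_postcomp (fun x => (hf.differentiable (by simp) x).hasFDerivAt) γ⟩
    exact (pointwiseEval K X F).contDiff.comp (ih hf')

/-- Composition with a smooth map is a smooth operator on continuous maps. -/
theorem contDiff_postcomp {f : C(X, F)} (hf : ContDiff ℝ ∞ f) :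
    ContDiff ℝ ∞ (fun γ : C(K, X) => f.comp γ) :=
  contDiff_infty.2 fun m => contDiff_nat_postcomp m hf

end Postcomp

/-! ### Primitives of continuous curves -/

section Primitive

/-- The extension of a curve on `[0, 1]` by its end points. -/
def extendCurve {V : Type*} [TopologicalSpace V] (γ : C(Icc (0 : ℝ) 1, V)) : ℝ → V :=
  IccExtend zero_le_one γ

lemma continuous_extendCurve {V : Type*} [TopologicalSpace V] (γ : C(Icc (0 : ℝ) 1, V)) :
    Continuous (extendCurve γ) :=
  γ.continuous.Icc_extend'

lemma extendCurve_coe {V : Type*} [TopologicalSpace V] (γ : C(Icc (0 : ℝ) 1, V))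
    (t : Icc (0 : ℝ) 1) : extendCurve γ t = γ t := IccExtend_val _ _ _

variable {V : Type*} [NormedAddCommGroup V] [NormedSpace ℝ V] [CompleteSpace V]

open MeasureTheory

/-- The primitive that vanishes at `0`. -/
def primitive (V : Type*) [NormedAddCommGroup V] [NormedSpace ℝ V] [CompleteSpace V] :
    C(Icc (0 : ℝ) 1, V) →L[ℝ] C(Icc (0 : ℝ) 1, V) :=
  LinearMap.mkContinuous
    { toFun := fun u => ⟨fun t => ∫ s in (0 : ℝ)..t, extendCurve u s,
        (intervalIntegral.continuous_primitive
          (fun _ _ => (continuous_extendCurve u).intervalIntegrable _ _) 0).comp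
          continuous_subtype_val⟩
      map_add' := fun u v => by
        ext t
        simp only [ContinuousMap.coe_mk, ContinuousMap.add_apply]
        rw [← intervalIntegral.integral_add
          ((continuous_extendCurve u).intervalIntegrable _ _)
          ((continuous_extendCurve v).intervalIntegrable _ _)]
        rfl
      map_smul' := fun c u => by
        ext t
        simp only [ContinuousMap.coe_mk, ContinuousMap.smul_apply, RingHom.id_apply]
        rw [← intervalIntegral.integral_smul]
        rfl } 1
    (fun u => by
      rw [ContinuousMap.norm_le _ (by positivity)]
      intro t
      have h := intervalIntegral.norm_integral_le_of_norm_le_const (a := 0) (b := (t : ℝ))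
        (f := extendCurve u) (C := ‖u‖) (fun s _ => u.norm_coe_le_norm _)
      refine h.trans ?_
      rw [mul_comm, sub_zero, abs_of_nonneg t.2.1]
      gcongr
      exact t.2.2)

lemma primitive_apply (u : C(Icc (0 : ℝ) 1, V)) (t : Icc (0 : ℝ) 1) :
    primitive V u t = ∫ s in (0 : ℝ)..t, extendCurve u s := rfl

lemma hasDerivAt_extendCurve_primitive (u : C(Icc (0 : ℝ) 1, V)) {t : ℝ} (ht : t ∈ Ioo (0 : ℝ) 1) :
    HasDerivAt (extendCurve (primitive V u)) (extendCurve u t) t := by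
  have h := intervalIntegral.integral_hasDerivAt_right
    ((continuous_extendCurve u).intervalIntegrable 0 t)
    ((continuous_extendCurve u).stronglyMeasurableAtFilter _ _)
    (continuous_extendCurve u).continuousAt
  refine h.congr_of_eventuallyEq ?_
  filter_upwards [Ioo_mem_nhds ht.1 ht.2] with s hs
  exact (extendCurve_coe _ ⟨s, hs.1.le, hs.2.le⟩).trans (primitive_apply _ _)

lemma eq_primitive_of_hasDerivAt {ζ u : C(Icc (0 : ℝ) 1, V)} (h0 : ζ 0 = 0)
    (h : ∀ t ∈ Ioo (0 : ℝ) 1, HasDerivAt (extendCurve ζ) (extendCurve u t) t) :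
    ζ = primitive V u := by
  ext t
  rw [primitive_apply, intervalIntegral.integral_eq_sub_of_hasDerivAt_of_le t.2.1
    (continuous_extendCurve ζ).continuousOn
    (fun x hx => h x ⟨hx.1, hx.2.trans_le t.2.2⟩)
    ((continuous_extendCurve u).intervalIntegrable _ _), extendCurve_coe]
  have := extendCurve_coe ζ 0
  rw [h0] at this
  simp only [Icc.coe_zero] at this
  rw [this, sub_zero]

end Primitive

/-! ### Cut-off -/

section Cutoff

variable {X F : Type*} [NormedAddCommGroup X] [NormedSpace ℝ X] [FiniteDimensional ℝ X]
  [NormedAddCommGroup F] [NormedSpace ℝ F]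

/-- A bump function makes a locally defined map globally smooth, as required for it to act by
composition on the whole space of curves. -/
lemma exists_contDiff_eventuallyEq {f : X → F} {W : Set X} (hW : IsOpen W)
    (hf : ContDiffOn ℝ ∞ f W) {p : X} (hp : p ∈ W) :
    ∃ g : X → F, ContDiff ℝ ∞ g ∧ g =ᶠ[𝓝 p] f := by
  obtain ⟨r, hr, hrW⟩ := Metric.isOpen_iff.1 hW p hp
  let χ : ContDiffBump p := ⟨r / 3, r / 2, by positivity, by linarith⟩
  refine ⟨fun x => χ x • f x, contDiff_iff_contDiffAt.2 fun x => ?_, ?_⟩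
  · by_cases hx : x ∈ W
    · exact χ.contDiff.contDiffAt.smul (hf.contDiffAt (hW.mem_nhds hx))
    · have hx' : x ∉ tsupport χ := by
        rw [χ.tsupport_eq]
        intro h
        refine hx (hrW ?_)
        rw [Metric.mem_closedBall] at h
        exact Metric.mem_ball.2 (h.trans_lt (by change r / 2 < r; linarith))
      have : (fun x => χ x • f x) =ᶠ[𝓝 x] fun _ => 0 := by
        filter_upwards [notMem_tsupport_iff_eventuallyEq.1 hx'] with y hy
        simp [hy]
      exact contDiffAt_const.congr_of_eventuallyEq this
  · filter_upwards [χ.eventuallyEq_one] with x hx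
    simp [hx]

end Cutoff

/-! ### The Frobenius theorem for graphs -/

section Frobenius

universe u

variable {V : Type u} [NormedAddCommGroup V] [NormedSpace ℝ V]

/-- If `D q` is within distance less than 1 of the identity, then `D q h = 0` gives ‖h‖ ≤ ‖D q - id‖
‖h‖, which forces h = 0. -/
lemma eventually_injective_of_continuousAt {P Z : Type*} [TopologicalSpace P]
    [NormedAddCommGroup Z] [NormedSpace ℝ Z] {D : P → Z →L[ℝ] Z} {p : P} (hc : ContinuousAt D p)
    (hD : D p = ContinuousLinearMap.id ℝ Z) : ∀ᶠ q in 𝓝 p, ∀ h, D q h = 0 → h = 0 := by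
  filter_upwards [Metric.continuousAt_iff'.1 hc 1 one_pos] with q hq h hh
  rw [hD, dist_eq_norm] at hq
  have hle := (D q - ContinuousLinearMap.id ℝ Z).le_opNorm h
  simp only [sub_apply, hh, ContinuousLinearMap.id_apply, zero_sub, norm_neg] at hle
  by_contra hne
  have : 0 < ‖h‖ := norm_pos_iff.2 hne
  nlinarith

/-- The inverse of a local diffeomorphism is smooth near each point. -/
lemma eventually_contDiffAt_symm {X Y : Type*} [NormedAddCommGroup X] [NormedSpace ℝ X]
    [CompleteSpace X] [NormedAddCommGroup Y] [NormedSpace ℝ Y] (e : OpenPartialHomeomorph X Y)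
    {a : X} (ha : a ∈ e.source) (he : ∀ᶠ x in 𝓝 a, ContDiffAt ℝ ∞ e x) {T : X ≃L[ℝ] Y}
    (hT : HasFDerivAt e (T : X →L[ℝ] Y) a) : ∀ᶠ b in 𝓝 (e a), ContDiffAt ℝ ∞ e.symm b := by
  have hc : ContinuousAt (fderiv ℝ e) a :=
    (he.self_of_nhds.fderiv_right (m := ∞) (by simp)).continuousAt
  have h1 : ∀ᶠ x in 𝓝 a, fderiv ℝ e x ∈ range ((↑) : (X ≃L[ℝ] Y) → X →L[ℝ] Y) := by
    refine hc.eventually ?_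
    rw [hT.fderiv]
    exact ContinuousLinearEquiv.nhds T
  have hs : Filter.Tendsto e.symm (𝓝 (e a)) (𝓝 a) := by
    have := e.continuousAt_symm (e.map_source ha)
    rwa [ContinuousAt, e.left_inv ha] at this
  filter_upwards [hs.eventually he, hs.eventually h1, e.open_target.mem_nhds (e.map_source ha)]
    with b hb1 ⟨T', hT'⟩ hb
  refine e.contDiffAt_symm hb (f₀' := T') ?_ hb1
  rw [hT']
  exact (hb1.differentiableAt (by simp)).hasFDerivAt

/-- The linear part of the map that sends `((v, z), γ)` to the curve `((x₀ + t v, γ(t)), v)`. -/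
def curveLin (V : Type*) [NormedAddCommGroup V] [NormedSpace ℝ V] :
    ((V × V) × C(Icc (0 : ℝ) 1, V)) →L[ℝ] C(Icc (0 : ℝ) 1, (V × V) × V) :=
  LinearMap.mkContinuous
    { toFun := fun X => ⟨fun t => (((t : ℝ) • X.1.1, X.2 t), X.1.1), by fun_prop⟩
      map_add' := fun X Y => by ext t <;> simp
      map_smul' := fun c X => by ext t <;> simp [smul_comm (t : ℝ) c] } 1
    (fun X => by
      rw [ContinuousMap.norm_le _ (by positivity)]
      intro t
      have h1 : ‖X.1.1‖ ≤ ‖X‖ := (norm_fst_le X.1).trans (norm_fst_le X)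
      have h2 : ‖X.2 t‖ ≤ ‖X‖ := (X.2.norm_coe_le_norm t).trans (norm_snd_le X)
      simp only [one_mul, Prod.norm_def, LinearMap.coe_mk, AddHom.coe_mk, ContinuousMap.coe_mk]
        at *
      refine max_le (max_le ?_ h2) h1
      rw [norm_smul, Real.norm_of_nonneg t.2.1]
      exact (mul_le_of_le_one_left (norm_nonneg _) t.2.2).trans h1)

/-- Constant curves. -/
def constCurve (V : Type*) [NormedAddCommGroup V] [NormedSpace ℝ V] :
    V →L[ℝ] C(Icc (0 : ℝ) 1, V) :=
  LinearMap.mkContinuous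
    { toFun := fun z => ContinuousMap.const _ z
      map_add' := fun _ _ => by ext; simp
      map_smul' := fun _ _ => by ext; simp } 1
    (fun z => by
      rw [ContinuousMap.norm_le _ (by positivity)]
      intro t
      simp)

@[simp] lemma curveLin_apply (X : (V × V) × C(Icc (0 : ℝ) 1, V)) (t : Icc (0 : ℝ) 1) :
    curveLin V X t = (((t : ℝ) • X.1.1, X.2 t), X.1.1) := rfl

@[simp] lemma constCurve_apply (z : V) (t : Icc (0 : ℝ) 1) : constCurve V z t = z := rfl

/-- The curve `((x₀ + t v, γ(t)), v)`. -/
def curveMap (x₀ : V) (X : (V × V) × C(Icc (0 : ℝ) 1, V)) : C(Icc (0 : ℝ) 1, (V × V) × V) :=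
  ContinuousMap.const _ ((x₀, 0), 0) + curveLin V X

@[simp] lemma curveMap_apply (x₀ : V) (X : (V × V) × C(Icc (0 : ℝ) 1, V)) (t : Icc (0 : ℝ) 1) :
    curveMap x₀ X t = ((x₀ + (t : ℝ) • X.1.1, X.2 t), X.1.1) := by
  simp [curveMap]

lemma hasFDerivAt_curveMap (x₀ : V) (X : (V × V) × C(Icc (0 : ℝ) 1, V)) :
    HasFDerivAt (curveMap x₀) (curveLin V) X :=
  (curveLin V).hasFDerivAt.const_add _

lemma contDiff_curveMap (x₀ : V) : ContDiff ℝ ∞ (curveMap x₀) :=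
  contDiff_const.add (curveLin V).contDiff

lemma fderiv_clm_apply_prod {A : V × V → V →L[ℝ] V} (hA : ContDiff ℝ ∞ A)
    {Q : C((V × V) × V, V)} {Q' : C((V × V) × V, (V × V) × V →L[ℝ] V)}
    (hQ : ∀ q, HasFDerivAt Q (Q' q) q) (hQA : ∀ q v, Q (q, v) = A q v) (q : V × V) (v : V)
    (a : V × V) (w : V) : Q' (q, v) (a, w) = fderiv ℝ A q a v + A q w := by
  have h1 : HasFDerivAt (fun r : (V × V) × V => A r.1 r.2) _ (q, v) :=
    ((hA.differentiable (by simp) q).hasFDerivAt.comp (q, v)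
      (hasFDerivAt_fst (𝕜 := ℝ) (p := (q, v)))).clm_apply (hasFDerivAt_snd (𝕜 := ℝ))
  have h2 : (fun r : (V × V) × V => A r.1 r.2) = Q := funext fun r => (hQA r.1 r.2).symm
  rw [h2] at h1
  rw [(hQ (q, v)).unique h1]
  simp [add_comm]

variable [CompleteSpace V]

/-- The integral equation of parallel transport along the segment from `x₀` to `x₀ + v`. -/
def transportDefect (Q : C((V × V) × V, V)) (x₀ : V) (X : (V × V) × C(Icc (0 : ℝ) 1, V)) :
    C(Icc (0 : ℝ) 1, V) :=
  X.2 - constCurve V X.1.2 - primitive V (Q.comp (curveMap x₀ X))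

lemma contDiff_transportDefect {Q : C((V × V) × V, V)} (hQ : ContDiff ℝ ∞ Q) (x₀ : V) :
    ContDiff ℝ ∞ (transportDefect Q x₀) :=
  (contDiff_snd.sub ((constCurve V).contDiff.comp (contDiff_snd.comp contDiff_fst))).sub
    ((primitive V).contDiff.comp ((contDiff_postcomp hQ).comp (contDiff_curveMap x₀)))

lemma fderiv_transportDefect {Q : C((V × V) × V, V)} {Q' : C((V × V) × V, (V × V) × V →L[ℝ] V)}
    (hQ : ∀ q, HasFDerivAt Q (Q' q) q) (x₀ : V) (X Y : (V × V) × C(Icc (0 : ℝ) 1, V)) :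
    fderiv ℝ (transportDefect Q x₀) X Y = Y.2 - constCurve V Y.1.2
      - primitive V (pointwiseEval _ _ _ (Q'.comp (curveMap x₀ X)) (curveLin V Y)) := by
  have h1 : HasFDerivAt (fun X : (V × V) × C(Icc (0 : ℝ) 1, V) => constCurve V X.1.2) _ X :=
    (constCurve V).hasFDerivAt.comp X (hasFDerivAt_snd.comp X (hasFDerivAt_fst (𝕜 := ℝ)))
  have h2 : HasFDerivAt (fun X => Q.comp (curveMap x₀ X)) _ X :=
    (hasFDerivAt_postcomp hQ (curveMap x₀ X)).comp X (hasFDerivAt_curveMap x₀ X)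
  have h3 : HasFDerivAt (fun X => primitive V (Q.comp (curveMap x₀ X))) _ X :=
    (primitive V).hasFDerivAt.comp X h2
  have h : HasFDerivAt (transportDefect Q x₀) _ X :=
    ((hasFDerivAt_snd (𝕜 := ℝ)).sub h1).sub h3
  rw [h.fderiv]
  rfl

lemma transportDefect_zero {Q : C((V × V) × V, V)} (hQ : ∀ q, Q (q, 0) = 0) (x₀ z : V)
    (γ : C(Icc (0 : ℝ) 1, V)) : transportDefect Q x₀ ((0, z), γ) = γ - constCurve V z := by
  have : Q.comp (curveMap x₀ ((0, z), γ)) = 0 := by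
    ext t
    simp [hQ]
  simp [transportDefect, this]

lemma hasDerivAt_of_transportDefect_eq_zero {Q : C((V × V) × V, V)} {x₀ : V}
    {X : (V × V) × C(Icc (0 : ℝ) 1, V)} (h : transportDefect Q x₀ X = 0) {t : ℝ}
    (ht : t ∈ Ioo (0 : ℝ) 1) :
    HasDerivAt (extendCurve X.2) (Q ((x₀ + t • X.1.1, extendCurve X.2 t), X.1.1)) t := by
  rw [transportDefect, sub_sub, sub_eq_zero] at h
  have h3 := (hasDerivAt_extendCurve_primitive (Q.comp (curveMap x₀ X)) ht).const_add X.1.2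
  have h4 : extendCurve X.2 =
      fun s => X.1.2 + extendCurve (primitive V (Q.comp (curveMap x₀ X))) s := by
    funext s
    conv_lhs => rw [h]
    rfl
  rw [← h4] at h3
  refine h3.congr_deriv ?_
  have e1 := extendCurve_coe (Q.comp (curveMap x₀ X)) ⟨t, ht.1.le, ht.2.le⟩
  have e2 := extendCurve_coe X.2 ⟨t, ht.1.le, ht.2.le⟩
  rw [e1, e2, ContinuousMap.comp_apply, curveMap_apply]

/-- For a flat connection, the connection solves the linearized transport equation. -/
lemma exists_fderiv_transportDefect_eq_zero {A : V × V → V →L[ℝ] V} (hA : ContDiff ℝ ∞ A)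
    {Q : C((V × V) × V, V)} {Q' : C((V × V) × V, (V × V) × V →L[ℝ] V)}
    (hQ : ∀ q, HasFDerivAt Q (Q' q) q) (hQA : ∀ q v, Q (q, v) = A q v) (x₀ : V)
    {X : (V × V) × C(Icc (0 : ℝ) 1, V)} (h : transportDefect Q x₀ X = 0)
    (flat : ∀ t : Icc (0 : ℝ) 1, ∀ v w : V,
      fderiv ℝ A (x₀ + (t : ℝ) • X.1.1, X.2 t) (v, A (x₀ + (t : ℝ) • X.1.1, X.2 t) v) w =
        fderiv ℝ A (x₀ + (t : ℝ) • X.1.1, X.2 t) (w, A (x₀ + (t : ℝ) • X.1.1, X.2 t) w) v)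
    (w : V) :
    ∃ ζ : C(Icc (0 : ℝ) 1, V),
      (∀ t : Icc (0 : ℝ) 1, ζ t = (t : ℝ) • A (x₀ + (t : ℝ) • X.1.1, X.2 t) w) ∧
      fderiv ℝ (transportDefect Q x₀) X ((w, 0), ζ) = 0 := by
  have hAc := hA.continuous
  -- When the velocity moves by `w`, the base point at time t moves by t w, so a flat connection
  -- should displace the curve by t A w.
  let ζ : C(Icc (0 : ℝ) 1, V) :=
    ⟨fun t => (t : ℝ) • A (x₀ + (t : ℝ) • X.1.1, X.2 t) w, by fun_prop⟩
  refine ⟨ζ, fun _ => rfl, ?_⟩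
  rw [fderiv_transportDefect hQ, map_zero, sub_zero, sub_eq_zero]
  refine eq_primitive_of_hasDerivAt (by simp [ζ]) fun t ht => ?_
  have hΓd := hasDerivAt_of_transportDefect_eq_zero h ht
  have hline : HasDerivAt (fun s : ℝ => x₀ + s • X.1.1) X.1.1 t := by
    simpa using ((hasDerivAt_id t).smul_const X.1.1).const_add x₀
  have hAd : HasDerivAt (fun s => A (x₀ + s • X.1.1, extendCurve X.2 s)) _ t :=
    HasFDerivAt.comp_hasDerivAt (l := A) t
      (hA.differentiable (by simp) (x₀ + t • X.1.1, extendCurve X.2 t)).hasFDerivAt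
      (hline.prodMk hΓd)
  have hz : HasDerivAt (fun s => s • A (x₀ + s • X.1.1, extendCurve X.2 s) w) _ t :=
    (hasDerivAt_id t).smul (hAd.clm_apply (hasDerivAt_const t w))
  have heq : extendCurve ζ =ᶠ[𝓝 t] fun s => s • A (x₀ + s • X.1.1, extendCurve X.2 s) w := by
    filter_upwards [Ioo_mem_nhds ht.1 ht.2] with s hs
    have e1 := extendCurve_coe ζ ⟨s, hs.1.le, hs.2.le⟩
    have e2 := extendCurve_coe X.2 ⟨s, hs.1.le, hs.2.le⟩
    rw [e1, e2]
    rfl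
  refine (hz.congr_of_eventuallyEq heq).congr_deriv ?_
  have e1 := extendCurve_coe (pointwiseEval _ _ _ (Q'.comp (curveMap x₀ X))
    (curveLin V ((w, 0), ζ))) ⟨t, ht.1.le, ht.2.le⟩
  have e2 := extendCurve_coe X.2 ⟨t, ht.1.le, ht.2.le⟩
  rw [e1, e2, pointwiseEval_apply, ContinuousMap.comp_apply, curveMap_apply, curveLin_apply,
    fderiv_clm_apply_prod hA hQ hQA]
  -- Flatness exchanges the two directions in the derivative of `A`, turning the product rule for t
  -- A w into the linearised transport equation.
  have hf := flat ⟨t, ht.1.le, ht.2.le⟩ X.1.1 w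
  have hζ : ζ ⟨t, ht.1.le, ht.2.le⟩ = t • A (x₀ + t • X.1.1, X.2 ⟨t, ht.1.le, ht.2.le⟩) w := rfl
  simp only at hf ⊢
  rw [hζ, ← Prod.smul_mk, map_smul, smul_apply, ← hf, hQA]
  simp [add_comm]

/-- Parallel transport along segments is smooth, and for a flat connection its derivative in the
direction of the base is the connection. -/
theorem exists_parallel_transport {A : V × V → V →L[ℝ] V} (hA : ContDiff ℝ ∞ A) (x₀ y₀ : V)
    (flat : ∀ᶠ p in 𝓝 (x₀, y₀), ∀ v w : V,
      fderiv ℝ A p (v, A p v) w = fderiv ℝ A p (w, A p w) v) :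
    ∃ Ψ : V × V → V, (∀ᶠ q in 𝓝 ((0 : V), y₀), ContDiffAt ℝ ∞ Ψ q) ∧ (∀ᶠ z in 𝓝 y₀, Ψ (0, z) = z) ∧
      ∀ᶠ q in 𝓝 ((0 : V), y₀), ∀ w : V, fderiv ℝ Ψ q (w, 0) = A (x₀ + q.1, Ψ q) w := by
  have hQs : ContDiff ℝ ∞ (fun q : (V × V) × V => A q.1 q.2) :=
    (hA.comp contDiff_fst).clm_apply contDiff_snd
  let Q : C((V × V) × V, V) := ⟨fun q => A q.1 q.2, hQs.continuous⟩
  let Q' : C((V × V) × V, (V × V) × V →L[ℝ] V) :=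
    ⟨fderiv ℝ Q, (hQs.continuous_fderiv (by simp))⟩
  have hQ : ContDiff ℝ ∞ Q := hQs
  have hQ' : ∀ q, HasFDerivAt Q (Q' q) q := fun q => (hQ.differentiable (by simp) q).hasFDerivAt
  have hQ'a : ∀ q v a w, Q' (q, v) (a, w) = fderiv ℝ A q a v + A q w :=
    fderiv_clm_apply_prod hA hQ' (fun _ _ => rfl)
  have hQ0 : ∀ q, Q (q, 0) = 0 := fun q => by simp [Q]
  set H := transportDefect Q x₀ with hH
  have hHs : ContDiff ℝ ∞ H := contDiff_transportDefect hQ x₀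
  set X₀ : (V × V) × C(Icc (0 : ℝ) 1, V) := ((0, y₀), constCurve V y₀) with hX₀
  -- With zero velocity the integral term does not see the curve, so the curve block of the
  -- differential is the identity.
  have hid : ∀ h, fderiv ℝ H X₀ (0, h) = h := by
    intro h
    rw [hH, fderiv_transportDefect hQ']
    have : pointwiseEval _ _ _ (Q'.comp (curveMap x₀ X₀)) (curveLin V (0, h)) = 0 := by
      ext t
      simp [hX₀, hQ'a]
    rw [this]
    simp
  have hinr : (fderiv ℝ H X₀).comp (.inr ℝ (V × V) C(Icc (0 : ℝ) 1, V)) =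
      ContinuousLinearMap.id ℝ _ := by
    ext1 h
    simpa using hid h
  have hH0 : H X₀ = 0 := by
    rw [hH, hX₀, transportDefect_zero hQ0, sub_self]
  -- The implicit function theorem is obtained by inverting this triangular map. Smooth dependence
  -- of the transported curve on velocity and initial value follows without a separate theorem on
  -- differential equations.
  let Θ : (V × V) × C(Icc (0 : ℝ) 1, V) → (V × V) × C(Icc (0 : ℝ) 1, V) := fun X => (X.1, H X)
  have hΘs : ContDiff ℝ ∞ Θ := contDiff_fst.prodMk hHs
  have hΘ' : HasFDerivAt Θ ((ContinuousLinearMap.fst ℝ _ _).prod (fderiv ℝ H X₀)) X₀ :=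
    hasFDerivAt_fst.prodMk (hHs.differentiable (by simp) X₀).hasFDerivAt
  have hsplit : ∀ a : (V × V) × C(Icc (0 : ℝ) 1, V),
      fderiv ℝ H X₀ a = fderiv ℝ H X₀ (a.1, 0) + a.2 := by
    intro a
    conv_rhs => rw [← hid a.2, ← map_add]
    simp
  let T : ((V × V) × C(Icc (0 : ℝ) 1, V)) ≃L[ℝ] ((V × V) × C(Icc (0 : ℝ) 1, V)) :=
    ContinuousLinearEquiv.equivOfInverse
      ((ContinuousLinearMap.fst ℝ _ _).prod (fderiv ℝ H X₀))
      ((ContinuousLinearMap.fst ℝ _ _).prod (ContinuousLinearMap.snd ℝ _ _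
        - (fderiv ℝ H X₀).comp ((ContinuousLinearMap.inl ℝ _ _).comp
          (ContinuousLinearMap.fst ℝ _ _))))
      (fun a => by
        refine Prod.ext rfl ?_
        change fderiv ℝ H X₀ a - fderiv ℝ H X₀ (a.1, 0) = a.2
        rw [hsplit a, add_sub_cancel_left])
      (fun a => by
        refine Prod.ext rfl ?_
        change fderiv ℝ H X₀ (a.1, a.2 - fderiv ℝ H X₀ (a.1, 0)) = a.2
        rw [hsplit, add_sub_cancel])
  have hT : HasFDerivAt Θ (T : (V × V) × C(Icc (0 : ℝ) 1, V) →L[ℝ] _) X₀ := hΘ'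
  let e := hΘs.contDiffAt.toOpenPartialHomeomorph Θ hT (by simp)
  have he : X₀ ∈ e.source := hΘs.contDiffAt.mem_toOpenPartialHomeomorph_source hT (by simp)
  have heX : e X₀ = ((0, y₀), 0) := by
    change Θ X₀ = _
    exact Prod.ext rfl hH0
  have hes : ∀ᶠ b in 𝓝 (((0 : V), y₀), (0 : C(Icc (0 : ℝ) 1, V))), ContDiffAt ℝ ∞ e.symm b := by
    rw [← heX]
    exact eventually_contDiffAt_symm e he (Filter.Eventually.of_forall fun x => hΘs.contDiffAt) hT
  have hι : Filter.Tendsto (fun q : V × V => (q, (0 : C(Icc (0 : ℝ) 1, V)))) (𝓝 (0, y₀))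
      (𝓝 ((0, y₀), 0)) := (Continuous.prodMk_left _).tendsto _
  let Γ : V × V → C(Icc (0 : ℝ) 1, V) := fun q => (e.symm (q, 0)).2
  have hΓe : ∀ᶠ q in 𝓝 ((0 : V), y₀), ContDiffAt ℝ ∞ Γ q := by
    filter_upwards [hι.eventually hes] with q hq
    exact contDiffAt_snd.comp q (hq.comp q (contDiffAt_id.prodMk contDiffAt_const))
  have hΓs : ContDiffAt ℝ ∞ Γ (0, y₀) := hΓe.self_of_nhds
  have hΓ0 : Γ (0, y₀) = constCurve V y₀ := by
    change (e.symm ((0, y₀), 0)).2 = _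
    rw [← heX, e.left_inv he]
  have hΓ : ∀ᶠ q in 𝓝 ((0 : V), y₀), H (q, Γ q) = 0 := by
    have htar : ∀ᶠ b in 𝓝 (((0 : V), y₀), (0 : C(Icc (0 : ℝ) 1, V))), Θ (e.symm b) = b := by
      rw [← heX]
      exact e.eventually_right_inverse (e.map_source he)
    filter_upwards [hι.eventually htar] with q hq
    have h1 : (e.symm (q, 0)).1 = q := congrArg Prod.fst hq
    have h2 : H (e.symm (q, 0)) = 0 := congrArg Prod.snd hq
    have h3 : (q, Γ q) = e.symm (q, 0) := Prod.ext h1.symm rfl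
    rw [h3, h2]
  -- The transport is the value of the solution curve at time 1.
  let ev : C(Icc (0 : ℝ) 1, V) →L[ℝ] V := ContinuousMap.evalCLM ℝ 1
  have hXc : ContinuousAt (fun q => (q, Γ q)) ((0 : V), y₀) :=
    continuousAt_id.prodMk hΓs.continuousAt
  refine ⟨fun q => ev (Γ q), hΓe.mono fun q hq => ev.contDiff.contDiffAt.comp q hq, ?_, ?_⟩
  · have hc : Filter.Tendsto (fun z : V => ((0 : V), z)) (𝓝 y₀) (𝓝 (0, y₀)) :=
      (Continuous.prodMk_right (0 : V)).tendsto y₀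
    filter_upwards [hc.eventually hΓ] with z hz
    rw [hH, transportDefect_zero hQ0, sub_eq_zero] at hz
    rw [hz]
    rfl
  -- the linearized equation is uniquely solvable near the base point
  have hinj : ∀ᶠ q in 𝓝 ((0 : V), y₀), ∀ h, fderiv ℝ H (q, Γ q) (0, h) = 0 → h = 0 := by
    have hc : ContinuousAt (fun q : V × V => (fderiv ℝ H (q, Γ q)).comp
        (.inr ℝ (V × V) C(Icc (0 : ℝ) 1, V))) (0, y₀) := by
      have h1 : ContinuousAt (fderiv ℝ H) ((0, y₀), Γ (0, y₀)) :=
        (hHs.continuous_fderiv (by simp)).continuousAt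
      exact (ContinuousAt.comp (f := fun q => (q, Γ q)) (x := ((0 : V), y₀)) h1 hXc).clm_comp
        continuousAt_const
    filter_upwards [eventually_injective_of_continuousAt hc (by rw [hΓ0]; exact hinr)]
      with q hq h hh using hq h (by simpa using hh)
  have hflat : ∀ᶠ q in 𝓝 ((0 : V), y₀), ∀ t : Icc (0 : ℝ) 1, ∀ v w : V,
      fderiv ℝ A (x₀ + (t : ℝ) • q.1, Γ q t) (v, A (x₀ + (t : ℝ) • q.1, Γ q t) v) w =
        fderiv ℝ A (x₀ + (t : ℝ) • q.1, Γ q t) (w, A (x₀ + (t : ℝ) • q.1, Γ q t) w) v := by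
    -- Flatness is only known near the base point. Compactness of the time interval keeps the whole
    -- curve in `O` for nearby data.
    obtain ⟨O, hO, hOo, hOm⟩ := eventually_nhds_iff.1 flat
    have hc : ContinuousAt (fun q => curveMap x₀ (q, Γ q)) ((0 : V), y₀) :=
      ContinuousAt.comp (f := fun q => (q, Γ q)) (x := ((0 : V), y₀))
        (contDiff_curveMap x₀).continuous.continuousAt hXc
    have hm : MapsTo (curveMap x₀ ((0, y₀), Γ (0, y₀))) univ (Prod.fst ⁻¹' O) := by
      intro t _
      simpa [hΓ0] using hOm
    have := hc.eventually (ContinuousMap.eventually_mapsTo isCompact_univ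
      (hOo.preimage continuous_fst) hm)
    filter_upwards [this] with q hq t
    have := hq (mem_univ t)
    simp only [curveMap_apply, mem_preimage] at this
    exact hO _ this
  have hd : ∀ᶠ q in 𝓝 ((0 : V), y₀), DifferentiableAt ℝ Γ q := by
    filter_upwards [hΓe] with q hq using hq.differentiableAt (by simp)
  filter_upwards [hΓ.eventually_nhds, hinj, hflat, hd] with q hq hqi hqf hqd w
  -- the derivative of the solution in the direction of the base
  set η := fderiv ℝ Γ q (w, 0) with hη
  have h1 : fderiv ℝ H (q, Γ q) ((w, 0), η) = 0 := by
    have hcomp : HasFDerivAt (fun r => H (r, Γ r)) _ q :=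
      HasFDerivAt.comp (g := H) (f := fun r => (r, Γ r)) q
        (hHs.differentiable (by simp) (q, Γ q)).hasFDerivAt
        ((hasFDerivAt_id q).prodMk hqd.hasFDerivAt)
    have h0 : HasFDerivAt (𝕜 := ℝ) (fun r => H (r, Γ r)) 0 q :=
      (hasFDerivAt_const (𝕜 := ℝ) 0 q).congr_of_eventuallyEq hq
    have := DFunLike.congr_fun (hcomp.unique h0) (w, 0)
    simpa using this
  obtain ⟨ζ, hζ, h2⟩ := exists_fderiv_transportDefect_eq_zero hA hQ' (fun _ _ => rfl) x₀
    hq.self_of_nhds hqf w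
  -- Both curves solve the linearised equation with the same base variation, and by `hinj` the
  -- solution is unique.
  have h3 : η = ζ := by
    rw [← sub_eq_zero]
    refine hqi _ ?_
    have : ((0 : V × V), η - ζ) = ((w, 0), η) - ((w, 0), ζ) := by simp
    rw [this, map_sub, h1, h2, sub_zero]
  have h4 : HasFDerivAt (fun r => ev (Γ r)) _ q := ev.hasFDerivAt.comp q hqd.hasFDerivAt
  rw [h4.fderiv]
  change ev η = _
  rw [h3]
  simpa [ev] using hζ 1

/-- A smooth flat connection has a full set of local first integrals, and every first integral
is a function of them. -/
theorem exists_first_integrals [FiniteDimensional ℝ V] {A : V × V → V →L[ℝ] V} {W : Set (V × V)}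
    (hW : IsOpen W) (hA : ContDiffOn ℝ ∞ A W)
    (flat : ∀ p ∈ W, ∀ v w : V, fderiv ℝ A p (v, A p v) w = fderiv ℝ A p (w, A p w) v)
    {x₀ y₀ : V} (hp : (x₀, y₀) ∈ W) :
    ∃ Φ : V × V → V, (∀ᶠ p in 𝓝 (x₀, y₀), ContDiffAt ℝ ∞ Φ p) ∧ (∀ᶠ y in 𝓝 y₀, Φ (x₀, y) = y) ∧
      (∀ᶠ p in 𝓝 (x₀, y₀), ∀ v, fderiv ℝ Φ p (v, A p v) = 0) ∧
      ∀ h : V × V → V, (∀ᶠ p in 𝓝 (x₀, y₀), DifferentiableAt ℝ h p) →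
        (∀ᶠ p in 𝓝 (x₀, y₀), ∀ v, fderiv ℝ h p (v, A p v) = 0) →
        ∀ᶠ p in 𝓝 (x₀, y₀), h p = h (x₀, Φ p) := by
  obtain ⟨B, hB, hBA⟩ := exists_contDiff_eventuallyEq hW hA hp
  have hBflat : ∀ᶠ p in 𝓝 (x₀, y₀), ∀ v w : V,
      fderiv ℝ B p (v, B p v) w = fderiv ℝ B p (w, B p w) v := by
    filter_upwards [hBA.eventuallyEq_nhds, hW.mem_nhds hp] with p hp1 hp2 v w
    rw [hp1.fderiv_eq, hp1.self_of_nhds, flat p hp2]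
  obtain ⟨Ψ, hΨe, hΨ0, hΨd⟩ := exists_parallel_transport hB x₀ y₀ hBflat
  have hΨs := hΨe.self_of_nhds
  -- This chart straightens the distribution: the vectors (w, 0) are sent to horizontal ones.
  let τ : V × V → V × V := fun q => (x₀ + q.1, Ψ q)
  have hτ0 : τ (0, y₀) = (x₀, y₀) := by simp [τ, hΨ0.self_of_nhds]
  have hτe : ∀ᶠ q in 𝓝 ((0 : V), y₀), ContDiffAt ℝ ∞ τ q := by
    filter_upwards [hΨe] with q hq using (contDiffAt_const.add contDiffAt_fst).prodMk hq
  have hτs := hτe.self_of_nhds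
  have hτd : ∀ᶠ q in 𝓝 ((0 : V), y₀), DifferentiableAt ℝ τ q := by
    filter_upwards [hτe] with q hq using hq.differentiableAt (by simp)
  have hτw : ∀ᶠ q in 𝓝 ((0 : V), y₀), ∀ w, fderiv ℝ τ q (w, 0) = (w, B (τ q) w) := by
    filter_upwards [hΨe, hΨd] with q hq hq2 w
    have h1 : HasFDerivAt τ _ q := ((hasFDerivAt_fst (𝕜 := ℝ)).const_add x₀).prodMk
      (hq.differentiableAt (by simp)).hasFDerivAt
    rw [h1.fderiv]
    simp [hq2, τ]
  -- the differential at the base point is invertible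
  have hΨ1 : ∀ z, fderiv ℝ Ψ (0, y₀) (0, z) = z := by
    intro z
    have h1 : HasFDerivAt (fun y : V => Ψ (0, y)) _ y₀ :=
      HasFDerivAt.comp (g := Ψ) (f := fun y : V => ((0 : V), y)) y₀
        (hΨs.differentiableAt (by simp)).hasFDerivAt
        ((hasFDerivAt_const (0 : V) y₀).prodMk (hasFDerivAt_id y₀))
    have h2 : HasFDerivAt (fun y : V => Ψ (0, y)) (.id ℝ V) y₀ :=
      (hasFDerivAt_id y₀).congr_of_eventuallyEq hΨ0
    simpa using DFunLike.congr_fun (h1.unique h2) z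
  have hτ' : ∀ a : V × V, fderiv ℝ τ (0, y₀) a = (a.1, B (x₀, y₀) a.1 + a.2) := by
    intro a
    have h1 : HasFDerivAt τ _ (0, y₀) := ((hasFDerivAt_fst (𝕜 := ℝ)).const_add x₀).prodMk
      (hΨs.differentiableAt (by simp)).hasFDerivAt
    have h2 := hΨd.self_of_nhds a.1
    rw [h1.fderiv]
    have h3 : fderiv ℝ Ψ (0, y₀) a = fderiv ℝ Ψ (0, y₀) (a.1, 0)
        + fderiv ℝ Ψ (0, y₀) (0, a.2) := by rw [← map_add]; simp
    simp only [ContinuousLinearMap.prod_apply, ContinuousLinearMap.coe_fst', h3, h2, hΨ1]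
    simp [hΨ0.self_of_nhds]
  let T : (V × V) ≃L[ℝ] (V × V) := ContinuousLinearEquiv.equivOfInverse
    (fderiv ℝ τ (0, y₀))
    ((ContinuousLinearMap.fst ℝ V V).prod (ContinuousLinearMap.snd ℝ V V
      - (B (x₀, y₀)).comp (ContinuousLinearMap.fst ℝ V V)))
    (fun a => by simp [hτ']) (fun a => by simp [hτ'])
  have hT : HasFDerivAt τ (T : V × V →L[ℝ] V × V) (0, y₀) :=
    (hτs.differentiableAt (by simp)).hasFDerivAt
  let e := hτs.toOpenPartialHomeomorph τ hT (by simp)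
  have he : (0, y₀) ∈ e.source := hτs.mem_toOpenPartialHomeomorph_source hT (by simp)
  have he' : (x₀, y₀) ∈ e.target := by
    rw [← hτ0]; exact hτs.image_mem_toOpenPartialHomeomorph_target hT (by simp)
  have hesymm : e.symm (x₀, y₀) = (0, y₀) := by
    rw [← hτ0]; exact e.left_inv he
  have hec : Filter.Tendsto e.symm (𝓝 (x₀, y₀)) (𝓝 (0, y₀)) := by
    rw [← hesymm]; exact (e.continuousAt_symm he')
  have hes : ∀ᶠ p in 𝓝 (x₀, y₀), ContDiffAt ℝ ∞ e.symm p := by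
    rw [← hτ0]
    exact eventually_contDiffAt_symm e he hτe hT
  have hright : ∀ᶠ p in 𝓝 (x₀, y₀), τ (e.symm p) = p := e.eventually_right_inverse he'
  have hleft : ∀ᶠ q in 𝓝 ((0 : V), y₀), e.symm (τ q) = q := e.eventually_left_inverse he
  have hBτ : ∀ᶠ q in 𝓝 ((0 : V), y₀), B (τ q) = A (τ q) :=
    hτs.continuousAt.eventually (by rw [hτ0]; exact hBA)
  -- The first integrals are the fibre coordinates of the straightened chart, that is, the initial
  -- value over `x₀` of the transport that arrives at `p`.
  refine ⟨fun p => (e.symm p).2, hes.mono fun p hp => contDiffAt_snd.comp p hp, ?_, ?_, ?_⟩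
  · have hc : Filter.Tendsto (fun z : V => ((0 : V), z)) (𝓝 y₀) (𝓝 (0, y₀)) :=
      (Continuous.prodMk_right (0 : V)).tendsto y₀
    filter_upwards [hc.eventually hleft, hΨ0] with z hz hz0
    have : τ (0, z) = (x₀, z) := by simp [τ, hz0]
    rw [← this, hz]
  · have hsd : ∀ᶠ q in 𝓝 ((0 : V), y₀), DifferentiableAt ℝ e.symm (τ q) := by
      refine hτs.continuousAt.eventually ?_
      rw [hτ0]
      filter_upwards [hes] with q hq using hq.differentiableAt (by simp)
    have : ∀ᶠ q in 𝓝 ((0 : V), y₀), ∀ v,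
        fderiv ℝ (fun p => (e.symm p).2) (τ q) (v, A (τ q) v) = 0 := by
      filter_upwards [hsd, hτd, hτw, hBτ, hleft.eventually_nhds] with q h1 h2 h3 h4 h5 v
      have h6 : HasFDerivAt (fun r => (e.symm (τ r)).2) _ q :=
        HasFDerivAt.comp (g := fun p => (e.symm p).2) (f := τ) q
          (h1.snd.hasFDerivAt) h2.hasFDerivAt
      have h7 : HasFDerivAt (fun r => (e.symm (τ r)).2) (.snd ℝ V V) q := by
        refine (hasFDerivAt_snd (𝕜 := ℝ)).congr_of_eventuallyEq ?_
        filter_upwards [h5] with r hr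
        rw [hr]
      have := DFunLike.congr_fun (h6.unique h7) (v, 0)
      rw [ContinuousLinearMap.comp_apply, h3, h4] at this
      simpa using this
    filter_upwards [hec.eventually this, hright] with p h1 h2
    rwa [h2] at h1
  · intro h hd hh
    have hτc : Filter.Tendsto τ (𝓝 (0, y₀)) (𝓝 (x₀, y₀)) := by
      have := hτs.continuousAt.tendsto
      rwa [hτ0] at this
    -- In the straightened chart a first integral has no derivative in the base variable, hence is
    -- constant along the convex slices of a small product ball.
    have hall : ∀ᶠ q in 𝓝 ((0 : V), y₀), DifferentiableAt ℝ (fun r => h (τ r)) q ∧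
        ∀ v, fderiv ℝ (fun r => h (τ r)) q (v, 0) = 0 := by
      filter_upwards [hτc.eventually hd, hτc.eventually hh, hτd, hτw, hBτ] with q h1 h2 h3 h4 h5
      have h6 : HasFDerivAt (fun r => h (τ r)) _ q :=
        HasFDerivAt.comp (g := h) (f := τ) q h1.hasFDerivAt h3.hasFDerivAt
      refine ⟨h6.differentiableAt, fun v => ?_⟩
      rw [h6.fderiv, ContinuousLinearMap.comp_apply, h4, h5, h2]
    obtain ⟨ε, hε, hball⟩ := Metric.eventually_nhds_iff_ball.1 (hall.and
      ((continuous_snd.tendsto ((0 : V), y₀)).eventually hΨ0))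
    filter_upwards [hec.eventually (Metric.ball_mem_nhds _ hε), hright] with p h1 h2
    set q := e.symm p with hq
    have hprod : Metric.ball ((0 : V), y₀) ε = Metric.ball 0 ε ×ˢ Metric.ball y₀ ε :=
      (ball_prod_same _ _ _).symm
    have h1' : q ∈ Metric.ball ((0 : V), y₀) ε := h1
    rw [hprod] at h1'
    have hmem : ∀ v ∈ Metric.ball (0 : V) ε, (v, q.2) ∈ Metric.ball ((0 : V), y₀) ε := by
      intro v hv
      rw [hprod]
      exact ⟨hv, h1'.2⟩
    have hder : ∀ v ∈ Metric.ball (0 : V) ε, HasFDerivAt (fun v => h (τ (v, q.2)))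
        (0 : V →L[ℝ] V) v := by
      intro v hv
      obtain ⟨h3, h4⟩ := (hball _ (hmem v hv)).1
      have h5 : HasFDerivAt (fun v => h (τ (v, q.2))) _ v :=
        HasFDerivAt.comp (g := fun r => h (τ r)) (f := fun v : V => (v, q.2)) v h3.hasFDerivAt
          ((hasFDerivAt_id v).prodMk (hasFDerivAt_const q.2 v))
      refine h5.congr_fderiv (ContinuousLinearMap.ext fun w => ?_)
      simpa using h4 w
    have hconst := (convex_ball (0 : V) ε).is_const_of_fderivWithin_eq_zero (𝕜 := ℝ)
      (f := fun v => h (τ (v, q.2)))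
      (fun v hv => (hder v hv).differentiableAt.differentiableWithinAt)
      (fun v hv => by
        rw [fderivWithin_of_isOpen Metric.isOpen_ball hv, (hder v hv).fderiv])
      h1'.1 (Metric.mem_ball_self hε)
    have hz : Ψ (0, q.2) = q.2 := (hball _ (hmem 0 (Metric.mem_ball_self hε))).2
    have h0 : τ (0, q.2) = (x₀, q.2) := by simp [τ, hz]
    simp only [h0] at hconst
    rw [← hconst]
    change h p = h (τ q)
    rw [h2]

end Frobenius

/-! ### Flat sprays -/

section Flat

universe u

variable {V : Type u} [NormedAddCommGroup V]

section

variable [NormedSpace ℝ V] {F : Type*} [NormedAddCommGroup F] [NormedSpace ℝ F]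

/-- The homothety `(x, y) ↦ (x, c y)`. -/
def fibreScale (V : Type*) [NormedAddCommGroup V] [NormedSpace ℝ V] (c : ℝ) :
    V × V →L[ℝ] V × V :=
  (ContinuousLinearMap.fst ℝ V V).prod (c • ContinuousLinearMap.snd ℝ V V)

@[simp] lemma fibreScale_apply (c : ℝ) (p : V × V) : fibreScale V c p = (p.1, c • p.2) := rfl

lemma fderiv_comp_fibreScale {f : V × V → F} {c : ℝ} {p : V × V}
    (hf : DifferentiableAt ℝ f (fibreScale V c p)) (a : V × V) :
    fderiv ℝ (fun q => f (fibreScale V c q)) p a =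
      fderiv ℝ f (fibreScale V c p) (fibreScale V c a) := by
  have h : HasFDerivAt (fun q => f (fibreScale V c q)) _ p :=
    HasFDerivAt.comp (g := f) p hf.hasFDerivAt (fibreScale V c).hasFDerivAt
  rw [h.fderiv]
  rfl

/-- The connection coefficients of a spray are positively homogeneous of degree one. -/
lemma IsLocalSpray.conn_scale {W : Set (V × V)} {G : V × V → V} (S : IsLocalSpray W G)
    {c : ℝ} (hc : 0 < c) {p : V × V} (hp : p ∈ W) (hcp : fibreScale V c p ∈ W) (w : V) :
    fderiv ℝ G (fibreScale V c p) (0, w) = c • fderiv ℝ G p (0, w) := by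
  have h1 := fderiv_comp_fibreScale (c := c) (f := G)
    ((S.smooth.at S.isOpen hcp).differentiableAt (by simp)) (0, w)
  have h2 : (fun q => G (fibreScale V c q)) =ᶠ[𝓝 p] fun q => c ^ 2 • G q := by
    filter_upwards [S.isOpen.mem_nhds hp] with q hq using S.hom q hq c hc
  rw [h2.fderiv_eq, fderiv_fun_const_smul ((S.smooth.at S.isOpen hp).differentiableAt (by simp))]
    at h1
  have h3 : fibreScale V c (0, w) = c • (0, w) := by simp
  rw [h3, map_smul] at h1
  have h4 := congrArg (c⁻¹ • ·) h1
  simp only [smul_apply, smul_smul, inv_mul_cancel₀ hc.ne', one_smul] at h4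
  rw [← h4]
  congr 1
  field_simp

/-- A function with the Euler relation of degree two on a convex set is homogeneous there. -/
lemma eq_mul_of_euler {B : Set V} (hB : IsOpen B) (hBc : Convex ℝ B) {f : V → ℝ}
    (hf : ∀ y ∈ B, DifferentiableAt ℝ f y) (he : ∀ y ∈ B, fderiv ℝ f y y = 2 * f y)
    {y : V} {a b : ℝ} (ha : 0 < a) (hb : 0 < b) (hya : a • y ∈ B) (hyb : b • y ∈ B) :
    (a ^ 2)⁻¹ * f (a • y) = (b ^ 2)⁻¹ * f (b • y) := by
  let s : Set ℝ := Ioi 0 ∩ (fun t : ℝ => t • y) ⁻¹' B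
  have hs : IsOpen s := isOpen_Ioi.inter (hB.preimage (by fun_prop))
  have hsc : Convex ℝ s := (convex_Ioi 0).inter
    (hBc.linear_preimage (LinearMap.toSpanSingleton ℝ V y))
  -- Along a ray, Euler's relation makes t⁻² f(t y) have zero derivative. Convexity makes the
  -- admissible t an interval, so the value is constant.
  have hd : ∀ t ∈ s, HasDerivAt (fun t : ℝ => (t ^ 2)⁻¹ * f (t • y)) 0 t := by
    rintro t ⟨ht, hty⟩
    have ht0 : t ≠ 0 := (mem_Ioi.1 ht).ne'
    have h1 : HasDerivAt (fun t : ℝ => f (t • y)) (fderiv ℝ f (t • y) y) t :=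
      HasFDerivAt.comp_hasDerivAt t (hf _ hty).hasFDerivAt
        (by simpa using (hasDerivAt_id t).smul_const y)
    have h2 := ((hasDerivAt_pow 2 t).inv (pow_ne_zero 2 ht0)).mul h1
    refine h2.congr_deriv ?_
    have h3 := he _ hty
    rw [map_smul, smul_eq_mul] at h3
    have h4 : fderiv ℝ f (t • y) y = 2 * f (t • y) / t := by
      rw [eq_div_iff ht0, mul_comm, h3]
    simp only [Pi.inv_apply, h4]
    field_simp
    ring
  exact hs.is_const_of_deriv_eq_zero hsc.isPreconnected
    (fun t ht => (hd t ht).differentiableAt.differentiableWithinAt)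
    (fun t ht => (hd t ht).deriv) ⟨ha, hya⟩ ⟨hb, hyb⟩

end

variable [InnerProductSpace ℝ V] [FiniteDimensional ℝ V]
  {W : Set (V × V)} {G : V × V → V}

lemma eventually_norm_sub_lt {P Z : Type*} [TopologicalSpace P] [NormedAddCommGroup Z]
    {D : P → Z} {p : P} (hc : ContinuousAt D p) {ε : ℝ}
    (hε : 0 < ε) : ∀ᶠ q in 𝓝 p, ‖D q - D p‖ < ε := by
  filter_upwards [Metric.continuousAt_iff'.1 hc ε hε] with q hq
  rwa [dist_eq_norm] at hq

/-- First integrals of a flat spray that are positively homogeneous of degree one. -/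
lemma IsLocalSpray.exists_homogeneous_first_integrals (S : IsLocalSpray W G)
    (flat : ∀ p ∈ W, ∀ v w, horCurv G v w p = 0) {x₀ y₀ : V} (hp : (x₀, y₀) ∈ W) :
    ∃ Φ : V × V → V, (∀ᶠ p in 𝓝 (x₀, y₀), ContDiffAt ℝ ∞ Φ p) ∧
      (∀ᶠ y in 𝓝 y₀, Φ (x₀, y) = y) ∧
      (∀ᶠ p in 𝓝 (x₀, y₀), ∀ w, horDeriv G w Φ p = 0) ∧
      ∀ᶠ p in 𝓝 (x₀, y₀), fderiv ℝ Φ p (0, p.2) = Φ p := by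
  have : CompleteSpace V := FiniteDimensional.complete ℝ V
  let A : V × V → V →L[ℝ] V := fun p => -(fderiv ℝ G p).comp (ContinuousLinearMap.inr ℝ V V)
  have hAs : ContDiffOn ℝ ∞ A W :=
    ((S.smooth.fderiv_of_isOpen S.isOpen (m := ∞) (by simp)).clm_comp contDiffOn_const).neg
  have hAv : ∀ p v, (v, A p v) = horLift G v p := fun p v => by simp [A, horLift]
  have hA' : ∀ p ∈ W, ∀ v w, fderiv ℝ A p (v, A p v) w =
      -horDeriv G v (fun q => fderiv ℝ G q (0, w)) p := by
    intro p hp v w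
    have hd := (hAs.at S.isOpen hp).differentiableAt (by simp)
    have h1 : fderiv ℝ A p (v, A p v) w = fderiv ℝ (fun q => A q w) p (v, A p v) := by
      rw [fderiv_clm_apply hd (differentiableAt_const w)]
      simp
    have h2 : (fun q => A q w) = fun q => -fderiv ℝ G q (0, w) := by
      funext q
      simp [A]
    rw [h1, h2, fderiv_fun_neg, hAv]
    rfl
  obtain ⟨Φ, hΦs, hΦ0, hΦh, hΦu⟩ := exists_first_integrals S.isOpen hAs
    (fun p hp v w => by
      rw [hA' p hp, hA' p hp, neg_inj, ← sub_eq_zero]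
      exact flat p hp v w) hp
  have hhor : ∀ᶠ p in 𝓝 (x₀, y₀), ∀ w, horDeriv G w Φ p = 0 := by
    filter_upwards [hΦh] with p hp w
    rw [horDeriv, ← hAv, hp]
  refine ⟨Φ, hΦs, hΦ0, hhor, ?_⟩
  -- The Euler defect is itself a first integral, because the radial field commutes with horizontal
  -- lifts. Over `x₀` it vanishes, since Φ is the identity there, so it vanishes nearby.
  let h : V × V → V := fun p => fderiv ℝ Φ p (0, p.2) - Φ p
  have hsnd : ∀ p, DifferentiableAt ℝ (fun q : V × V => ((0 : V), q.2)) p := by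
    intro p
    fun_prop
  have hd : ∀ᶠ p in 𝓝 (x₀, y₀), DifferentiableAt ℝ h p := by
    filter_upwards [hΦs] with p hp
    exact (hp.differentiableAt_fderiv.clm_apply (hsnd p)).sub (hp.differentiableAt (by simp))
  have hh : ∀ᶠ p in 𝓝 (x₀, y₀), ∀ v, fderiv ℝ h p (v, A p v) = 0 := by
    filter_upwards [hΦs, hhor.eventually_nhds, S.isOpen.mem_nhds hp] with p h1 h2 h3 v
    have h4 : fderiv ℝ h p = fderiv ℝ (fun q => fderiv ℝ Φ q (0, q.2)) p - fderiv ℝ Φ p :=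
      fderiv_sub (h1.differentiableAt_fderiv.clm_apply (hsnd p)) (h1.differentiableAt (by simp))
    have h5 := fderiv_fderiv_sub h1 (S.differentiableAt_horLift h3 v) (hsnd p)
    have h6 : fderiv ℝ (fun q => fderiv ℝ Φ q (horLift G v q)) p = 0 := by
      have : (fun q => fderiv ℝ Φ q (horLift G v q)) =ᶠ[𝓝 p] fun _ => 0 := by
        filter_upwards [h2] with q hq using hq v
      rw [this.fderiv_eq]
      simp
    rw [h6, fderiv_zero_snd, S.fderiv_horLift h3, S.euler_vert h3, zero_apply, sub_zero] at h5
    rw [h4, sub_apply, hAv, h5]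
    have := h2.self_of_nhds v
    rw [horDeriv] at this
    rw [this]
    simp [horLift]
  have h0 : ∀ᶠ y in 𝓝 y₀, h (x₀, y) = 0 := by
    have hc : Filter.Tendsto (fun y : V => (x₀, y)) (𝓝 y₀) (𝓝 (x₀, y₀)) :=
      (Continuous.prodMk_right x₀).tendsto y₀
    filter_upwards [hc.eventually hΦs, hΦ0.eventually_nhds] with y h1 h2
    have h3 : HasFDerivAt (fun y : V => Φ (x₀, y)) _ y :=
      HasFDerivAt.comp (g := Φ) (f := fun y : V => (x₀, y)) y
        (h1.differentiableAt (by simp)).hasFDerivAt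
        ((hasFDerivAt_const x₀ y).prodMk (hasFDerivAt_id y))
    have h4 : HasFDerivAt (fun y : V => Φ (x₀, y)) (.id ℝ V) y :=
      (hasFDerivAt_id y).congr_of_eventuallyEq h2
    have h5 := DFunLike.congr_fun (h3.unique h4) y
    simp only [h, h2.self_of_nhds, sub_eq_zero]
    simpa using h5
  have hΦc : Filter.Tendsto Φ (𝓝 (x₀, y₀)) (𝓝 y₀) := by
    have := hΦs.self_of_nhds.continuousAt.tendsto
    rwa [hΦ0.self_of_nhds] at this
  filter_upwards [hΦu h hd hh, hΦc.eventually h0] with p h1 h2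
  rw [h2] at h1
  exact sub_eq_zero.1 h1

set_option maxSynthPendingDepth 3 in
/-- A flat spray is locally induced by the square of the norm of its first integrals. -/
lemma IsLocalSpray.exists_local_energy (S : IsLocalSpray W G)
    (flat : ∀ p ∈ W, ∀ v w, horCurv G v w p = 0) {x₀ y₀ : V} (hp : (x₀, y₀) ∈ W) :
    ∃ f : V × V → ℝ, (∀ᶠ p in 𝓝 (x₀, y₀), ContDiffAt ℝ ∞ f p) ∧
      (∀ᶠ p in 𝓝 (x₀, y₀), ∀ w, horDeriv G w f p = 0) ∧
      (∀ᶠ p in 𝓝 (x₀, y₀), fderiv ℝ f p (0, p.2) = 2 * f p) ∧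
      ∀ᶠ p in 𝓝 (x₀, y₀), ∀ w, (∀ v, fderiv ℝ (fderiv ℝ f) p (0, v) (0, w) = 0) → w = 0 := by
  obtain ⟨Φ, hΦs, hΦ0, hΦh, hΦe⟩ := S.exists_homogeneous_first_integrals flat hp
  let f : V × V → ℝ := fun p => inner ℝ (Φ p) (Φ p)
  have hfs : ∀ᶠ p in 𝓝 (x₀, y₀), ContDiffAt ℝ ∞ f p := by
    filter_upwards [hΦs] with p hp using hp.inner ℝ hp
  have hfd : ∀ᶠ p in 𝓝 (x₀, y₀), ∀ a, fderiv ℝ f p a = 2 * inner ℝ (Φ p) (fderiv ℝ Φ p a) := by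
    filter_upwards [hΦs] with p hp a
    have hd := hp.differentiableAt (by simp)
    rw [fderiv_inner_apply ℝ hd hd, real_inner_comm]
    ring
  have hc : Filter.Tendsto (fun y : V => (x₀, y)) (𝓝 y₀) (𝓝 (x₀, y₀)) :=
    (Continuous.prodMk_right x₀).tendsto y₀
  have hΦ1 : ∀ᶠ y in 𝓝 y₀, ∀ w, fderiv ℝ Φ (x₀, y) (0, w) = w := by
    filter_upwards [hc.eventually hΦs, hΦ0.eventually_nhds] with y h1 h2 w
    have h3 : HasFDerivAt (fun y : V => Φ (x₀, y)) _ y :=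
      HasFDerivAt.comp (g := Φ) (f := fun y : V => (x₀, y)) y
        (h1.differentiableAt (by simp)).hasFDerivAt
        ((hasFDerivAt_const x₀ y).prodMk (hasFDerivAt_id y))
    have h4 : HasFDerivAt (fun y : V => Φ (x₀, y)) (.id ℝ V) y :=
      (hasFDerivAt_id y).congr_of_eventuallyEq h2
    simpa using DFunLike.congr_fun (h3.unique h4) w
  have hf0 := hfs.self_of_nhds
  -- Over `x₀` the energy is the squared norm itself, whose Hessian is twice the inner product.
  have hess : ∀ w, fderiv ℝ (fderiv ℝ f) (x₀, y₀) (0, w) (0, w) = 2 * ‖w‖ ^ 2 := by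
    intro w
    rw [← fderiv_fderiv_const hf0]
    have h1 : HasFDerivAt (fun y : V => fderiv ℝ f (x₀, y) (0, w)) _ y₀ :=
      HasFDerivAt.comp (g := fun q => fderiv ℝ f q (0, w)) (f := fun y : V => (x₀, y)) y₀
        (hf0.differentiableAt_fderiv.clm_apply (differentiableAt_const _)).hasFDerivAt
        ((hasFDerivAt_const x₀ y₀).prodMk (hasFDerivAt_id y₀))
    have h2 : HasFDerivAt (fun y : V => fderiv ℝ f (x₀, y) (0, w)) ((2 : ℝ) • innerSL ℝ w) y₀ := by
      refine ((innerSL ℝ w).hasFDerivAt.const_smul (2 : ℝ)).congr_of_eventuallyEq ?_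
      filter_upwards [hc.eventually hfd, hΦ0, hΦ1] with y h3 h4 h5
      rw [h3, h4, h5, real_inner_comm]
      simp
    have h3 := DFunLike.congr_fun (h1.unique h2) w
    simpa using h3
  refine ⟨f, hfs, ?_, ?_, ?_⟩
  · filter_upwards [hfd, hΦh] with p h1 h2 w
    have := h2 w
    rw [horDeriv] at this ⊢
    rw [h1, this, inner_zero_right, mul_zero]
  · filter_upwards [hfd, hΦe] with p h1 h2
    rw [h1, h2]
  · have hcont : ContinuousAt (fderiv ℝ (fderiv ℝ f)) (x₀, y₀) :=
      ((hf0.fderiv_right (m := ∞) (by simp)).fderiv_right (m := ∞) (by simp)).continuousAt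
    filter_upwards [eventually_norm_sub_lt (Z := V × V →L[ℝ] V × V →L[ℝ] ℝ) hcont one_pos]
      with p hp w hw
    -- A kernel vector would satisfy 2‖w‖² ≤ ε‖w‖² with ε < 1.
    have h1 := (fderiv ℝ (fderiv ℝ f) p - fderiv ℝ (fderiv ℝ f) (x₀, y₀)).le_opNorm₂ (0, w) (0, w)
    have h2 : ‖((0 : V), w)‖ = ‖w‖ := by simp [Prod.norm_def]
    rw [h2] at h1
    simp only [sub_apply, hw, hess, zero_sub, norm_neg] at h1
    rw [Real.norm_of_nonneg (by positivity)] at h1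
    by_contra hne
    have : 0 < ‖w‖ := norm_pos_iff.2 hne
    nlinarith [mul_pos this this]

/-- A flat spray is locally induced by a Finsler metric on a product of an open set and an open
cone. -/
theorem IsLocalSpray.exists_flat_metric (S : IsLocalSpray W G)
    (cone : ∀ p ∈ W, ∀ c : ℝ, 0 < c → (p.1, c • p.2) ∈ W)
    (flat : ∀ p ∈ W, ∀ v w, horCurv G v w p = 0) {x₀ y₀ : V} (hp : (x₀, y₀) ∈ W) (hy : y₀ ≠ 0) :
    ∃ (O B : Set V) (L : V × V → ℝ), IsOpen O ∧ x₀ ∈ O ∧ IsOpen B ∧ y₀ ∈ B ∧ IsConnected B ∧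
      (0 : V) ∉ B ∧ (∀ y ∈ B, ∀ c : ℝ, 0 < c → c • y ∈ B) ∧ O ×ˢ B ⊆ W ∧
      ContDiffOn ℝ ∞ L (O ×ˢ B) ∧ HomTwoOn (O ×ˢ B) L ∧
      (∀ p ∈ O ×ˢ B, ∀ w, horDeriv G w L p = 0) ∧
      ∀ p ∈ O ×ˢ B, ∀ w, (∀ v, fderiv ℝ (fderiv ℝ L) p (0, v) (0, w) = 0) → w = 0 := by
  obtain ⟨f, hfs, hfh, hfe, hfn⟩ := S.exists_local_energy flat hp
  obtain ⟨r, hr, hball⟩ := Metric.eventually_nhds_iff_ball.1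
    (hfs.and (hfh.and (hfe.and (hfn.and (S.isOpen.mem_nhds hp)))))
  -- The bound by the norm of `y₀` keeps zero out of the ball, and hence out of the cone generated
  -- by it.
  obtain ⟨ρ, hρ, hρr, hρy⟩ : ∃ ρ, 0 < ρ ∧ ρ ≤ r ∧ ρ ≤ ‖y₀‖ :=
    ⟨min r ‖y₀‖, lt_min hr (norm_pos_iff.2 hy), min_le_left _ _, min_le_right _ _⟩
  have hmem : ∀ x ∈ Metric.ball x₀ ρ, ∀ y ∈ Metric.ball y₀ ρ, (x, y) ∈ Metric.ball (x₀, y₀) r := by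
    intro x hx y hy
    rw [← ball_prod_same]
    exact ⟨Metric.ball_subset_ball hρr hx, Metric.ball_subset_ball hρr hy⟩
  let B : Set V := {y | ∃ c : ℝ, 0 < c ∧ c • y ∈ Metric.ball y₀ ρ}
  -- An arbitrary factor moving `y` into the ball. By homogeneity of `f` along rays the extended
  -- metric does not depend on the choice, and the value 1 off the cone plays no role.
  let κ : V → ℝ := fun y => open Classical in if h : y ∈ B then h.choose else 1
  have hκ : ∀ y ∈ B, 0 < κ y ∧ κ y • y ∈ Metric.ball y₀ ρ := by
    intro y hy
    simp only [κ, dif_pos hy]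
    exact hy.choose_spec
  let L : V × V → ℝ := fun p => (κ p.2 ^ 2)⁻¹ * f (p.1, κ p.2 • p.2)
  have hL : ∀ x ∈ Metric.ball x₀ ρ, ∀ y, ∀ c : ℝ, 0 < c → c • y ∈ Metric.ball y₀ ρ →
      L (x, y) = (c ^ 2)⁻¹ * f (x, c • y) := by
    intro x hx y c hc hcy
    obtain ⟨h1, h2⟩ := hκ y ⟨c, hc, hcy⟩
    have hd : ∀ z ∈ Metric.ball y₀ ρ, HasFDerivAt (fun z => f (x, z))
        ((fderiv ℝ f (x, z)).comp (ContinuousLinearMap.inr ℝ V V)) z := by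
      intro z hz
      have := (hball _ (hmem x hx z hz)).1.differentiableAt (by simp)
      have h3 : HasFDerivAt (fun z => f (x, z)) _ z :=
        HasFDerivAt.comp (g := f) (f := fun z : V => (x, z)) z this.hasFDerivAt
          ((hasFDerivAt_const x z).prodMk (hasFDerivAt_id z))
      refine h3.congr_fderiv (ContinuousLinearMap.ext fun w => ?_)
      simp
    refine eq_mul_of_euler (f := fun z => f (x, z)) Metric.isOpen_ball (convex_ball y₀ ρ)
      (fun z hz => (hd z hz).differentiableAt) (fun z hz => ?_) h1 hc h2 hcy
    rw [(hd z hz).fderiv]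
    exact (hball _ (hmem x hx z hz)).2.2.1
  have hBopen : IsOpen B := by
    have : B = ⋃ c : Ioi (0 : ℝ), (fun y => (c : ℝ) • y) ⁻¹' Metric.ball y₀ ρ := by
      ext y
      simp [B]
    rw [this]
    exact isOpen_iUnion fun c => Metric.isOpen_ball.preimage (continuous_const_smul _)
  -- near each point, the metric is a rescaling of the local energy
  have hloc : ∀ p ∈ Metric.ball x₀ ρ ×ˢ B, ∃ c : ℝ, 0 < c ∧
      fibreScale V c p ∈ Metric.ball (x₀, y₀) r ∧
      L =ᶠ[𝓝 p] fun q => (c ^ 2)⁻¹ * f (fibreScale V c q) := by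
    rintro p ⟨hp1, c, hc, hcp⟩
    refine ⟨c, hc, hmem _ hp1 _ hcp, ?_⟩
    have h1 : ∀ᶠ q in 𝓝 p, q.1 ∈ Metric.ball x₀ ρ :=
      continuous_fst.continuousAt.eventually (Metric.isOpen_ball.mem_nhds hp1)
    have h2 : ∀ᶠ q in 𝓝 p, c • q.2 ∈ Metric.ball y₀ ρ :=
      (continuous_snd.const_smul c).continuousAt.eventually (Metric.isOpen_ball.mem_nhds hcp)
    filter_upwards [h1, h2] with q hq1 hq2
    exact hL q.1 hq1 q.2 c hc hq2
  have hscale : ∀ p c, 0 < c → fibreScale V c p ∈ W → p ∈ W := by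
    intro p c hc h
    have := cone _ h c⁻¹ (inv_pos.2 hc)
    simpa [smul_smul, inv_mul_cancel₀ hc.ne'] using this
  refine ⟨Metric.ball x₀ ρ, B, L, Metric.isOpen_ball, Metric.mem_ball_self hρ, hBopen,
    ⟨1, one_pos, by simpa using hρ⟩, ?_, ?_, ?_, ?_, ?_, ?_, ?_, ?_⟩
  · have : B = (fun q : ℝ × V => q.1 • q.2) '' (Ioi 0 ×ˢ Metric.ball y₀ ρ) := by
      ext y
      constructor
      · rintro ⟨c, hc, hcy⟩
        exact ⟨(c⁻¹, c • y), ⟨inv_pos.2 hc, hcy⟩, by simp [smul_smul, inv_mul_cancel₀ hc.ne']⟩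
      · rintro ⟨⟨c, z⟩, ⟨hc, hz⟩, rfl⟩
        have hc' : 0 < c := hc
        exact ⟨c⁻¹, inv_pos.2 hc', by simpa [smul_smul, inv_mul_cancel₀ hc'.ne'] using hz⟩
    rw [this]
    refine ((convex_Ioi (0 : ℝ)).prod (convex_ball y₀ ρ)).isConnected ?_ |>.image _
      (by fun_prop)
    exact ⟨(1, y₀), by simp, Metric.mem_ball_self hρ⟩
  · rintro ⟨c, hc, h⟩
    rw [smul_zero, Metric.mem_ball, dist_zero_left] at h
    exact absurd hρy (not_le.2 h)
  · rintro y ⟨c, hc, h⟩ a ha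
    exact ⟨c * a⁻¹, by positivity, by simpa [smul_smul, mul_assoc, inv_mul_cancel₀ ha.ne'] using h⟩
  · intro p hp
    obtain ⟨c, hc, h1, -⟩ := hloc p hp
    exact hscale p c hc (hball _ h1).2.2.2.2
  · intro p hp
    obtain ⟨c, hc, h1, h2⟩ := hloc p hp
    refine (ContDiffAt.congr_of_eventuallyEq ?_ h2).contDiffWithinAt
    exact contDiffAt_const.mul ((hball _ h1).1.comp p (fibreScale V c).contDiff.contDiffAt)
  · rintro p ⟨hp1, c, hc, hcp⟩ a ha
    rw [hL p.1 hp1 (a • p.2) (c * a⁻¹) (by positivity)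
      (by simpa [smul_smul, mul_assoc, inv_mul_cancel₀ ha.ne'] using hcp),
      show L p = _ from hL p.1 hp1 p.2 c hc hcp, smul_smul, mul_assoc, inv_mul_cancel₀ ha.ne',
      mul_one, smul_eq_mul]
    field_simp
  · intro p hp w
    obtain ⟨c, hc, h1, h2⟩ := hloc p hp
    obtain ⟨hs, hh, -, -, hw⟩ := hball _ h1
    have hd := hs.differentiableAt (by simp)
    have hdc : DifferentiableAt ℝ (fun q => f (fibreScale V c q)) p :=
      hd.comp p (fibreScale V c).differentiableAt
    rw [horDeriv, h2.fderiv_eq, fderiv_const_mul hdc, smul_apply, fderiv_comp_fibreScale hd]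
    have h3 := hh w
    rw [horDeriv, horLift, S.conn_scale hc (hscale p c hc hw) hw] at h3
    have h4 : fibreScale V c (horLift G w p) = (w, -(c • fderiv ℝ G p (0, w))) := by
      simp [horLift]
    rw [h4, h3, smul_zero]
  · intro p hp w hw
    obtain ⟨c, hc, h1, h2⟩ := hloc p hp
    obtain ⟨hs, -, -, hn, -⟩ := hball _ h1
    refine hn w fun v => ?_
    have hLs : ContDiffAt ℝ ∞ L p := ContDiffAt.congr_of_eventuallyEq
      (contDiffAt_const.mul (hs.comp p (fibreScale V c).contDiff.contDiffAt)) h2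
    have h3 := hw v
    rw [← fderiv_fderiv_const hLs] at h3
    -- The factor c⁻¹ combines c⁻² from the metric with c from the rescaled vertical vector.
    have hev : (fun q => fderiv ℝ L q (0, w)) =ᶠ[𝓝 p]
        fun q => c⁻¹ * fderiv ℝ f (fibreScale V c q) (0, w) := by
      have hcont := (fibreScale V c).continuous.continuousAt.eventually
        (Metric.isOpen_ball.mem_nhds h1)
      filter_upwards [h2.eventuallyEq_nhds, hcont] with q hq1 hq2
      have hd := (hball _ hq2).1.differentiableAt (by simp)
      have hdc : DifferentiableAt ℝ (fun q => f (fibreScale V c q)) q :=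
        hd.comp q (fibreScale V c).differentiableAt
      have h5 : fibreScale V c (0, w) = c • (0, w) := by simp
      rw [hq1.fderiv_eq, fderiv_const_mul hdc, smul_apply, fderiv_comp_fibreScale hd, h5, map_smul]
      simp only [smul_eq_mul]
      field_simp
    have hdd : DifferentiableAt ℝ (fun q => fderiv ℝ f q (0, w)) (fibreScale V c p) :=
      hs.differentiableAt_fderiv.clm_apply (differentiableAt_const _)
    have hdc : DifferentiableAt ℝ (fun q => fderiv ℝ f (fibreScale V c q) (0, w)) p :=
      hdd.comp p (fibreScale V c).differentiableAt
    rw [hev.fderiv_eq, fderiv_const_mul hdc, smul_apply,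
      fderiv_comp_fibreScale (f := fun q => fderiv ℝ f q (0, w)) hdd,
      show fibreScale V c (0, v) = c • (0, v) by simp, map_smul, fderiv_fderiv_const hs] at h3
    simpa [hc.ne'] using h3

end Flat

/-! ### Coordinate expressions -/

section Coordinates

variable {n : ℕ} {F : Type*} [NormedAddCommGroup F] [NormedSpace ℝ F]

/-- The coordinate vector `∂_k`. -/
abbrev coordVec (k : Fin n) : E n := EuclideanSpace.single k 1

/-- A function of `x` and `y` as a function of the pair. -/
abbrev unc (f : E n → E n → F) : E n × E n → F := fun p => f p.1 p.2

lemma sum_mul_map_coordVec (T : E n →L[ℝ] ℝ) (a : E n) : ∑ r, a r * T (coordVec r) = T a := by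
  conv_rhs => rw [← (EuclideanSpace.basisFun (Fin n) ℝ).sum_repr a]
  simp [map_sum]

lemma ext_coordVec {S T : E n →L[ℝ] F} (h : ∀ i, S (coordVec i) = T (coordVec i)) : S = T := by
  ext a
  rw [← (EuclideanSpace.basisFun (Fin n) ℝ).sum_repr a, map_sum, map_sum]
  refine Finset.sum_congr rfl fun i _ => ?_
  rw [map_smul, map_smul, EuclideanSpace.basisFun_apply]
  congr 1
  exact h i

variable {f : E n → E n → ℝ} {G : E n → E n → E n} {L : E n → E n → ℝ} {W : Set (E n × E n)}
  {p : E n × E n}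

lemma dx_eq (hf : DifferentiableAt ℝ (unc f) p) (k : Fin n) :
    dx k f p.1 p.2 = fderiv ℝ (unc f) p (coordVec k, 0) := by
  have h : HasFDerivAt (fun x => f x p.2) _ p.1 :=
    HasFDerivAt.comp (g := unc f) (f := fun x : E n => (x, p.2)) p.1 hf.hasFDerivAt
      ((hasFDerivAt_id p.1).prodMk (hasFDerivAt_const p.2 p.1))
  rw [dx, h.fderiv]
  simp

lemma dy_eq (hf : DifferentiableAt ℝ (unc f) p) (k : Fin n) :
    dy k f p.1 p.2 = fderiv ℝ (unc f) p (0, coordVec k) := by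
  have h : HasFDerivAt (fun y => f p.1 y) _ p.2 :=
    HasFDerivAt.comp (g := unc f) (f := fun y : E n => (p.1, y)) p.2 hf.hasFDerivAt
      ((hasFDerivAt_const p.1 p.2).prodMk (hasFDerivAt_id p.2))
  rw [dy, h.fderiv]
  simp

lemma smooth_diff (hW : IsOpen W) {f : E n × E n → F} (hf : ContDiffOn ℝ ∞ f W) (hp : p ∈ W) :
    DifferentiableAt ℝ f p := (hf.at hW hp).differentiableAt (by simp)

lemma dy_eqOn (hW : IsOpen W) (hf : ContDiffOn ℝ ∞ (unc f) W) (k : Fin n) :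
    EqOn (unc (dy k f)) (fun q => fderiv ℝ (unc f) q (0, coordVec k)) W :=
  fun _ hq => dy_eq (smooth_diff hW hf hq) k

lemma smooth_dy (hW : IsOpen W) (hf : ContDiffOn ℝ ∞ (unc f) W) (k : Fin n) :
    ContDiffOn ℝ ∞ (unc (dy k f)) W :=
  (hf.vert hW (coordVec k)).congr (dy_eqOn hW hf k)

lemma fderiv_dy (hW : IsOpen W) (hf : ContDiffOn ℝ ∞ (unc f) W) (hp : p ∈ W) (k : Fin n) :
    fderiv ℝ (unc (dy k f)) p = fderiv ℝ (fun q => fderiv ℝ (unc f) q (0, coordVec k)) p :=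
  fderiv_congr_of_eqOn hW (dy_eqOn hW hf k) hp

lemma smooth_comp (hG : ContDiffOn ℝ ∞ (unc G) W) (i : Fin n) :
    ContDiffOn ℝ ∞ (unc (comp G i)) W :=
  (EuclideanSpace.proj (𝕜 := ℝ) i).contDiff.comp_contDiffOn hG

lemma fderiv_component {X : Type*} [NormedAddCommGroup X] [NormedSpace ℝ X] {H : X → E n} {x : X}
    (hH : DifferentiableAt ℝ H x) (i : Fin n) (a : X) :
    fderiv ℝ (fun q => H q i) x a = fderiv ℝ H x a i := by
  have h : HasFDerivAt (fun q => H q i) _ x :=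
    (EuclideanSpace.proj (𝕜 := ℝ) i).hasFDerivAt.comp x hH.hasFDerivAt
  rw [h.fderiv]
  rfl

lemma dy_comp_eq (hW : IsOpen W) (hG : ContDiffOn ℝ ∞ (unc G) W) (hp : p ∈ W) (i k : Fin n) :
    dy k (comp G i) p.1 p.2 = fderiv ℝ (unc G) p (0, coordVec k) i := by
  rw [dy_eq (smooth_diff hW (smooth_comp hG i) hp)]
  exact fderiv_component (smooth_diff hW hG hp) i _

lemma fderiv_dy_comp (hW : IsOpen W) (hG : ContDiffOn ℝ ∞ (unc G) W) (hp : p ∈ W) (i k : Fin n)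
    (a : E n × E n) :
    fderiv ℝ (unc (dy k (comp G i))) p a =
      fderiv ℝ (fun q => fderiv ℝ (unc G) q (0, coordVec k)) p a i := by
  rw [fderiv_congr_of_eqOn (f := unc (dy k (comp G i)))
    (g := fun q => fderiv ℝ (unc G) q (0, coordVec k) i) hW
    (fun q hq => dy_comp_eq hW hG hq i k) hp]
  exact fderiv_component (smooth_diff hW (hG.vert hW _) hp) i a

lemma hderiv_eq (hW : IsOpen W) (hG : ContDiffOn ℝ ∞ (unc G) W)
    (hf : ContDiffOn ℝ ∞ (unc f) W) (hp : p ∈ W) (i : Fin n) :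
    hderiv G f i p.1 p.2 = horDeriv (unc G) (coordVec i) (unc f) p := by
  have hd := smooth_diff hW hf hp
  rw [hderiv, dx_eq hd, IsLocalSpray.horDeriv_eq]
  congr 1
  rw [← ContinuousLinearMap.inr_apply (R := ℝ) (M₁ := E n), ← ContinuousLinearMap.comp_apply,
    ← sum_mul_map_coordVec]
  refine Finset.sum_congr rfl fun r _ => ?_
  rw [dy_comp_eq hW hG hp, dy_eq hd]
  rfl

lemma map_pair {T : E n × E n →L[ℝ] F} (a b : E n) : T (a, b) = T (a, 0) + T (0, b) := by
  rw [← map_add]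
  simp

/-- This ties the coordinate definition to the invariant one: each sum over j is the contraction of
a linear map with y, with G, or with a column of the connection. -/
lemma riemann_eq (S : IsLocalSpray W (unc G)) (hp : p ∈ W) (i k : Fin n) :
    riemann G i k p.1 p.2 = horCurv (unc G) (coordVec k) p.2 p i := by
  have hW := S.isOpen
  have hG := S.smooth
  have hC := smooth_dy hW (smooth_comp hG i) k
  rw [S.horCurv_snd hp, riemann]
  have h1 : dx k (comp G i) p.1 p.2 = fderiv ℝ (unc G) p (coordVec k, 0) i := by
    rw [dx_eq (smooth_diff hW (smooth_comp hG i) hp)]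
    exact fderiv_component (smooth_diff hW hG hp) i _
  have h2 : ∑ j, p.2 j * dx j (dy k (comp G i)) p.1 p.2 =
      fderiv ℝ (fun q => fderiv ℝ (unc G) q (0, coordVec k)) p (p.2, 0) i := by
    rw [← fderiv_dy_comp hW hG hp, ← ContinuousLinearMap.inl_apply (R := ℝ) (M₂ := E n),
      ← ContinuousLinearMap.comp_apply, ← sum_mul_map_coordVec]
    refine Finset.sum_congr rfl fun r _ => ?_
    rw [dx_eq (smooth_diff hW hC hp)]
    rfl
  have h3 : ∑ j, G p.1 p.2 j * dy j (dy k (comp G i)) p.1 p.2 =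
      fderiv ℝ (fun q => fderiv ℝ (unc G) q (0, coordVec k)) p (0, unc G p) i := by
    rw [← fderiv_dy_comp hW hG hp, ← ContinuousLinearMap.inr_apply (R := ℝ) (M₁ := E n),
      ← ContinuousLinearMap.comp_apply, ← sum_mul_map_coordVec]
    refine Finset.sum_congr rfl fun r _ => ?_
    rw [dy_eq (smooth_diff hW hC hp)]
    rfl
  have h4 : ∑ j, dy j (comp G i) p.1 p.2 * dy k (comp G j) p.1 p.2 =
      fderiv ℝ (unc G) p (0, fderiv ℝ (unc G) p (0, coordVec k)) i := by
    let T : E n →L[ℝ] ℝ := (EuclideanSpace.proj (𝕜 := ℝ) i).comp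
      ((fderiv ℝ (unc G) p).comp (ContinuousLinearMap.inr ℝ (E n) (E n)))
    have hT : ∀ a, T a = fderiv ℝ (unc G) p (0, a) i := fun a => rfl
    rw [← hT, ← sum_mul_map_coordVec]
    refine Finset.sum_congr rfl fun r _ => ?_
    rw [dy_comp_eq hW hG hp, dy_comp_eq hW hG hp, mul_comm, hT]
  rw [h1, h2, h3, h4, map_pair p.2 (-(2 : ℝ) • unc G p)]
  have h5 : ((0 : E n), -(2 : ℝ) • unc G p) = -(2 : ℝ) • (0, unc G p) := by simp
  rw [h5, map_smul]
  simp only [PiLp.sub_apply, PiLp.add_apply, PiLp.smul_apply, smul_eq_mul]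
  ring

/-! ### The fundamental tensor -/

lemma fundTensor_apply (hW : IsOpen W) (hL : ContDiffOn ℝ ∞ (unc L) W) (hp : p ∈ W)
    (i j : Fin n) :
    fundTensor L p.1 p.2 i j =
      1 / 2 * fderiv ℝ (fderiv ℝ (unc L)) p (0, coordVec i) (0, coordVec j) := by
  have h1 : ContDiffOn ℝ ∞ (unc fun x y => L x y / 2) W := hL.div_const 2
  have h2 : ∀ q ∈ W, fderiv ℝ (unc fun x y => L x y / 2) q (0, coordVec j) =
      1 / 2 * fderiv ℝ (unc L) q (0, coordVec j) := by
    intro q hq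
    have h3 : (unc fun x y => L x y / 2) = fun q => 1 / 2 * unc L q := by
      funext q
      exact div_eq_inv_mul _ _ |>.trans (by rw [one_div])
    rw [h3, fderiv_const_mul (smooth_diff hW hL hq)]
    rfl
  change dy i (dy j fun x y => L x y / 2) p.1 p.2 = _
  rw [dy_eq (smooth_diff hW (smooth_dy hW h1 j) hp), fderiv_dy hW h1 hp,
    fderiv_congr_of_eqOn hW h2 hp, fderiv_const_mul (smooth_diff hW (hL.vert hW _) hp), smul_apply,
    fderiv_fderiv_const (hL.at hW hp)]
  rfl

lemma fundTensor_mulVec (hW : IsOpen W) (hL : ContDiffOn ℝ ∞ (unc L) W) (hp : p ∈ W)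
    (w : E n) (i : Fin n) : (fundTensor L p.1 p.2).mulVec w i =
      1 / 2 * fderiv ℝ (fderiv ℝ (unc L)) p (0, coordVec i) (0, w) := by
  rw [← ContinuousLinearMap.inr_apply (R := ℝ) (M₁ := E n) w, ← ContinuousLinearMap.comp_apply,
    ← sum_mul_map_coordVec, Matrix.mulVec, dotProduct, Finset.mul_sum]
  refine Finset.sum_congr rfl fun j _ => ?_
  rw [fundTensor_apply hW hL hp]
  simp only [ContinuousLinearMap.comp_apply, ContinuousLinearMap.inr_apply]
  ring

/-- The fundamental tensor is non-degenerate if and only if the vertical Hessian is. -/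
lemma det_fundTensor_ne_zero_iff (hW : IsOpen W) (hL : ContDiffOn ℝ ∞ (unc L) W) (hp : p ∈ W) :
    (fundTensor L p.1 p.2).det ≠ 0 ↔
      ∀ w, (∀ v, fderiv ℝ (fderiv ℝ (unc L)) p (0, v) (0, w) = 0) → w = 0 := by
  rw [← not_iff_not, not_not, ← Matrix.exists_mulVec_eq_zero_iff]
  push Not
  have key : ∀ w : E n, (fundTensor L p.1 p.2).mulVec w = 0 ↔
      ∀ v, fderiv ℝ (fderiv ℝ (unc L)) p (0, v) (0, w) = 0 := by
    intro w
    constructor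
    · intro h
      have h1 : ((ContinuousLinearMap.apply ℝ ℝ ((0 : E n), w)).comp
          ((fderiv ℝ (fderiv ℝ (unc L)) p).comp (ContinuousLinearMap.inr ℝ (E n) (E n)))) = 0 := by
        refine ext_coordVec fun i => ?_
        have := congrFun h i
        rw [fundTensor_mulVec hW hL hp] at this
        simpa using this
      intro v
      exact DFunLike.congr_fun h1 v
    · intro h
      funext i
      rw [fundTensor_mulVec hW hL hp, h]
      simp
  constructor
  · rintro ⟨v, hv, h⟩
    refine ⟨WithLp.toLp 2 v, (key _).1 h, fun h0 => hv ?_⟩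
    simpa using congrArg WithLp.ofLp h0
  · rintro ⟨w, h, hw⟩
    refine ⟨w, fun h0 => hw ?_, (key w).2 h⟩
    ext i
    exact congrFun h0 i

/-- The induced coefficients are those for which the Euler–Lagrange equations hold. -/
lemma eq_inducedCoeff_iff (hW : IsOpen W) (hL : ContDiffOn ℝ ∞ (unc L) W) (hp : p ∈ W)
    (hdet : (fundTensor L p.1 p.2).det ≠ 0) :
    G p.1 p.2 = inducedCoeff L p.1 p.2 ↔ ∀ w, EulerLagrange (unc G) (unc L) w p := by
  have hLp := hL.at hW hp
  set b : Fin n → ℝ := fun l => (∑ k, dx k (dy l L) p.1 p.2 * p.2 k) - dx l L p.1 p.2 with hb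
  have hbl : ∀ l, b l = fderiv ℝ (fderiv ℝ (unc L)) p (p.2, 0) (0, coordVec l)
      - fderiv ℝ (unc L) p (coordVec l, 0) := by
    intro l
    simp only [hb]
    rw [dx_eq (smooth_diff hW hL hp), ← fderiv_fderiv_const hLp, ← fderiv_dy hW hL hp,
      ← ContinuousLinearMap.inl_apply (R := ℝ) (M₁ := E n) (M₂ := E n) p.2,
      ← ContinuousLinearMap.comp_apply, ← sum_mul_map_coordVec]
    congr 1
    refine Finset.sum_congr rfl fun k _ => ?_
    rw [dx_eq (smooth_diff hW (smooth_dy hW hL l) hp), mul_comm]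
    rfl
  have hmul : ∀ l, (fundTensor L p.1 p.2).mulVec (G p.1 p.2) l =
      1 / 2 * fderiv ℝ (fderiv ℝ (unc L)) p (0, unc G p) (0, coordVec l) := by
    intro l
    rw [fundTensor_mulVec hW hL hp, fderiv_fderiv_symm hLp]
  -- In coordinates the Euler-Lagrange equations are the linear system 4 g G = b, whose solution is
  -- the induced coefficients.
  have hEL : ∀ l, EulerLagrange (unc G) (unc L) (coordVec l) p ↔
      4 * (fundTensor L p.1 p.2).mulVec (G p.1 p.2) l = b l := by
    intro l
    rw [EulerLagrange, fderiv_fderiv_const hLp, hmul, hbl, map_pair p.2,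
      show ((0 : E n), -(2 : ℝ) • unc G p) = -(2 : ℝ) • (0, unc G p) by simp, map_smul]
    simp only [add_apply, smul_apply, smul_eq_mul]
    constructor <;> intro h <;> linarith
  have hall : (∀ w, EulerLagrange (unc G) (unc L) w p) ↔
      ∀ l, EulerLagrange (unc G) (unc L) (coordVec l) p := by
    refine ⟨fun h l => h _, fun h w => ?_⟩
    have h1 : (fderiv ℝ (fderiv ℝ (unc L)) p (p.2, -(2 : ℝ) • unc G p)).comp
        (ContinuousLinearMap.inr ℝ (E n) (E n)) =
        (fderiv ℝ (unc L) p).comp (ContinuousLinearMap.inl ℝ (E n) (E n)) := by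
      refine ext_coordVec fun i => ?_
      have := h i
      rw [EulerLagrange, fderiv_fderiv_const hLp] at this
      simpa using this
    have := DFunLike.congr_fun h1 w
    rw [EulerLagrange, fderiv_fderiv_const hLp]
    simpa using this
  have hunit : IsUnit (fundTensor L p.1 p.2).det := isUnit_iff_ne_zero.2 hdet
  have hind : ∀ i, inducedCoeff L p.1 p.2 i = 1 / 4 * (fundTensor L p.1 p.2)⁻¹.mulVec b i :=
    fun i => rfl
  rw [hall]
  simp only [hEL]
  constructor
  · intro h l
    have h1 : (WithLp.ofLp (G p.1 p.2) : Fin n → ℝ)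
        = (1 / 4 : ℝ) • (fundTensor L p.1 p.2)⁻¹.mulVec b := by
      funext i
      rw [h, hind]
      rfl
    rw [h1, Matrix.mulVec_smul, Matrix.mulVec_mulVec, Matrix.mul_nonsing_inv _ hunit,
      Matrix.one_mulVec]
    simp
  · intro h
    have h1 : b = (4 : ℝ) • (fundTensor L p.1 p.2).mulVec (G p.1 p.2) := funext fun l => (h l).symm
    ext i
    rw [hind, h1, Matrix.mulVec_smul, Matrix.mulVec_mulVec, Matrix.nonsing_inv_mul _ hunit,
      Matrix.one_mulVec]
    simp

end Coordinates

/-! ### Proportionality on the fibres -/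

section Proportional

variable {n : ℕ}

/-- Two smooth functions that satisfy the Euler relation of degree two and have proportional
logarithmic derivatives are proportional, if one of them has no critical points. -/
theorem exists_eq_mul_of_proportional {Ω : Set (E n)} (hΩ : IsOpen Ω) (hconn : IsPreconnected Ω)
    {r l : E n → ℝ} (hr : ContDiffOn ℝ ∞ r Ω) (hl : ContDiffOn ℝ ∞ l Ω)
    (er : ∀ y ∈ Ω, fderiv ℝ r y y = 2 * r y) (el : ∀ y ∈ Ω, fderiv ℝ l y y = 2 * l y)
    (prop : ∀ y ∈ Ω, ∀ w, r y * fderiv ℝ l y w = l y * fderiv ℝ r y w)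
    (nd : ∀ y ∈ Ω, fderiv ℝ l y ≠ 0) : ∃ c : ℝ, ∀ y ∈ Ω, r y = c * l y := by
  have hrd : ∀ y ∈ Ω, DifferentiableAt ℝ r y := fun y hy =>
    (hr.contDiffAt (hΩ.mem_nhds hy)).differentiableAt (by simp)
  have hld : ∀ y ∈ Ω, DifferentiableAt ℝ l y := fun y hy =>
    (hl.contDiffAt (hΩ.mem_nhds hy)).differentiableAt (by simp)
  have hr1 : ∀ w, ContDiffOn ℝ ∞ (fun y => fderiv ℝ r y w) Ω := fun w =>
    hr.fderiv_apply_of_isOpen hΩ contDiffOn_const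
  have hl1 : ∀ w, ContDiffOn ℝ ∞ (fun y => fderiv ℝ l y w) Ω := fun w =>
    hl.fderiv_apply_of_isOpen hΩ contDiffOn_const
  -- Differentiating r dl = l dr and antisymmetrising removes the Hessians, so dr and dl are
  -- parallel even where r and l vanish.
  have hpar : ∀ y ∈ Ω, ∀ v w,
      fderiv ℝ r y w * fderiv ℝ l y v = fderiv ℝ r y v * fderiv ℝ l y w := by
    intro y hy v w
    have hry := hr.contDiffAt (hΩ.mem_nhds hy)
    have hly := hl.contDiffAt (hΩ.mem_nhds hy)
    have key : ∀ a b, r y * fderiv ℝ (fderiv ℝ l) y b a + fderiv ℝ l y a * fderiv ℝ r y b =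
        l y * fderiv ℝ (fderiv ℝ r) y b a + fderiv ℝ r y a * fderiv ℝ l y b := by
      intro a b
      have h := DFunLike.congr_fun (fderiv_congr_of_eqOn hΩ (fun z hz => prop z hz a) hy) b
      rw [fderiv_fun_mul (hrd y hy) (((hl1 a).contDiffAt (hΩ.mem_nhds hy)).differentiableAt
          (by simp)),
        fderiv_fun_mul (hld y hy) (((hr1 a).contDiffAt (hΩ.mem_nhds hy)).differentiableAt
          (by simp))] at h
      simpa [fderiv_fderiv_const hry, fderiv_fderiv_const hly] using h
    have h1 := key v w
    have h2 := key w v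
    rw [fderiv_fderiv_symm hry, fderiv_fderiv_symm hly] at h2
    linarith
  -- The factor is defined through differentials rather than as r / l, since l may vanish while dl
  -- does not.
  let s : E n → ℝ := fun y => ∑ i, fderiv ℝ l y (coordVec i) * fderiv ℝ l y (coordVec i)
  let k : E n → ℝ := fun y => (∑ i, fderiv ℝ r y (coordVec i) * fderiv ℝ l y (coordVec i)) / s y
  have hs : ∀ y ∈ Ω, s y ≠ 0 := by
    intro y hy h0
    have h1 := (Finset.sum_eq_zero_iff_of_nonneg (fun i _ => mul_self_nonneg _)).1 h0
    refine nd y hy (ext_coordVec fun i => ?_)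
    simpa using h1 i (Finset.mem_univ i)
  have hk : ContDiffOn ℝ ∞ k Ω := by
    refine ContDiffOn.div (ContDiffOn.sum fun i _ => (hr1 _).mul (hl1 _))
      (ContDiffOn.sum fun i _ => (hl1 _).mul (hl1 _)) hs
  have hkw : ∀ y ∈ Ω, ∀ w, fderiv ℝ r y w = k y * fderiv ℝ l y w := by
    intro y hy w
    have h1 : fderiv ℝ r y w * s y =
        (∑ i, fderiv ℝ r y (coordVec i) * fderiv ℝ l y (coordVec i)) * fderiv ℝ l y w := by
      simp only [s]
      rw [Finset.mul_sum, Finset.sum_mul]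
      refine Finset.sum_congr rfl fun i _ => ?_
      rw [← mul_assoc, hpar y hy]
      ring
    simp only [k]
    rw [div_mul_eq_mul_div, ← h1, mul_div_assoc, div_self (hs y hy), mul_one]
  have hrk : ∀ y ∈ Ω, r y = k y * l y := by
    intro y hy
    have := hkw y hy y
    rw [er y hy, el y hy] at this
    linarith
  have hkd : ∀ y ∈ Ω, DifferentiableAt ℝ k y := fun y hy =>
    (hk.contDiffAt (hΩ.mem_nhds hy)).differentiableAt (by simp)
  have hl0 : ∀ y ∈ Ω, l y • fderiv ℝ k y = 0 := by
    intro y hy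
    ext w
    have h1 := DFunLike.congr_fun (fderiv_congr_of_eqOn hΩ hrk hy) w
    rw [fderiv_fun_mul (hkd y hy) (hld y hy), hkw y hy] at h1
    simpa using h1
  -- From r = k l and dr = k dl one gets l dk = 0. If dk were nonzero at a point, l would vanish
  -- near it and so would dl.
  have hk0 : ∀ y ∈ Ω, fderiv ℝ k y = 0 := by
    intro y hy
    by_contra hne
    have hc : ContinuousAt (fderiv ℝ k) y :=
      ((hk.contDiffAt (hΩ.mem_nhds hy)).fderiv_right (m := ∞) (by simp)).continuousAt
    have : l =ᶠ[𝓝 y] fun _ => 0 := by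
      filter_upwards [hc.eventually_ne hne, hΩ.mem_nhds hy] with z hz hzΩ
      exact (smul_eq_zero.1 (hl0 z hzΩ)).resolve_right hz
    refine nd y hy ?_
    rw [this.fderiv_eq]
    simp
  rcases Ω.eq_empty_or_nonempty with rfl | ⟨y₀, hy₀⟩
  · exact ⟨0, by simp⟩
  · refine ⟨k y₀, fun y hy => ?_⟩
    rw [hrk y hy, hΩ.is_const_of_fderiv_eq_zero hconn
      (fun z hz => (hkd z hz).differentiableWithinAt) hk0 hy hy₀]

variable {W : Set (E n × E n)} {G : E n × E n → E n} {R L : E n × E n → ℝ}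

/-- A metric with non-degenerate vertical Hessian has no vertical critical points. -/
lemma vert_ne_zero (hW : IsOpen W) (hL : ContDiffOn ℝ ∞ L W) (hom : HomTwoOn W L)
    (nd : ∀ p ∈ W, ∀ w, (∀ v, fderiv ℝ (fderiv ℝ L) p (0, v) (0, w) = 0) → w = 0)
    {p : E n × E n} (hp : p ∈ W) (hy : p.2 ≠ 0) : ∃ w, fderiv ℝ L p (0, w) ≠ 0 := by
  by_contra! h
  -- By Euler's relation the vertical Hessian applied to y is the vertical differential, so at a
  -- critical point y itself lies in the kernel.
  refine hy (nd p hp p.2 fun v => ?_)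
  rw [fderiv_fderiv_symm (hL.at hW hp), ← fderiv_fderiv_const (hL.at hW hp),
    euler_vert (k := 1) hW hL (fun q hq => by
      rw [hom.euler hq (smooth_diff hW hL hq)]
      norm_num) hp, h v, smul_zero]

/-- A horizontally constant metric is proportional to the curvature function on each fibre. -/
theorem IsLocallyIsotropic.exists_eq_mul (S : IsLocalSpray W G) (I : IsLocallyIsotropic W G R)
    (hL : ContDiffOn ℝ ∞ L W) (hom : HomTwoOn W L) (hor : ∀ q ∈ W, ∀ w, horDeriv G w L q = 0)
    (nd : ∀ p ∈ W, ∀ w, (∀ v, fderiv ℝ (fderiv ℝ L) p (0, v) (0, w) = 0) → w = 0)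
    (hy : ∀ p ∈ W, p.2 ≠ 0) {x : E n} (hconn : IsPreconnected {y | (x, y) ∈ W}) :
    ∃ c : ℝ, ∀ y, (x, y) ∈ W → R (x, y) = c * L (x, y) := by
  have hc : Continuous fun y : E n => (x, y) := Continuous.prodMk_right x
  have hΩ : IsOpen {y | (x, y) ∈ W} := S.isOpen.preimage hc
  have hsl : ContDiff ℝ ∞ fun y : E n => (x, y) := contDiff_const.prodMk contDiff_id
  have hd : ∀ {f : E n × E n → ℝ}, ContDiffOn ℝ ∞ f W → ∀ y, (x, y) ∈ W → ∀ w,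
      fderiv ℝ (fun z => f (x, z)) y w = fderiv ℝ f (x, y) (0, w) := by
    intro f hf y hy w
    have h : HasFDerivAt (fun z => f (x, z)) _ y :=
      HasFDerivAt.comp (g := f) (f := fun z : E n => (x, z)) y
        (smooth_diff S.isOpen hf hy).hasFDerivAt
        ((hasFDerivAt_const x y).prodMk (hasFDerivAt_id y))
    rw [h.fderiv]
    simp
  refine exists_eq_mul_of_proportional hΩ hconn (r := fun y => R (x, y)) (l := fun y => L (x, y))
    (I.smooth.comp hsl.contDiffOn fun y hy => hy) (hL.comp hsl.contDiffOn fun y hy => hy)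
    (fun y hy => ?_) (fun y hy => ?_) (fun y hy w => ?_) (fun y hyW h0 => ?_)
  · rw [hd I.smooth y hy]
    exact I.hom.euler hy (smooth_diff S.isOpen I.smooth hy)
  · rw [hd hL y hy]
    exact hom.euler hy (smooth_diff S.isOpen hL hy)
  · rw [hd I.smooth y hy, hd hL y hy]
    exact I.mul_vert_eq S hL hom hor hy w
  · obtain ⟨w, hw⟩ := vert_ne_zero S.isOpen hL hom nd hyW (hy _ hyW)
    refine hw ?_
    rw [← hd hL y hyW, h0]
    rfl

end Proportional

/-! ### Coordinates on the tangent bundle -/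

section TangentCoordinates

variable {n : ℕ} {M : Type*} [TopologicalSpace M] [ChartedSpace (E n) M]
  {e e' : OpenPartialHomeomorph M (E n)} {D : Set (TangentBundle (𝓡 n) M)}

/-- The coordinates of a point of `TM` in the coordinate system induced by `e`. -/
def tangentCoord (e : OpenPartialHomeomorph M (E n)) (u : TangentBundle (𝓡 n) M) : E n × E n :=
  (e u.1, mfderiv (𝓡 n) (𝓡 n) e u.1 u.2)

/-- All tangent spaces are definitionally the model space, so vectors over equal base points are
compared without transport. -/
lemma tangentBundle_mk_eq {a b : M} (h : a = b) {v w : E n} (hvw : v = w) :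
    (⟨a, v⟩ : TangentBundle (𝓡 n) M) = ⟨b, w⟩ := by
  subst h hvw
  rfl

lemma tangentPoint_smul (e : OpenPartialHomeomorph M (E n)) (ξ η : E n) (c : ℝ) :
    tangentPoint e ξ (c • η) = ⟨e.symm ξ, c • mfderiv (𝓡 n) (𝓡 n) e.symm ξ η⟩ :=
  tangentBundle_mk_eq rfl (map_smul (mfderiv (𝓡 n) (𝓡 n) e.symm ξ) c η)

lemma HomogeneousTwo.homTwoOn {f : TangentBundle (𝓡 n) M → ℝ} (hf : HomogeneousTwo D f)
    (e : OpenPartialHomeomorph M (E n)) : HomTwoOn (chartDom e D) (unc (rep e f)) := by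
  intro p hp c hc
  change f (tangentPoint e p.1 (c • p.2)) = c ^ 2 * f (tangentPoint e p.1 p.2)
  rw [tangentPoint_smul]
  exact hf _ _ hp.2 c hc

lemma chartDom_mono {D' : Set (TangentBundle (𝓡 n) M)} (h : D' ⊆ D) :
    chartDom e D' ⊆ chartDom e D := fun _ hp => ⟨hp.1, h hp.2⟩

lemma IsCoord.contMDiffOn (he : IsCoord e) : ContMDiffOn (𝓡 n) (𝓡 n) ∞ e e.source :=
  contMDiffOn_of_mem_maximalAtlas he

lemma IsCoord.contMDiffOn_symm (he : IsCoord e) : ContMDiffOn (𝓡 n) (𝓡 n) ∞ e.symm e.target :=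
  contMDiffOn_symm_of_mem_maximalAtlas he

lemma IsCoord.mdifferentiable (he : IsCoord e) : e.MDifferentiable (𝓡 n) (𝓡 n) :=
  ⟨he.contMDiffOn.mdifferentiableOn (by simp), he.contMDiffOn_symm.mdifferentiableOn (by simp)⟩

lemma IsCoord.mdifferentiableAt_symm (he : IsCoord e) {ξ : E n} (hξ : ξ ∈ e.target) :
    MDifferentiableAt (𝓡 n) (𝓡 n) e.symm ξ :=
  he.mdifferentiable.mdifferentiableAt_symm hξ

lemma IsCoord.mfderiv_mfderiv_symm (he : IsCoord e) {ξ : E n} (hξ : ξ ∈ e.target) (η : E n) :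
    mfderiv (𝓡 n) (𝓡 n) e (e.symm ξ) (mfderiv (𝓡 n) (𝓡 n) e.symm ξ η) = η :=
  DFunLike.congr_fun (he.mdifferentiable.comp_symm_deriv hξ) η

lemma IsCoord.mfderiv_symm_mfderiv (he : IsCoord e) {x : M} (hx : x ∈ e.source)
    (v : TangentSpace (𝓡 n) x) :
    mfderiv (𝓡 n) (𝓡 n) e.symm (e x) (mfderiv (𝓡 n) (𝓡 n) e x v) = v :=
  DFunLike.congr_fun (he.mdifferentiable.symm_comp_deriv hx) v

lemma tangentCoord_tangentPoint (he : IsCoord e) {ξ : E n} (hξ : ξ ∈ e.target) (η : E n) :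
    tangentCoord e (tangentPoint e ξ η) = (ξ, η) :=
  Prod.ext (e.right_inv hξ) (he.mfderiv_mfderiv_symm hξ η)

lemma tangentPoint_tangentCoord (he : IsCoord e) {u : TangentBundle (𝓡 n) M}
    (hu : u.1 ∈ e.source) : tangentPoint e (tangentCoord e u).1 (tangentCoord e u).2 = u :=
  tangentBundle_mk_eq (e.left_inv hu) (he.mfderiv_symm_mfderiv hu u.2)

lemma tangentCoord_mem_chartDom (he : IsCoord e) {u : TangentBundle (𝓡 n) M}
    (hu : u.1 ∈ e.source) (hD : u ∈ D) : tangentCoord e u ∈ chartDom e D := by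
  refine ⟨e.map_source hu, ?_⟩
  rwa [tangentPoint_tangentCoord he hu]

variable [IsManifold (𝓡 n) ∞ M]

lemma isCoord_chartAt (x : M) : IsCoord (chartAt (E n) x) :=
  IsManifold.chart_mem_maximalAtlas x

lemma continuousOn_tangentPoint (he : IsCoord e) :
    ContinuousOn (fun p : E n × E n => tangentPoint (M := M) e p.1 p.2)
      (Prod.fst ⁻¹' e.target) := by
  have h1 := he.contMDiffOn_symm.continuousOn_tangentMapWithin (by simp)
    e.open_target.uniqueMDiffOn
  have h2 : Continuous fun p : E n × E n => (⟨p.1, p.2⟩ : TangentBundle (𝓡 n) (E n)) :=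
    (tangentBundleModelSpaceHomeomorph (𝓡 n)).symm.continuous
  refine (h1.comp h2.continuousOn fun p hp => hp).congr fun p hp => ?_
  have hp' : p.1 ∈ e.target := hp
  simp only [Function.comp, tangentMapWithin, tangentPoint,
    mfderivWithin_of_isOpen e.open_target hp']

lemma continuousOn_tangentCoord (he : IsCoord e) :
    ContinuousOn (tangentCoord (M := M) e) {u | u.1 ∈ e.source} := by
  have h1 := he.contMDiffOn.continuousOn_tangentMapWithin (by simp) e.open_source.uniqueMDiffOn
  have h2 := (tangentBundleModelSpaceHomeomorph (𝓡 n) (H := E n)).continuous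
  refine (h2.comp_continuousOn h1).congr fun u hu => ?_
  have hu' : u.1 ∈ e.source := hu
  simp only [Function.comp, tangentMapWithin, tangentCoord,
    mfderivWithin_of_isOpen e.open_source hu']
  rfl

lemma isOpen_chartDom (he : IsCoord e) (hD : IsOpen D) : IsOpen (chartDom e D) :=
  (continuousOn_tangentPoint he).isOpen_inter_preimage
    (e.open_target.preimage continuous_fst) hD

lemma isOpen_setOf_fst_mem {U : Set M} (hU : IsOpen U) :
    IsOpen {u : TangentBundle (𝓡 n) M | u.1 ∈ U} :=
  hU.preimage (FiberBundle.continuous_proj (E n) (TangentSpace (𝓡 n) : M → Type _))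

lemma isOpen_tangentCoord_preimage (he : IsCoord e) {W : Set (E n × E n)} (hW : IsOpen W) :
    IsOpen {u : TangentBundle (𝓡 n) M | u.1 ∈ e.source ∧ tangentCoord e u ∈ W} :=
  (continuousOn_tangentCoord he).isOpen_inter_preimage (isOpen_setOf_fst_mem e.open_source) hW

lemma IsConicalRegion.chartDom_smul {U : Set M} (hD : IsConicalRegion U D) {p : E n × E n}
    (hp : p ∈ chartDom e D) {c : ℝ} (hc : 0 < c) : (p.1, c • p.2) ∈ chartDom e D := by
  refine ⟨hp.1, ?_⟩
  rw [tangentPoint_smul]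
  exact hD.smul_mem _ _ hp.2 c hc

lemma IsConicalRegion.snd_ne_zero {U : Set M} (hD : IsConicalRegion U D) {p : E n × E n}
    (hp : p ∈ chartDom e D) : p.2 ≠ 0 := by
  intro h
  refine hD.ne_zero (e.symm p.1) ?_
  have h1 := hp.2
  rw [h] at h1
  have h2 : tangentPoint (M := M) e p.1 0 = ⟨e.symm p.1, 0⟩ :=
    tangentBundle_mk_eq rfl (map_zero (mfderiv (𝓡 n) (𝓡 n) e.symm p.1))
  rwa [h2] at h1

/-- The fibres of a conical region are connected in coordinates. -/
lemma IsConicalRegion.isConnected_coord {U : Set M} (hD : IsConicalRegion U D) (he : IsCoord e)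
    {ξ : E n} (hξ : ξ ∈ e.target) (hU : e.symm ξ ∈ U) :
    IsConnected {η | (ξ, η) ∈ chartDom e D} := by
  have h := hD.isConnected_fibre _ hU
  have himg : {η | (ξ, η) ∈ chartDom e D} =
      (mfderiv (𝓡 n) (𝓡 n) e (e.symm ξ)) '' fibre D (e.symm ξ) := by
    ext η
    constructor
    · rintro ⟨_, h2⟩
      exact ⟨_, h2, he.mfderiv_mfderiv_symm hξ η⟩
    · rintro ⟨v, hv, rfl⟩
      have := tangentCoord_mem_chartDom he (u := ⟨e.symm ξ, v⟩) (e.map_target hξ) hv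
      simp only [tangentCoord, e.right_inv hξ] at this
      exact this
  rw [himg]
  exact h.image _ (mfderiv (𝓡 n) (𝓡 n) e (e.symm ξ)).cont.continuousOn

end TangentCoordinates

/-! ### Sprays and metrics in coordinates -/

section SprayCoordinates

variable {n : ℕ}

lemma IsLocalSpray.mono {V : Type*} [NormedAddCommGroup V] [NormedSpace ℝ V]
    {W W' : Set (V × V)} {G : V × V → V} (S : IsLocalSpray W G) (hW' : IsOpen W') (h : W' ⊆ W) :
    IsLocalSpray W' G :=
  ⟨hW', S.smooth.mono h, fun p hp => S.hom p (h hp)⟩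

lemma IsLocallyIsotropic.mono {V : Type*} [NormedAddCommGroup V] [NormedSpace ℝ V]
    {W W' : Set (V × V)} {G : V × V → V} {R : V × V → ℝ} (I : IsLocallyIsotropic W G R)
    (h : W' ⊆ W) : IsLocallyIsotropic W' G R :=
  ⟨I.smooth.mono h, fun p hp => I.hom p (h hp), fun p hp => I.curv p (h hp)⟩

lemma horCurv_congr {V : Type*} [NormedAddCommGroup V] [NormedSpace ℝ V]
    {W : Set (V × V)} {G G' : V × V → V} (hW : IsOpen W) (h : EqOn G G' W) {p : V × V} (hp : p ∈ W)
    (v w : V) : horCurv G v w p = horCurv G' v w p := by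
  have h1 : ∀ q ∈ W, fderiv ℝ G q = fderiv ℝ G' q := fun q hq => fderiv_congr_of_eqOn hW h hq
  have h2 : ∀ a, fderiv ℝ (fun q => fderiv ℝ G q (0, a)) p =
      fderiv ℝ (fun q => fderiv ℝ G' q (0, a)) p := fun a =>
    fderiv_congr_of_eqOn hW (fun q hq => by simp only [h1 q hq]) hp
  simp only [horCurv, horDeriv, horLift, h1 p hp, h2]

/-- The Riemann curvature is a tensor. -/
lemma IsLocalSpray.exists_riemann {V : Type*} [NormedAddCommGroup V] [NormedSpace ℝ V]
    {W : Set (V × V)} {G : V × V → V} (S : IsLocalSpray W G) {p : V × V} (hp : p ∈ W) :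
    ∃ T : V →L[ℝ] V, ∀ w, horCurv G w p.2 p = T w := by
  refine ⟨(2 : ℝ) • (fderiv ℝ G p).comp (ContinuousLinearMap.inl ℝ V V)
    - (fderiv ℝ (fderiv ℝ G) p (p.2, -(2 : ℝ) • G p)).comp (ContinuousLinearMap.inr ℝ V V)
    - ((fderiv ℝ G p).comp (ContinuousLinearMap.inr ℝ V V)).comp
      ((fderiv ℝ G p).comp (ContinuousLinearMap.inr ℝ V V)), fun w => ?_⟩
  rw [S.horCurv_snd hp, fderiv_fderiv_const (S.smooth.at S.isOpen hp)]
  simp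

variable {M : Type*} [TopologicalSpace M] [ChartedSpace (E n) M] [IsManifold (𝓡 n) ∞ M]
  {e : OpenPartialHomeomorph M (E n)} {D : Set (TangentBundle (𝓡 n) M)} {G : Spray n M}
  {R L : TangentBundle (𝓡 n) M → ℝ}

lemma Spray.isLocalSpray (G : Spray n M) (he : IsCoord e) :
    IsLocalSpray (chartDom e G.region) (unc (G.coeff e)) :=
  ⟨isOpen_chartDom he G.isConicalRegion.isOpen, G.smooth e he,
    fun p hp c hc => G.homogeneous e he p hp c hc⟩

lemma Spray.isLocalSpray_of_subset (G : Spray n M) (he : IsCoord e) (hD : IsOpen D)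
    (h : D ⊆ G.region) : IsLocalSpray (chartDom e D) (unc (G.coeff e)) :=
  (G.isLocalSpray he).mono (isOpen_chartDom he hD) (chartDom_mono h)

/-- The curvature condition is given on coordinate vectors only. Linearity of the Riemann curvature
extends it to every `w`. -/
lemma Spray.IsIsotropic.isLocallyIsotropic (hR : G.IsIsotropic R) (he : IsCoord e) :
    IsLocallyIsotropic (chartDom e G.region) (unc (G.coeff e)) (unc (rep e R)) := by
  have S := G.isLocalSpray he
  refine ⟨hR.smooth e he, hR.homogeneous.homTwoOn e, fun p hp w => ?_⟩
  obtain ⟨T, hT⟩ := S.exists_riemann hp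
  let T' : E n →L[ℝ] E n := unc (rep e R) p • ContinuousLinearMap.id ℝ (E n)
    - ((1 / 2 : ℝ) • (fderiv ℝ (unc (rep e R)) p).comp
      (ContinuousLinearMap.inr ℝ (E n) (E n))).smulRight p.2
  have hTT : T = T' := by
    refine ext_coordVec fun k => ?_
    ext i
    rw [← hT, ← riemann_eq S hp, hR.curvature e he p hp,
      dy_eq (smooth_diff S.isOpen (hR.smooth e he) hp)]
    simp [T', coordVec]
  rw [hT, hTT]
  simp [T']

/-- In coordinates, a metric that induces the spray is horizontally constant and has a
non-degenerate vertical Hessian. -/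
lemma Spray.IsInducedBy.coord (h : G.IsInducedBy D L) (he : IsCoord e) (hD : IsOpen D)
    (hDG : D ⊆ G.region) :
    (∀ p ∈ chartDom e D, ∀ w, horDeriv (unc (G.coeff e)) w (unc (rep e L)) p = 0) ∧
      ∀ p ∈ chartDom e D, ∀ w,
        (∀ v, fderiv ℝ (fderiv ℝ (unc (rep e L))) p (0, v) (0, w) = 0) → w = 0 := by
  have S := G.isLocalSpray_of_subset he hD hDG
  have hL := h.1.smooth e he
  refine ⟨(S.eulerLagrange_iff hL (h.1.homogeneous.homTwoOn e)).1 fun p hp => ?_, fun p hp => ?_⟩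
  · exact (eq_inducedCoeff_iff S.isOpen hL hp (h.1.nondegenerate e he p hp)).1 (h.2 e he p hp)
  · exact (det_fundTensor_ne_zero_iff S.isOpen hL hp).1 (h.1.nondegenerate e he p hp)

/-- A horizontally constant metric induces the spray. -/
lemma Spray.isInducedBy_of_horDeriv (hD : IsOpen D) (hDG : D ⊆ G.region)
    (hL : IsFinslerMetric D L)
    (hor : ∀ e : OpenPartialHomeomorph M (E n), IsCoord e → ∀ p ∈ chartDom e D, ∀ w,
      horDeriv (unc (G.coeff e)) w (unc (rep e L)) p = 0) : G.IsInducedBy D L := by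
  refine ⟨hL, fun e he p hp => ?_⟩
  have S := G.isLocalSpray_of_subset he hD hDG
  refine (eq_inducedCoeff_iff S.isOpen (hL.smooth e he) hp (hL.nondegenerate e he p hp)).2 ?_
  exact (S.eulerLagrange_iff (hL.smooth e he) (hL.homogeneous.homTwoOn e)).2 (hor e he) p hp

/-- The Riemann curvature of the induced spray. -/
lemma Spray.IsInducedBy.riemann_eq {U : Set M} (h : G.IsInducedBy D L) (hD : IsConicalRegion U D)
    (he : IsCoord e) (hDG : D ⊆ G.region) {p : E n × E n} (hp : p ∈ chartDom e D) (i k : Fin n) :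
    riemann (inducedCoeff (rep e L)) i k p.1 p.2 = riemann (G.coeff e) i k p.1 p.2 := by
  have S := G.isLocalSpray_of_subset he hD.isOpen hDG
  have heq : EqOn (unc (inducedCoeff (rep e L))) (unc (G.coeff e)) (chartDom e D) :=
    fun q hq => (h.2 e he q hq).symm
  have S' : IsLocalSpray (chartDom e D) (unc (inducedCoeff (rep e L))) :=
    ⟨S.isOpen, S.smooth.congr heq, fun q hq c hc => by
      rw [heq hq, heq (hD.chartDom_smul hq hc)]
      exact S.hom q hq c hc⟩
  rw [SprayGeometry.riemann_eq S' hp, SprayGeometry.riemann_eq S hp,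
    horCurv_congr S.isOpen heq hp]

end SprayCoordinates

/-! ### Metrizability and the curvature function -/

section NonMetrizable

variable {n : ℕ}

lemma fundTensor_eq_smul {L₁ L₂ : E n → E n → ℝ} {x y : E n} {c : ℝ}
    (h : (fun z => L₁ x z) =ᶠ[𝓝 y] fun z => c * L₂ x z) :
    fundTensor L₁ x y = c • fundTensor L₂ x y := by
  ext i j
  have h1 : (fun z => dy j (fun x' y' => L₁ x' y' / 2) x z) =ᶠ[𝓝 y]
      fun z => c • dy j (fun x' y' => L₂ x' y' / 2) x z := by
    filter_upwards [h.eventuallyEq_nhds] with z hz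
    have h2 : (fun w => L₁ x w / 2) =ᶠ[𝓝 z] c • fun w => L₂ x w / 2 := by
      filter_upwards [hz] with w hw
      simp only [hw, Pi.smul_apply, smul_eq_mul]
      ring
    simp only [dy]
    rw [h2.fderiv_eq, fderiv_const_smul_field]
    rfl
  change fderiv ℝ (fun z => dy j (fun x' y' => L₁ x' y' / 2) x z) y _ = _
  rw [h1.fderiv_eq, show (fun z => c • dy j (fun x' y' => L₂ x' y' / 2) x z) =
    c • fun z => dy j (fun x' y' => L₂ x' y' / 2) x z from rfl, fderiv_const_smul_field]
  rfl

/-- A function with non-degenerate fundamental tensor does not vanish on an open subset of a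
fibre. -/
lemma exists_ne_zero_of_det {f : E n → E n → ℝ} {x y : E n} (hdet : (fundTensor f x y).det ≠ 0)
    (hy : y ≠ 0) {B : Set (E n)} (hB : B ∈ 𝓝 y) : ∃ z ∈ B, f x z ≠ 0 := by
  by_contra! h
  have h0 : fundTensor f x y = (0 : ℝ) • fundTensor f x y :=
    fundTensor_eq_smul (by filter_upwards [hB] with z hz; simpa using h z hz)
  rw [zero_smul] at h0
  -- The empty matrix has determinant 1, so dimension zero must be excluded; `y ≠ 0` does that.
  have : Nonempty (Fin n) := by
    by_contra hne
    rw [not_nonempty_iff] at hne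
    exact hy (Subsingleton.elim _ _)
  exact hdet (by rw [h0, Matrix.det_zero])

variable {M : Type*} [TopologicalSpace M] [ChartedSpace (E n) M] [IsManifold (𝓡 n) ∞ M]
  {e : OpenPartialHomeomorph M (E n)} {D : Set (TangentBundle (𝓡 n) M)} {G : Spray n M}
  {R L : TangentBundle (𝓡 n) M → ℝ}

lemma IsConicalRegion.isPreconnected_coord {U : Set M} (hD : IsConicalRegion U D)
    (he : IsCoord e) (ξ : E n) : IsPreconnected {η | (ξ, η) ∈ chartDom e D} := by
  rcases Set.eq_empty_or_nonempty {η | (ξ, η) ∈ chartDom e D} with h | ⟨η, hη⟩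
  · rw [h]
    exact isPreconnected_empty
  · exact (hD.isConnected_coord he hη.1 (hD.base_mem _ hη.2)).isPreconnected

/-- On each fibre, the curvature function is a multiple of any metric that induces the spray. -/
lemma Spray.IsInducedBy.exists_eq_mul {U : Set M} (hR : G.IsIsotropic R) (h : G.IsInducedBy D L)
    (hD : IsConicalRegion U D) (hDG : D ⊆ G.region) (he : IsCoord e) (ξ : E n) :
    ∃ c : ℝ, ∀ η, (ξ, η) ∈ chartDom e D → rep e R ξ η = c * rep e L ξ η :=
  IsLocallyIsotropic.exists_eq_mul (G.isLocalSpray_of_subset he hD.isOpen hDG)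
    ((hR.isLocallyIsotropic he).mono (chartDom_mono hDG)) (h.1.smooth e he)
    (h.1.homogeneous.homTwoOn e) (h.coord he hD.isOpen hDG).1 (h.coord he hD.isOpen hDG).2
    (fun _ hp => hD.snd_ne_zero hp) (hD.isPreconnected_coord he ξ)

lemma Spray.IsMetrizable.isLocallyMetrizable (h : G.IsMetrizable) : G.IsLocallyMetrizable := by
  obtain ⟨L, hL⟩ := h
  exact fun u hu => ⟨univ, G.region, G.isConicalRegion, subset_rfl, hu, L, hL⟩

/-- If the spray is locally metrizable and the curvature function vanishes identically on no
fibre, then the curvature function is a Finsler metric. -/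
theorem Spray.IsLocallyMetrizable.isFinslerMetric (h : G.IsLocallyMetrizable)
    (hR : G.IsIsotropic R)
    (hne : ∀ x : M, ∃ y ∈ fibre G.region x, R ⟨x, y⟩ ≠ 0) : IsFinslerMetric G.region R := by
  refine ⟨hR.smooth, hR.homogeneous, fun e he p hp hdet => ?_⟩
  have hslice : ∀ {W : Set (E n × E n)}, IsOpen W → IsOpen {η | (p.1, η) ∈ W} :=
    fun hW => hW.preimage (Continuous.prodMk_right p.1)
  -- With R = c L on the fibre of a local metric, c = 0 puts η in `Z` and c ≠ 0 makes the Hessian of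
  -- R nondegenerate nearby. A degenerate point lies in `Z`, and `Z` is open and relatively closed,
  -- so it is the whole fibre.
  let Z : Set (E n) := {η | ∀ᶠ z in 𝓝 η, rep e R p.1 z = 0}
  have dich : ∀ η, (p.1, η) ∈ chartDom e G.region →
      η ∈ Z ∨ ∀ᶠ z in 𝓝 η, (fundTensor (rep e R) p.1 z).det ≠ 0 := by
    intro η hη
    obtain ⟨U, D, hD, hDG, huD, L, hL⟩ := h _ hη.2
    obtain ⟨c, hc⟩ := hL.exists_eq_mul hR hD hDG he p.1
    have hΩ := hslice (isOpen_chartDom he hD.isOpen)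
    have hηD : η ∈ {η | (p.1, η) ∈ chartDom e D} := ⟨hη.1, huD⟩
    rcases eq_or_ne c 0 with rfl | hc0
    · left
      filter_upwards [hΩ.mem_nhds hηD] with z hz
      simpa using hc z hz
    · right
      filter_upwards [hΩ.mem_nhds hηD] with z hz
      have h1 : fundTensor (rep e R) p.1 z = c • fundTensor (rep e L) p.1 z :=
        fundTensor_eq_smul (by filter_upwards [hΩ.mem_nhds hz] with w hw using hc w hw)
      rw [h1, Matrix.det_smul]
      exact mul_ne_zero (pow_ne_zero _ hc0) (hL.1.nondegenerate e he _ hz)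
  have hsub : {η | (p.1, η) ∈ chartDom e G.region} ⊆ Z := by
    refine (G.isConicalRegion.isPreconnected_coord he p.1).subset_of_closure_inter_subset
      isOpen_setOfPred_eventually_nhds ⟨p.2, hp, ?_⟩ fun η hη => ?_
    · exact (dich p.2 hp).resolve_right fun h0 => h0.self_of_nhds hdet
    · refine (dich η hη.2).resolve_right fun h0 => ?_
      have h1 : ∀ᶠ z in 𝓝 η, (p.1, z) ∈ chartDom e G.region :=
        (hslice (isOpen_chartDom he G.isConicalRegion.isOpen)).mem_nhds hη.2
      obtain ⟨z, ⟨hz1, hz3⟩, hz2⟩ := mem_closure_iff_nhds.1 hη.1 _ (h0.and h1)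
      obtain ⟨w, hw1, hw2⟩ := exists_ne_zero_of_det hz1
        (G.isConicalRegion.snd_ne_zero hz3) hz2
      exact hw2 hw1
  obtain ⟨y, hy, hy0⟩ := hne (e.symm p.1)
  have hcoord := tangentCoord_mem_chartDom he (u := ⟨e.symm p.1, y⟩) (e.map_target hp.1) hy
  have hpt := tangentPoint_tangentCoord he (u := ⟨e.symm p.1, y⟩) (e.map_target hp.1)
  have hfst : (tangentCoord e (⟨e.symm p.1, y⟩ : TangentBundle (𝓡 n) M)).1 = p.1 :=
    e.right_inv hp.1
  rw [hfst] at hpt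
  refine hy0 ?_
  rw [← hpt]
  refine (hsub ?_ : _ ∈ Z).self_of_nhds
  rw [← Prod.mk.eta (p := tangentCoord e _), hfst] at hcoord
  exact hcoord

end NonMetrizable

/-! ### Changes of coordinates -/

section LocalTransition

variable {V : Type*} [NormedAddCommGroup V] [NormedSpace ℝ V]

/-- The map `(x, y) ↦ (ψ(x), Dψ(x) y)`. -/
def tangentLift (ψ : V → V) (p : V × V) : V × V := (ψ p.1, fderiv ℝ ψ p.1 p.2)

variable {ψ : V → V} {O : Set V} {W W' : Set (V × V)} {G G' : V × V → V} {p : V × V}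

lemma hasFDerivAt_tangentLift (hψ : ContDiffAt ℝ ∞ ψ p.1) (a b : V) :
    DifferentiableAt ℝ (tangentLift ψ) p ∧ fderiv ℝ (tangentLift ψ) p (a, b) =
      (fderiv ℝ ψ p.1 a, fderiv ℝ (fderiv ℝ ψ) p.1 a p.2 + fderiv ℝ ψ p.1 b) := by
  have h1 : HasFDerivAt (fun q : V × V => ψ q.1) _ p :=
    (hψ.differentiableAt (by simp)).hasFDerivAt.comp p hasFDerivAt_fst
  have h2 : HasFDerivAt (fun q : V × V => fderiv ℝ ψ q.1) _ p :=
    hψ.differentiableAt_fderiv.hasFDerivAt.comp p hasFDerivAt_fst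
  have h3 := h1.prodMk (h2.clm_apply hasFDerivAt_snd)
  refine ⟨h3.differentiableAt, ?_⟩
  have h4 : fderiv ℝ (tangentLift ψ) p = _ := h3.fderiv
  rw [h4]
  simp [add_comm]

lemma contDiffOn_tangentLift (hO : IsOpen O) (hψ : ContDiffOn ℝ ∞ ψ O) :
    ContDiffOn ℝ ∞ (tangentLift ψ) (Prod.fst ⁻¹' O) :=
  (hψ.comp contDiff_fst.contDiffOn fun _ hq => hq).prodMk
    (((hψ.fderiv_of_isOpen hO (m := ∞) (by simp)).comp contDiff_fst.contDiffOn
      fun _ hq => hq).clm_apply contDiff_snd.contDiffOn)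

/-- A change of coordinates that maps sprays to each other maps the horizontal lifts to each
other. -/
theorem IsLocalSpray.fderiv_tangentLift_horLift (S' : IsLocalSpray W' G') (S : IsLocalSpray W G)
    (hO : IsOpen O) (hψ : ContDiffOn ℝ ∞ ψ O) (hWO : ∀ q ∈ W', q.1 ∈ O)
    (hT : MapsTo (tangentLift ψ) W' W)
    (compat : ∀ q ∈ W', fderiv ℝ (tangentLift ψ) q (q.2, (-2 : ℝ) • G' q) =
      ((tangentLift ψ q).2, (-2 : ℝ) • G (tangentLift ψ q)))
    (hp : p ∈ W') (w : V) :
    fderiv ℝ (tangentLift ψ) p (horLift G' w p) =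
      horLift G (fderiv ℝ ψ p.1 w) (tangentLift ψ p) := by
  have hψp : ContDiffAt ℝ ∞ ψ p.1 := hψ.contDiffAt (hO.mem_nhds (hWO p hp))
  have hG' : HasFDerivAt G' _ p :=
    ((S'.smooth.at S'.isOpen hp).differentiableAt (by simp)).hasFDerivAt
  have hG : HasFDerivAt G _ (tangentLift ψ p) :=
    ((S.smooth.at S.isOpen (hT hp)).differentiableAt (by simp)).hasFDerivAt
  have hTd : HasFDerivAt (tangentLift ψ) _ p := (hasFDerivAt_tangentLift hψp 0 0).1.hasFDerivAt
  have hsl : HasFDerivAt (fun y : V => (p.1, y)) _ p.2 :=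
    (hasFDerivAt_const (𝕜 := ℝ) p.1 p.2).prodMk (hasFDerivAt_id p.2)
  -- The fibre component of compatibility, as an identity of functions of y. Its derivative in the
  -- direction `w` is the transformation law of the connection.
  have hev : (fun y => fderiv ℝ (fderiv ℝ ψ) p.1 y y + (-2 : ℝ) • fderiv ℝ ψ p.1 (G' (p.1, y)))
      =ᶠ[𝓝 p.2] fun y => (-2 : ℝ) • G (tangentLift ψ (p.1, y)) := by
    have : {y | (p.1, y) ∈ W'} ∈ 𝓝 p.2 :=
      (S'.isOpen.preimage (Continuous.prodMk_right p.1)).mem_nhds hp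
    filter_upwards [this] with y hy
    have h := congrArg Prod.snd (compat _ hy)
    rw [(hasFDerivAt_tangentLift (p := (p.1, y)) hψp _ _).2] at h
    simpa using h
  have hl := ((fderiv ℝ (fderiv ℝ ψ) p.1).hasFDerivAt.clm_apply (hasFDerivAt_id p.2)).add
    (((fderiv ℝ ψ p.1).hasFDerivAt.comp p.2 (hG'.comp p.2 hsl)).const_smul (-2 : ℝ))
  have hr := (hG.comp p.2 (hTd.comp p.2 hsl)).const_smul (-2 : ℝ)
  have key := DFunLike.congr_fun (hl.unique (hr.congr_of_eventuallyEq hev)) w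
  have hTw := (hasFDerivAt_tangentLift (p := p) hψp 0 w).2
  simp only [add_apply, smul_apply,
    ContinuousLinearMap.comp_apply, ContinuousLinearMap.prod_apply,
    zero_apply, ContinuousLinearMap.id_apply, hTw,
    ContinuousLinearMap.flip_apply, id, map_zero, zero_add] at key
  -- The quadratic term contributes its polar form twice, which matches the factor -2 of the spray
  -- coefficients.
  rw [fderiv_fderiv_symm hψp p.2 w, ← two_smul ℝ (fderiv ℝ (fderiv ℝ ψ) p.1 w p.2), neg_smul,
    neg_smul, ← sub_eq_add_neg, ← smul_sub, ← smul_neg] at key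
  have key' := smul_right_injective V (two_ne_zero (α := ℝ)) key
  rw [horLift, horLift, (hasFDerivAt_tangentLift hψp _ _).2, map_neg, ← sub_eq_add_neg, key']

lemma horDeriv_comp_tangentLift {f : V × V → ℝ} (S' : IsLocalSpray W' G') (S : IsLocalSpray W G)
    (hO : IsOpen O) (hψ : ContDiffOn ℝ ∞ ψ O) (hWO : ∀ q ∈ W', q.1 ∈ O)
    (hT : MapsTo (tangentLift ψ) W' W)
    (compat : ∀ q ∈ W', fderiv ℝ (tangentLift ψ) q (q.2, (-2 : ℝ) • G' q) =
      ((tangentLift ψ q).2, (-2 : ℝ) • G (tangentLift ψ q)))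
    (hf : ContDiffOn ℝ ∞ f W) (hp : p ∈ W') (w : V) :
    horDeriv G' w (f ∘ tangentLift ψ) p =
      horDeriv G (fderiv ℝ ψ p.1 w) f (tangentLift ψ p) := by
  have hψp : ContDiffAt ℝ ∞ ψ p.1 := hψ.contDiffAt (hO.mem_nhds (hWO p hp))
  rw [horDeriv, horDeriv, ← S'.fderiv_tangentLift_horLift S hO hψ hWO hT compat hp,
    fderiv_comp p ((hf.at S.isOpen (hT hp)).differentiableAt (by simp))
      (hasFDerivAt_tangentLift hψp 0 0).1]
  rfl

/-- The tangent lift is linear on fibres, so no second derivative of `ψ` enters and the vertical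
Hessian transforms as a tensor. -/
lemma fderiv_fderiv_comp_tangentLift {f : V × V → ℝ} (hW' : IsOpen W') (hW : IsOpen W)
    (hO : IsOpen O) (hψ : ContDiffOn ℝ ∞ ψ O) (hWO : ∀ q ∈ W', q.1 ∈ O)
    (hT : MapsTo (tangentLift ψ) W' W) (hf : ContDiffOn ℝ ∞ f W) (hp : p ∈ W') (v w : V) :
    fderiv ℝ (fderiv ℝ (f ∘ tangentLift ψ)) p (0, v) (0, w) =
      fderiv ℝ (fderiv ℝ f) (tangentLift ψ p) (0, fderiv ℝ ψ p.1 v) (0, fderiv ℝ ψ p.1 w) := by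
  have hψa : ∀ q ∈ W', ContDiffAt ℝ ∞ ψ q.1 := fun q hq => hψ.contDiffAt (hO.mem_nhds (hWO q hq))
  have hfT : ContDiffOn ℝ ∞ (f ∘ tangentLift ψ) W' :=
    hf.comp ((contDiffOn_tangentLift hO hψ).mono fun q hq => hWO q hq) hT
  have h1 : EqOn (fun q => fderiv ℝ (f ∘ tangentLift ψ) q (0, w))
      (fun q => fderiv ℝ f (tangentLift ψ q) (0, fderiv ℝ ψ q.1 w)) W' := by
    intro q hq
    simp only
    rw [fderiv_comp q ((hf.at hW (hT hq)).differentiableAt (by simp))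
      (hasFDerivAt_tangentLift (hψa q hq) 0 0).1, ContinuousLinearMap.comp_apply,
      (hasFDerivAt_tangentLift (hψa q hq) 0 w).2]
    simp
  rw [← fderiv_fderiv_const (hfT.at hW' hp), fderiv_congr_of_eqOn hW' h1 hp]
  have h2 : HasFDerivAt (fun q : V × V => fderiv ℝ f (tangentLift ψ q)) _ p :=
    (hf.at hW (hT hp)).differentiableAt_fderiv.hasFDerivAt.comp p
      (hasFDerivAt_tangentLift (hψa p hp) 0 0).1.hasFDerivAt
  have h3 : HasFDerivAt (fun q : V × V => fderiv ℝ ψ q.1) _ p :=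
    (hψa p hp).differentiableAt_fderiv.hasFDerivAt.comp p hasFDerivAt_fst
  have h4 := (hasFDerivAt_const (0 : V) p).prodMk (h3.clm_apply (hasFDerivAt_const w p))
  rw [(h2.clm_apply h4).fderiv]
  have hTw := (hasFDerivAt_tangentLift (hψa p hp) 0 v).2
  simp only [add_apply, ContinuousLinearMap.comp_apply,
    ContinuousLinearMap.flip_apply, hTw]
  simp [show ((0 : V), (0 : V)) = 0 from rfl]

end LocalTransition

/-! ### Independence of coordinates on the manifold. -/

section Transition

variable {n : ℕ} {M : Type*} [TopologicalSpace M] {e e' : OpenPartialHomeomorph M (E n)}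

/-- The domain of the change of coordinates from `e'` to `e`. -/
def transitionDom (e' e : OpenPartialHomeomorph M (E n)) : Set (E n) :=
  e'.target ∩ e'.symm ⁻¹' e.source

lemma isOpen_transitionDom (e' e : OpenPartialHomeomorph M (E n)) :
    IsOpen (transitionDom e' e) :=
  e'.isOpen_inter_preimage_symm e.open_source

variable [ChartedSpace (E n) M] {D : Set (TangentBundle (𝓡 n) M)} {f : TangentBundle (𝓡 n) M → ℝ}

lemma contDiffOn_transition (he' : IsCoord e') (he : IsCoord e) :
    ContDiffOn ℝ ∞ (fun ξ => e (e'.symm ξ)) (transitionDom e' e) :=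
  (he.contMDiffOn.comp (he'.contMDiffOn_symm.mono inter_subset_left)
    fun _ h => h.2).contDiffOn

lemma fderiv_transition (he' : IsCoord e') (he : IsCoord e) {ξ : E n}
    (hξ : ξ ∈ transitionDom e' e) (w : E n) :
    fderiv ℝ (fun ξ => e (e'.symm ξ)) ξ w =
      mfderiv (𝓡 n) (𝓡 n) e (e'.symm ξ) (mfderiv (𝓡 n) (𝓡 n) e'.symm ξ w) := by
  have h := mfderiv_comp (I := 𝓡 n) (I' := 𝓡 n) (I'' := 𝓡 n) ξ
    (he.mdifferentiable.mdifferentiableAt hξ.2) (he'.mdifferentiableAt_symm hξ.1)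
  rw [← mfderiv_eq_fderiv]
  exact DFunLike.congr_fun h w

lemma fderiv_transition_injective (he' : IsCoord e') (he : IsCoord e) {ξ : E n}
    (hξ : ξ ∈ transitionDom e' e) : Function.Injective (fderiv ℝ (fun ξ => e (e'.symm ξ)) ξ) := by
  intro v w h
  rw [fderiv_transition he' he hξ, fderiv_transition he' he hξ] at h
  have h1 := congrArg (fun a => mfderiv (𝓡 n) (𝓡 n) e.symm (e (e'.symm ξ)) a) h
  simp only [he.mfderiv_symm_mfderiv hξ.2] at h1
  have h2 := congrArg (fun a => mfderiv (𝓡 n) (𝓡 n) e' (e'.symm ξ) a) h1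
  simp only [he'.mfderiv_mfderiv_symm hξ.1] at h2
  exact h2

lemma fderiv_transition_surjective (he' : IsCoord e') (he : IsCoord e) {ξ : E n}
    (hξ : ξ ∈ transitionDom e' e) :
    Function.Surjective (fderiv ℝ (fun ξ => e (e'.symm ξ)) ξ) :=
  (LinearMap.injective_iff_surjective (f := (fderiv ℝ (fun ξ => e (e'.symm ξ)) ξ).toLinearMap)).1
    (fderiv_transition_injective he' he hξ)

lemma tangentLift_transition (he' : IsCoord e') (he : IsCoord e) {p : E n × E n}
    (hp : p.1 ∈ transitionDom e' e) :
    tangentLift (fun ξ => e (e'.symm ξ)) p = tangentCoord e (tangentPoint e' p.1 p.2) :=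
  Prod.ext rfl (fderiv_transition he' he hp p.2)

lemma tangentPoint_tangentLift (he' : IsCoord e') (he : IsCoord e) {p : E n × E n}
    (hp : p.1 ∈ transitionDom e' e) :
    tangentPoint e (tangentLift (fun ξ => e (e'.symm ξ)) p).1
      (tangentLift (fun ξ => e (e'.symm ξ)) p).2 = tangentPoint e' p.1 p.2 := by
  rw [tangentLift_transition he' he hp]
  exact tangentPoint_tangentCoord he hp.2

/-- The part of the coordinate domain of `e'` on which the coordinates of `e` are defined. -/
def overlap (e' e : OpenPartialHomeomorph M (E n)) (D : Set (TangentBundle (𝓡 n) M)) :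
    Set (E n × E n) := chartDom e' D ∩ Prod.fst ⁻¹' transitionDom e' e

lemma mapsTo_overlap (he' : IsCoord e') (he : IsCoord e) :
    MapsTo (tangentLift fun ξ => e (e'.symm ξ)) (overlap e' e D) (chartDom e D) := by
  intro p hp
  rw [tangentLift_transition he' he hp.2]
  exact tangentCoord_mem_chartDom he hp.2.2 hp.1.2

lemma rep_eqOn (he' : IsCoord e') (he : IsCoord e) (f : TangentBundle (𝓡 n) M → ℝ) :
    EqOn (unc (rep e' f)) (unc (rep e f) ∘ tangentLift fun ξ => e (e'.symm ξ))
      (Prod.fst ⁻¹' transitionDom e' e) := by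
  intro p hp
  exact congrArg f (tangentPoint_tangentLift he' he hp).symm

variable [IsManifold (𝓡 n) ∞ M] {G : Spray n M}

lemma isOpen_overlap (he' : IsCoord e') (hD : IsOpen D) : IsOpen (overlap e' e D) :=
  (isOpen_chartDom he' hD).inter ((isOpen_transitionDom e' e).preimage continuous_fst)

/-- The horizontal derivative does not depend on the coordinates. -/
theorem Spray.horDeriv_rep (he' : IsCoord e') (he : IsCoord e) (hD : IsOpen D)
    (hDG : D ⊆ G.region)
    (hf : ContDiffOn ℝ ∞ (unc (rep e f)) (chartDom e D)) {p : E n × E n}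
    (hp : p ∈ overlap e' e D) (w : E n) :
    horDeriv (unc (G.coeff e')) w (unc (rep e' f)) p =
      horDeriv (unc (G.coeff e)) (fderiv ℝ (fun ξ => e (e'.symm ξ)) p.1 w) (unc (rep e f))
        (tangentLift (fun ξ => e (e'.symm ξ)) p) := by
  have S' : IsLocalSpray (overlap e' e D) (unc (G.coeff e')) :=
    (G.isLocalSpray he').mono (isOpen_overlap he' hD)
      (inter_subset_left.trans (chartDom_mono hDG))
  have S := G.isLocalSpray_of_subset he hD hDG
  rw [← horDeriv_comp_tangentLift S' S (isOpen_transitionDom e' e)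
    (contDiffOn_transition he' he) (fun q hq => hq.2) (mapsTo_overlap he' he)
    (fun q hq => G.compatible e' e he' he q (chartDom_mono hDG hq.1) hq.2.2) hf hp, horDeriv,
    horDeriv, fderiv_congr_of_eqOn (S'.isOpen)
      ((rep_eqOn he' he f).mono inter_subset_right) hp]

/-- Smoothness, horizontal constancy and non-degeneracy in one coordinate system. -/
theorem Spray.isInducedBy_of_coord (he : IsCoord e) (hD : IsOpen D) (hDG : D ⊆ G.region)
    (hDe : ∀ u ∈ D, u.1 ∈ e.source) (hf : ContDiffOn ℝ ∞ (unc (rep e f)) (chartDom e D))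
    (hom : HomogeneousTwo D f)
    (hor : ∀ p ∈ chartDom e D, ∀ w, horDeriv (unc (G.coeff e)) w (unc (rep e f)) p = 0)
    (nd : ∀ p ∈ chartDom e D, ∀ w,
      (∀ v, fderiv ℝ (fderiv ℝ (unc (rep e f))) p (0, v) (0, w) = 0) → w = 0) :
    G.IsInducedBy D f := by
  have hov : ∀ e' : OpenPartialHomeomorph M (E n), chartDom e' D = overlap e' e D := fun e' =>
    (inter_eq_left.2 (show chartDom e' D ⊆ Prod.fst ⁻¹' transitionDom e' e from
      fun p hp => ⟨hp.1, hDe _ hp.2⟩)).symm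
  have hsm : SmoothOnTM D f := by
    intro e' he'
    rw [hov e']
    exact (hf.comp ((contDiffOn_tangentLift (isOpen_transitionDom e' e)
      (contDiffOn_transition he' he)).mono fun q hq => hq.2) (mapsTo_overlap he' he)).congr
        ((rep_eqOn he' he f).mono inter_subset_right)
  refine G.isInducedBy_of_horDeriv hD hDG ⟨hsm, hom, fun e' he' p hp => ?_⟩ fun e' he' p hp w => ?_
  · have hp' : p ∈ overlap e' e D := hov e' ▸ hp
    have hW' := isOpen_overlap (e := e) he' hD
    refine (det_fundTensor_ne_zero_iff (isOpen_chartDom he' hD) (hsm e' he') hp).2 fun w hw => ?_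
    have hsur := fderiv_transition_surjective he' he hp'.2
    refine fderiv_transition_injective he' he hp'.2 ?_
    rw [map_zero]
    refine nd _ (mapsTo_overlap he' he hp') _ fun v => ?_
    obtain ⟨v, rfl⟩ := hsur v
    rw [← fderiv_fderiv_comp_tangentLift hW' (isOpen_chartDom he hD) (isOpen_transitionDom e' e)
      (contDiffOn_transition he' he) (fun q hq => hq.2) (mapsTo_overlap he' he) hf hp', ← hw v]
    have h1 : EqOn (fderiv ℝ (unc (rep e' f)))
        (fderiv ℝ (unc (rep e f) ∘ tangentLift fun ξ => e (e'.symm ξ))) (overlap e' e D) :=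
      fun q hq => fderiv_congr_of_eqOn hW' ((rep_eqOn he' he f).mono inter_subset_right) hq
    rw [fderiv_congr_of_eqOn hW' h1 hp']
  · have hp' : p ∈ overlap e' e D := hov e' ▸ hp
    rw [G.horDeriv_rep he' he hD hDG hf hp', hor _ (mapsTo_overlap he' he hp')]

end Transition

/-! ### Sprays of vanishing curvature -/

section Flat

variable {n : ℕ} {M : Type*} [TopologicalSpace M] [ChartedSpace (E n) M]

lemma tangentCoord_zero (e : OpenPartialHomeomorph M (E n)) (x : M) :
    tangentCoord e (⟨x, (0 : TangentSpace (𝓡 n) x)⟩ : TangentBundle (𝓡 n) M) = (e x, 0) :=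
  Prod.ext rfl (map_zero (mfderiv (𝓡 n) (𝓡 n) e x))

lemma tangentCoord_smul (e : OpenPartialHomeomorph M (E n)) (x : M) (y : TangentSpace (𝓡 n) x)
    (c : ℝ) : tangentCoord e (⟨x, c • y⟩ : TangentBundle (𝓡 n) M) =
      ((tangentCoord e (⟨x, y⟩ : TangentBundle (𝓡 n) M)).1,
        c • (tangentCoord e (⟨x, y⟩ : TangentBundle (𝓡 n) M)).2) :=
  Prod.ext rfl (map_smul (mfderiv (𝓡 n) (𝓡 n) e x) c y)

lemma IsCoord.mfderiv_mfderiv_symm' {e : OpenPartialHomeomorph M (E n)} (he : IsCoord e) {x : M}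
    (hx : x ∈ e.source) (η : E n) :
    mfderiv (𝓡 n) (𝓡 n) e x (mfderiv (𝓡 n) (𝓡 n) e.symm (e x) η) = η := by
  have key : ∀ x', x' = x → ∀ a : E n,
      (mfderiv (𝓡 n) (𝓡 n) e x' a : E n) = mfderiv (𝓡 n) (𝓡 n) e x a := by
    rintro _ rfl _
    rfl
  exact (key _ (e.left_inv hx) _).symm.trans (he.mfderiv_mfderiv_symm (e.map_source hx) η)

variable [IsManifold (𝓡 n) ∞ M]
  {G : Spray n M} {R : TangentBundle (𝓡 n) M → ℝ}

/-- A spray of vanishing curvature is locally metrizable. -/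
theorem Spray.IsIsotropic.isLocallyMetrizable_of_eq_zero (hR : G.IsIsotropic R)
    (h0 : ∀ u ∈ G.region, R u = 0) : G.IsLocallyMetrizable := by
  intro u hu
  set e := chartAt (E n) u.1 with he_def
  have he : IsCoord e := isCoord_chartAt u.1
  have hue : u.1 ∈ e.source := mem_chart_source (E n) u.1
  have S := G.isLocalSpray he
  have I := hR.isLocallyIsotropic he
  have hup := tangentCoord_mem_chartDom he hue hu
  have hR0 : ∀ q ∈ chartDom e G.region, fderiv ℝ (unc (rep e R)) q = 0 := by
    intro q hq
    rw [fderiv_congr_of_eqOn S.isOpen (f := unc (rep e R)) (g := fun _ => (0 : ℝ))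
      (fun z hz => h0 _ hz.2) hq]
    simp
  have flat : ∀ q ∈ chartDom e G.region, ∀ v w, horCurv (unc (G.coeff e)) v w q = 0 := by
    intro q hq v w
    rw [I.horCurv_eq S hq, hR0 q hq]
    simp
  obtain ⟨O, B, L, hO, hxO, hB, hyB, hBc, hB0, hBs, hOB, hL, hom, hor, nd⟩ :=
    S.exists_flat_metric (x₀ := (tangentCoord e u).1) (y₀ := (tangentCoord e u).2)
      (fun q hq c hc => G.isConicalRegion.chartDom_smul hq hc) flat hup
      (G.isConicalRegion.snd_ne_zero hup)
  let D : Set (TangentBundle (𝓡 n) M) := {v | v.1 ∈ e.source ∧ tangentCoord e v ∈ O ×ˢ B}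
  have hDopen : IsOpen D := isOpen_tangentCoord_preimage he (hO.prod hB)
  have hDe : chartDom e D ⊆ O ×ˢ B := by
    intro p hp
    have := hp.2.2
    rwa [tangentCoord_tangentPoint he hp.1] at this
  have hDG : D ⊆ G.region := by
    intro v hv
    have := (hOB hv.2).2
    rwa [tangentPoint_tangentCoord he hv.1] at this
  have hrep : EqOn (unc (rep e fun v => L (tangentCoord e v))) L (chartDom e D) := by
    intro p hp
    exact congrArg L (tangentCoord_tangentPoint he hp.1 p.2)
  have hWo := isOpen_chartDom he hDopen
  have hfib : ∀ x ∈ e.source, e x ∈ O →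
      fibre D x = (mfderiv (𝓡 n) (𝓡 n) e.symm (e x)) '' B := by
    intro x hx hxO
    ext v
    constructor
    · intro hv
      exact ⟨_, hv.2.2, he.mfderiv_symm_mfderiv hx v⟩
    · rintro ⟨η, hη, rfl⟩
      refine ⟨hx, hxO, ?_⟩
      exact (congrArg (fun z : E n => z ∈ B) (he.mfderiv_mfderiv_symm' hx η)).mpr hη
  have hD : IsConicalRegion (e.source ∩ e ⁻¹' O) D :=
    { isOpen_base := e.isOpen_inter_preimage hO
      isOpen := hDopen
      base_mem := fun v hv => ⟨hv.1, hv.2.1⟩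
      isConnected_fibre := fun x hx => by
        rw [hfib x hx.1 hx.2]
        exact hBc.image _ (mfderiv (𝓡 n) (𝓡 n) e.symm (e x)).cont.continuousOn
      ne_zero := fun x hx => hB0 (by
        have := hx.2.2
        rwa [tangentCoord_zero] at this)
      smul_mem := fun x y hy c hc => by
        refine ⟨hy.1, ?_⟩
        rw [tangentCoord_smul]
        exact ⟨hy.2.1, hBs _ hy.2.2 c hc⟩ }
  refine ⟨e.source ∩ e ⁻¹' O, D, hD, hDG, ⟨hue, hxO, hyB⟩, fun v => L (tangentCoord e v), ?_⟩
  refine G.isInducedBy_of_coord he hDopen hDG (fun v hv => hv.1) ((hL.mono hDe).congr hrep)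
    (fun x y hy c hc => ?_) (fun p hp w => ?_) fun p hp w hw => ?_
  · simp only [tangentCoord_smul]
    exact hom _ hy.2 c hc
  · rw [horDeriv, fderiv_congr_of_eqOn hWo hrep hp]
    exact hor p (hDe hp) w
  · refine nd p (hDe hp) w fun v => ?_
    rw [← hw v, fderiv_congr_of_eqOn hWo
      (fun q hq => fderiv_congr_of_eqOn hWo hrep hq : EqOn (fderiv ℝ (unc (rep e _))) _ _) hp]

end Flat

/-! ### Curvature functions with prescribed logarithmic horizontal derivative -/

section LocalLog

variable {V : Type*} [NormedAddCommGroup V] [NormedSpace ℝ V] {W : Set (V × V)}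
  {G : V × V → V} {R : V × V → ℝ} {p : V × V}

lemma fderiv_zero_snd_eq {f : V × V → ℝ} (hf : DifferentiableAt ℝ f p) (w : V) :
    fderiv ℝ f p (0, w) = fderiv ℝ (fun y => f (p.1, y)) p.2 w := by
  have h : HasFDerivAt (fun y => f (p.1, y)) _ p.2 :=
    HasFDerivAt.comp (g := f) (f := fun y : V => (p.1, y)) p.2 hf.hasFDerivAt
      ((hasFDerivAt_const (𝕜 := ℝ) p.1 p.2).prodMk (hasFDerivAt_id p.2))
  rw [h.fderiv]
  simp

lemma horDeriv_fst_mul {l : V → ℝ} {f : V × V → ℝ} (hl : DifferentiableAt ℝ l p.1)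
    (hf : DifferentiableAt ℝ f p) (w : V) :
    horDeriv G w (fun q => l q.1 * f q) p = fderiv ℝ l p.1 w * f p + l p.1 * horDeriv G w f p := by
  have h1 : HasFDerivAt (fun q : V × V => l q.1) _ p := hl.hasFDerivAt.comp p hasFDerivAt_fst
  have h2 : fderiv ℝ (fun q => l q.1 * f q) p = _ := (h1.mul hf.hasFDerivAt).fderiv
  rw [horDeriv, h2]
  simp [horDeriv, horLift]
  ring

/-- Two vectors span a proper subspace. The outcome is the input of `vert_horDeriv_symm`, and the
only place where dimension three is needed. -/
lemma exists_functional_of_three_le [FiniteDimensional ℝ V] (h : 3 ≤ Module.finrank ℝ V)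
    (u w : V) : ∃ (v : V) (φ : V →L[ℝ] ℝ), φ u = 0 ∧ φ v = 1 ∧ φ w = 0 := by
  classical
  have hlt : Submodule.span ℝ {u, w} < ⊤ := by
    refine lt_top_iff_ne_top.2 fun htop => ?_
    have h1 := finrank_span_finset_le_card (R := ℝ) ({u, w} : Finset V)
    rw [Set.finrank, Finset.coe_insert, Finset.coe_singleton, htop, finrank_top] at h1
    have h2 := Finset.card_le_two (a := u) (b := w)
    omega
  obtain ⟨f, hf, hle⟩ := Submodule.exists_le_ker_of_lt_top _ hlt
  obtain ⟨v, hv⟩ : ∃ v, f v ≠ 0 := by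
    by_contra! h0
    exact hf (LinearMap.ext h0)
  refine ⟨(f v)⁻¹ • v, LinearMap.toContinuousLinearMap f, ?_, ?_, ?_⟩
  · exact hle (Submodule.subset_span (by simp))
  · simp [hv]
  · exact hle (Submodule.subset_span (by simp))

/-- In dimension at least three, the logarithmic horizontal derivative of the curvature function
depends on the direction, unless it vanishes. -/
theorem IsLocallyIsotropic.eq_zero_of_horDeriv [FiniteDimensional ℝ V]
    (h3 : 3 ≤ Module.finrank ℝ V) (S : IsLocalSpray W G) (I : IsLocallyIsotropic W G R)
    (hp : p ∈ W) (nd : ∀ w, (∀ v, fderiv ℝ (fderiv ℝ R) p (0, v) (0, w) = 0) → w = 0)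
    {a : V →L[ℝ] ℝ}
    (h : ∀ y, (p.1, y) ∈ W → ∀ w, horDeriv G w R (p.1, y) = R (p.1, y) * a w) : a = 0 := by
  have hslice : IsOpen {y | (p.1, y) ∈ W} := S.isOpen.preimage (Continuous.prodMk_right p.1)
  have hd : ∀ q ∈ W, DifferentiableAt ℝ R q := fun q hq =>
    (I.smooth.at S.isOpen hq).differentiableAt (by simp)
  have hvert : ∀ y, (p.1, y) ∈ W → ∀ u w,
      fderiv ℝ (horDeriv G u R) (p.1, y) (0, w) = fderiv ℝ R (p.1, y) (0, w) * a u := by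
    intro y hy u w
    have hs : HasFDerivAt (fun z => R (p.1, z)) _ y :=
      HasFDerivAt.comp (g := R) (f := fun y : V => (p.1, y)) y (hd _ hy).hasFDerivAt
        ((hasFDerivAt_const (𝕜 := ℝ) p.1 y).prodMk (hasFDerivAt_id y))
    rw [fderiv_zero_snd_eq (((S.smooth_horDeriv I.smooth u).at S.isOpen hy).differentiableAt
      (by simp)), fderiv_zero_snd_eq (hd _ hy),
      fderiv_congr_of_eqOn hslice (fun z hz => h z hz u) hy, (hs.mul_const (a u)).fderiv, hs.fderiv]
    simp [mul_comm]
  -- The covector is the same for all directions of the fibre, so the symmetry of the mixed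
  -- derivatives becomes a relation between `a` and the vertical differential of R.
  have hsymm : ∀ y, (p.1, y) ∈ W → ∀ u w,
      fderiv ℝ R (p.1, y) (0, w) * a u = fderiv ℝ R (p.1, y) (0, u) * a w := by
    intro y hy u w
    obtain ⟨v, φ, hu, hv, hw⟩ := exists_functional_of_three_le h3 u w
    rw [← hvert y hy, ← hvert y hy]
    exact I.vert_horDeriv_symm S hy u v w φ hu hv hw
  by_contra ha
  obtain ⟨u, hu⟩ : ∃ u, a u ≠ 0 := by
    by_contra! h0
    exact ha (ContinuousLinearMap.ext h0)
  -- A kernel vector of `a` annihilates the differential of R along the whole fibre, hence lies in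
  -- the kernel of the Hessian.
  have hinj : Function.Injective a.toLinearMap := by
    rw [← LinearMap.ker_eq_bot, LinearMap.ker_eq_bot']
    intro w hw
    have hw' : a w = 0 := hw
    refine nd w fun v => ?_
    have hR := I.smooth.at S.isOpen hp
    rw [← fderiv_fderiv_const hR, fderiv_zero_snd_eq
      (((I.smooth.vert S.isOpen w).at S.isOpen hp).differentiableAt (by simp)),
      fderiv_congr_of_eqOn hslice (g := fun _ => (0 : ℝ)) (fun y hy => ?_) hp]
    · simp
    · have := hsymm y hy u w
      rw [hw', mul_zero] at this
      exact (mul_eq_zero.1 this).resolve_right hu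
  have := LinearMap.finrank_le_finrank_of_injective hinj
  rw [Module.finrank_self] at this
  omega

end LocalLog

/-! ### Logarithmic potentials on the base and the metrics R/λ. -/

section Log

variable {n : ℕ} {M : Type*} [TopologicalSpace M] [ChartedSpace (E n) M]
  {e : OpenPartialHomeomorph M (E n)} {θ : OneForm n M} {U : Set M} {lam : M → ℝ}

/-- The coordinate expression of a 1-form. -/
def formAt (e : OpenPartialHomeomorph M (E n)) (θ : OneForm n M) (ξ : E n) : E n →L[ℝ] ℝ :=
  (θ (e.symm ξ)).comp (mfderiv (𝓡 n) (𝓡 n) e.symm ξ)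

lemma formAt_coordVec (i : Fin n) (ξ : E n) :
    formAt e θ ξ (coordVec i) = formComp e θ i ξ := rfl

lemma formAt_eq_sum (ξ : E n) :
    formAt e θ ξ = ∑ i, formComp e θ i ξ • EuclideanSpace.proj (𝕜 := ℝ) i := by
  ext w
  rw [← sum_mul_map_coordVec]
  simp [formAt_coordVec, mul_comm]

lemma OneForm.apply_eq (he : IsCoord e) (θ : OneForm n M) {x : M} (hx : x ∈ e.source)
    (v : TangentSpace (𝓡 n) x) : θ x v = formAt e θ (e x) (mfderiv (𝓡 n) (𝓡 n) e x v) := by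
  have key : ∀ x', x' = x → ∀ a : E n, θ x' a = θ x a := by
    rintro _ rfl _
    rfl
  refine (congrArg (θ x) (he.mfderiv_symm_mfderiv hx v)).symm.trans ?_
  exact (key _ (e.left_inv hx) _).symm

lemma contDiffOn_comp_symm (he : IsCoord e) (hl : ContMDiffOn (𝓡 n) 𝓘(ℝ, ℝ) ∞ lam U) :
    ContDiffOn ℝ ∞ (fun ξ => lam (e.symm ξ)) (e.target ∩ e.symm ⁻¹' U) :=
  (hl.comp (he.contMDiffOn_symm.mono inter_subset_left) fun _ h => h.2).contDiffOn

lemma isLogPotential_one : IsLogPotential (n := n) (M := M) univ 0 (fun _ => 1) where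
  smooth := contMDiffOn_const
  ne_zero _ _ := one_ne_zero
  eq x _ v := by
    rw [mfderiv_const]
    rfl

/-- This is θ = d ln|λ| with the denominator cleared, the form that enters the Leibniz rule for λ ·
(R/λ). -/
lemma IsLogPotential.mul_formAt (h : IsLogPotential U θ lam) (hU : IsOpen U) (he : IsCoord e)
    {ξ : E n} (hξ : ξ ∈ e.target) (hξU : e.symm ξ ∈ U) (w : E n) :
    lam (e.symm ξ) * formAt e θ ξ w = fderiv ℝ (fun ξ => lam (e.symm ξ)) ξ w := by
  have hopen : IsOpen (e.target ∩ e.symm ⁻¹' U) := e.isOpen_inter_preimage_symm hU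
  have hne := h.ne_zero _ hξU
  have hl : DifferentiableAt ℝ (fun ξ => lam (e.symm ξ)) ξ :=
    ((contDiffOn_comp_symm he h.smooth).contDiffAt (hopen.mem_nhds ⟨hξ, hξU⟩)).differentiableAt
      (by simp)
  have hlM : MDifferentiableAt (𝓡 n) 𝓘(ℝ, ℝ) lam (e.symm ξ) :=
    (h.smooth.contMDiffAt (hU.mem_nhds hξU)).mdifferentiableAt (by simp)
  have hlog : MDifferentiableAt (𝓡 n) 𝓘(ℝ, ℝ) (fun z => Real.log |lam z|) (e.symm ξ) := by
    simp only [Real.log_abs]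
    exact MDifferentiableAt.comp (I' := 𝓘(ℝ, ℝ)) (g := Real.log) (e.symm ξ)
      (Real.differentiableAt_log hne).mdifferentiableAt hlM
  have h1 : formAt e θ ξ w = mfderiv (𝓡 n) 𝓘(ℝ, ℝ) (fun z => Real.log |lam z|) (e.symm ξ)
      (mfderiv (𝓡 n) (𝓡 n) e.symm ξ w) := h.eq _ hξU _
  have h2 := DFunLike.congr_fun (mfderiv_comp (I := 𝓡 n) (I' := 𝓡 n) (I'' := 𝓘(ℝ, ℝ)) ξ hlog
    (he.mdifferentiableAt_symm hξ)) w
  have h3 : formAt e θ ξ w = fderiv ℝ (fun ξ => Real.log (lam (e.symm ξ))) ξ w := by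
    have hfun : (fun ξ => Real.log (lam (e.symm ξ))) =
        (fun z => Real.log |lam z|) ∘ e.symm := by
      funext ξ
      simp only [Function.comp, Real.log_abs]
    rw [hfun, ← mfderiv_eq_fderiv]
    exact h1.trans h2.symm
  rw [h3, (hl.hasFDerivAt.log hne).fderiv]
  simp [hne]

variable [IsManifold (𝓡 n) ∞ M] {G : Spray n M} {R : TangentBundle (𝓡 n) M → ℝ}

lemma Spray.HorizontalLog.horDeriv_eq (h : G.HorizontalLog R θ) (hR : SmoothOnTM G.region R)
    (he : IsCoord e) {p : E n × E n} (hp : p ∈ chartDom e G.region) (w : E n) :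
    horDeriv (unc (G.coeff e)) w (unc (rep e R)) p = rep e R p.1 p.2 * formAt e θ p.1 w := by
  have S := G.isLocalSpray he
  have hlin : (fderiv ℝ (unc (rep e R)) p).comp (ContinuousLinearMap.inl ℝ (E n) (E n))
      - (fderiv ℝ (unc (rep e R)) p).comp ((ContinuousLinearMap.inr ℝ (E n) (E n)).comp
        ((fderiv ℝ (unc (G.coeff e)) p).comp (ContinuousLinearMap.inr ℝ (E n) (E n)))) =
      rep e R p.1 p.2 • formAt e θ p.1 := by
    refine ext_coordVec fun i => ?_
    have h1 := h e he p hp i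
    rw [hderiv_eq S.isOpen S.smooth (hR e he) hp, IsLocalSpray.horDeriv_eq] at h1
    exact h1
  rw [IsLocalSpray.horDeriv_eq]
  exact DFunLike.congr_fun hlin w

lemma Spray.isConicalRegion_restrictTo (G : Spray n M) (hU : IsOpen U) :
    IsConicalRegion U (restrictTo G.region U) where
  isOpen_base := hU
  isOpen := G.isConicalRegion.isOpen.inter (isOpen_setOf_fst_mem hU)
  base_mem _ hu := hu.2
  isConnected_fibre x hx := by
    have : fibre (restrictTo G.region U) x = fibre G.region x := by
      ext y
      exact ⟨fun hy => hy.1, fun hy => ⟨hy, hx⟩⟩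
    rw [this]
    exact G.isConicalRegion.isConnected_fibre x (mem_univ x)
  ne_zero x hx := G.isConicalRegion.ne_zero x hx.1
  smul_mem x y hy c hc := ⟨G.isConicalRegion.smul_mem x y hy.1 c hc, hy.2⟩

/-- A potential of the logarithmic horizontal derivative of the curvature function turns it into
a metric that induces the spray. -/
theorem Spray.isInducedBy_div (hFR : IsFinslerMetric G.region R)
    (hlog : G.HorizontalLog R θ) (hU : IsOpen U) (h : IsLogPotential U θ lam) :
    G.IsInducedBy (restrictTo G.region U) (fun u => R u / lam u.1) := by
  have hD := G.isConicalRegion_restrictTo hU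
  have hDG : restrictTo G.region U ⊆ G.region := fun u hu => hu.1
  have hopen : ∀ e : OpenPartialHomeomorph M (E n), IsOpen (e.target ∩ e.symm ⁻¹' U) :=
    fun e => e.isOpen_inter_preimage_symm hU
  have hsm : SmoothOnTM (restrictTo G.region U) (fun u => R u / lam u.1) := by
    intro e he
    refine ((hFR.smooth e he).mono (chartDom_mono hDG)).div
      ((contDiffOn_comp_symm he h.smooth).comp contDiff_fst.contDiffOn
        fun p hp => ⟨hp.1, hp.2.2⟩) fun p hp => h.ne_zero _ hp.2.2
  refine G.isInducedBy_of_horDeriv hD.isOpen hDG ⟨hsm, fun x y hy c hc => ?_,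
    fun e he p hp => ?_⟩ fun e he p hp w => ?_
  · simp only [hFR.homogeneous x y hy.1 c hc]
    ring
  · have h1 : fundTensor (rep e fun u => R u / lam u.1) p.1 p.2 =
        (lam (e.symm p.1))⁻¹ • fundTensor (rep e R) p.1 p.2 :=
      fundTensor_eq_smul (Filter.Eventually.of_forall fun z => div_eq_inv_mul _ _)
    rw [h1, Matrix.det_smul]
    exact mul_ne_zero (pow_ne_zero _ (inv_ne_zero (h.ne_zero _ hp.2.2)))
      (hFR.nondegenerate e he p (chartDom_mono hDG hp))
  · have hWo := isOpen_chartDom he hD.isOpen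
    have hne := h.ne_zero _ hp.2.2
    have hl : DifferentiableAt ℝ (fun ξ => lam (e.symm ξ)) p.1 :=
      ((contDiffOn_comp_symm he h.smooth).contDiffAt
        ((hopen e).mem_nhds ⟨hp.1, hp.2.2⟩)).differentiableAt (by simp)
    -- With L = R/λ, the Leibniz rule gives R_{;w} = dλ(w) L + λ L_{;w}. The hypothesis says R_{;w}
    -- = dλ(w) L, so λ L_{;w} = 0.
    have hmul : EqOn (unc (rep e R))
        (fun q => (fun ξ => lam (e.symm ξ)) q.1 * unc (rep e fun u => R u / lam u.1) q)
        (chartDom e (restrictTo G.region U)) :=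
      fun q hq => (mul_div_cancel₀ _ (h.ne_zero _ hq.2.2)).symm
    have h1 := hlog.horDeriv_eq hFR.smooth he (chartDom_mono hDG hp) w
    rw [horDeriv, fderiv_congr_of_eqOn hWo hmul hp, ← horDeriv,
      horDeriv_fst_mul hl (smooth_diff hWo (hsm e he) hp),
      ← h.mul_formAt hU he hp.1 hp.2.2] at h1
    have h2 : rep e R p.1 p.2 = lam (e.symm p.1) * unc (rep e fun u => R u / lam u.1) p := hmul hp
    rw [h2] at h1
    refine (mul_eq_zero.1 (?_ : lam (e.symm p.1) * _ = 0)).resolve_left hne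
    linear_combination h1

/-- The Riemann curvature depends on the spray alone, and factoring λ out of the isotropic
expression in R leaves the flag curvature expression of R/λ. -/
theorem Spray.IsIsotropic.hasFlagCurvature_div (hR : G.IsIsotropic R) (hU : IsOpen U)
    (hne : ∀ x ∈ U, lam x ≠ 0)
    (h : G.IsInducedBy (restrictTo G.region U) (fun u => R u / lam u.1)) :
    HasFlagCurvature (restrictTo G.region U) (fun u => R u / lam u.1) (fun u => lam u.1) := by
  have hDG : restrictTo G.region U ⊆ G.region := fun u hu => hu.1
  intro e he p hp i k
  rw [h.riemann_eq (G.isConicalRegion_restrictTo hU) he hDG hp,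
    hR.curvature e he p (chartDom_mono hDG hp)]
  have hp0 : lam (e.symm p.1) ≠ 0 := hne _ hp.2.2
  have hdy : dy k (fun x y => rep e (fun u => R u / lam u.1) x y / 2) p.1 p.2 =
      (2 * lam (e.symm p.1))⁻¹ * dy k (rep e R) p.1 p.2 := by
    have h1 : (fun y => rep e (fun u => R u / lam u.1) p.1 y / 2) =
        (2 * lam (e.symm p.1))⁻¹ • fun y => rep e R p.1 y := by
      funext y
      change R _ / lam (e.symm p.1) / 2 = (2 * lam (e.symm p.1))⁻¹ * R _
      field_simp
    simp only [dy]
    rw [h1, fderiv_const_smul_field]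
    rfl
  rw [hdy]
  change _ = lam (e.symm p.1) * (rep e R p.1 p.2 / lam (e.symm p.1) * _ - _)
  field_simp

/-- In dimension at least three, the logarithmic horizontal derivative vanishes. -/
theorem Spray.IsIsotropic.form_eq_zero (hn : 3 ≤ n) (hR : G.IsIsotropic R)
    (hFR : IsFinslerMetric G.region R) (hlog : G.HorizontalLog R θ) : θ = 0 := by
  funext x
  ext v
  have he : IsCoord (chartAt (E n) x) := isCoord_chartAt x
  have hx := mem_chart_source (E n) x
  obtain ⟨y, hy⟩ := (G.isConicalRegion.isConnected_fibre x (mem_univ x)).nonempty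
  have hp := tangentCoord_mem_chartDom he (u := ⟨x, y⟩) hx hy
  have S := G.isLocalSpray he
  have h0 : formAt (chartAt (E n) x) θ (chartAt (E n) x x) = 0 :=
    (hR.isLocallyIsotropic he).eq_zero_of_horDeriv (by simpa using hn) S hp
      ((det_fundTensor_ne_zero_iff S.isOpen (hFR.smooth _ he) hp).1 (hFR.nondegenerate _ he _ hp))
      fun η hη w => hlog.horDeriv_eq hFR.smooth he hη w
  rw [OneForm.apply_eq he θ hx, h0]
  rfl

lemma Spray.HorizontalLog.horizontallyConstant (h : G.HorizontalLog R 0) :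
    G.HorizontallyConstant R := by
  intro e he p hp i
  rw [h e he p hp i]
  exact mul_zero _

/-- A closed 1-form is locally the logarithmic differential of a nowhere vanishing function. -/
theorem IsClosedOneForm.exists_isLogPotential (hθ : IsClosedOneForm θ) (x : M) :
    ∃ (U : Set M) (lam : M → ℝ), IsOpen U ∧ x ∈ U ∧ IsLogPotential U θ lam := by
  set e := chartAt (E n) x
  have he : IsCoord e := isCoord_chartAt x
  have hx : x ∈ e.source := mem_chart_source (E n) x
  obtain ⟨r, hr, hball⟩ := Metric.isOpen_iff.1 e.open_target (e x) (e.map_source hx)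
  have hsm : ContDiffOn ℝ ∞ (formAt e θ) (Metric.ball (e x) r) := by
    rw [show formAt e θ = _ from funext formAt_eq_sum]
    exact ContDiffOn.sum fun i _ => ((hθ.smooth e he i).mono hball).smul contDiffOn_const
  have hd : ∀ ξ ∈ Metric.ball (e x) r, DifferentiableAt ℝ (formAt e θ) ξ := fun ξ hξ =>
    (hsm.contDiffAt (Metric.isOpen_ball.mem_nhds hξ)).differentiableAt (by simp)
  have hsymm : ∀ ξ ∈ Metric.ball (e x) r, ∀ u w,
      fderiv ℝ (formAt e θ) ξ u w = fderiv ℝ (formAt e θ) ξ w u := by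
    intro ξ hξ u w
    have hc : ∀ i j, fderiv ℝ (formAt e θ) ξ (coordVec j) (coordVec i) =
        fderiv ℝ (formComp e θ i) ξ (coordVec j) := by
      intro i j
      have h1 := ((hd ξ hξ).hasFDerivAt.clm_apply (hasFDerivAt_const (coordVec i) ξ)).fderiv
      have h2 : (fun ξ => formAt e θ ξ (coordVec i)) = formComp e θ i := rfl
      rw [h2] at h1
      rw [h1]
      simp
    have hflip : fderiv ℝ (formAt e θ) ξ = (fderiv ℝ (formAt e θ) ξ).flip := by
      refine ext_coordVec fun j => ext_coordVec fun i => ?_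
      rw [ContinuousLinearMap.flip_apply, hc, hc]
      exact hθ.closed e he ξ (hball hξ) i j
    exact DFunLike.congr_fun (DFunLike.congr_fun hflip u) w
  -- Poincaré's lemma on a coordinate ball; the exponential of the primitive then serves as a
  -- positive λ.
  obtain ⟨f, hf⟩ := (convex_ball (e x) r).exists_forall_hasFDerivAt_of_fderiv_symmetric
    Metric.isOpen_ball (fun ξ hξ => (hd ξ hξ).differentiableWithinAt) hsymm
  have hfs : ContDiffOn ℝ ∞ f (Metric.ball (e x) r) :=
    (contDiffOn_infty_iff_fderiv_of_isOpen Metric.isOpen_ball).2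
      ⟨fun ξ hξ => (hf ξ hξ).differentiableAt.differentiableWithinAt,
        hsm.congr fun ξ hξ => (hf ξ hξ).fderiv⟩
  refine ⟨e.source ∩ e ⁻¹' Metric.ball (e x) r, fun z => Real.exp (f (e z)),
    e.isOpen_inter_preimage Metric.isOpen_ball, ⟨hx, Metric.mem_ball_self hr⟩, ?_,
    fun z _ => Real.exp_ne_zero _, fun z hz v => ?_⟩
  · exact (Real.contDiff_exp.comp_contDiffOn hfs).contMDiffOn.comp
      (he.contMDiffOn.mono inter_subset_left) fun z hz => hz.2
  · have key : ∀ g : M → ℝ, g = f ∘ e →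
        mfderiv (𝓡 n) 𝓘(ℝ, ℝ) g z v = formAt e θ (e z) (mfderiv (𝓡 n) (𝓡 n) e z v) := by
      rintro _ rfl
      rw [← (hf _ hz.2).fderiv, ← mfderiv_eq_fderiv]
      exact DFunLike.congr_fun (mfderiv_comp (I := 𝓡 n) (I' := 𝓡 n) (I'' := 𝓘(ℝ, ℝ)) z
        (hf _ hz.2).differentiableAt.mdifferentiableAt
        (he.mdifferentiable.mdifferentiableAt hz.1)) v
    refine (OneForm.apply_eq he θ hz.1 v).trans (key _ ?_).symm
    funext z
    simp

end Log

/-! ### The 1-form of a locally metrizable spray -/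

section LocalPotential

variable {n : ℕ} {W : Set (E n × E n)} {G : E n × E n → E n} {R L : E n × E n → ℝ}

/-- If a horizontally constant metric exists, then the logarithmic horizontal derivative of the
curvature function is locally the differential of a function on the base. -/
theorem IsLocallyIsotropic.exists_local_potential (S : IsLocalSpray W G)
    (I : IsLocallyIsotropic W G R) (hL : ContDiffOn ℝ ∞ L W) (hom : HomTwoOn W L)
    (hor : ∀ q ∈ W, ∀ w, horDeriv G w L q = 0)
    (nd : ∀ p ∈ W, ∀ w, (∀ v, fderiv ℝ (fderiv ℝ L) p (0, v) (0, w) = 0) → w = 0)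
    (hy : ∀ p ∈ W, p.2 ≠ 0) (hconn : ∀ x, IsPreconnected {y | (x, y) ∈ W})
    (hRne : ∀ p ∈ W, ∀ B ∈ 𝓝 p.2, ∃ z ∈ B, R (p.1, z) ≠ 0)
    (hLne : ∀ p ∈ W, ∀ B ∈ 𝓝 p.2, ∃ z ∈ B, L (p.1, z) ≠ 0) {p : E n × E n} (hp : p ∈ W) :
    ∃ (O B : Set (E n)) (l : E n → ℝ), IsOpen O ∧ p.1 ∈ O ∧ IsOpen B ∧ p.2 ∈ B ∧ O ×ˢ B ⊆ W ∧
      ContDiffOn ℝ ∞ l O ∧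
        ∀ q ∈ O ×ˢ B, ∀ w, horDeriv G w R q = R q * fderiv ℝ l q.1 w := by
  have hslice : ∀ x, IsOpen {y | (x, y) ∈ W} := fun x =>
    S.isOpen.preimage (Continuous.prodMk_right x)
  -- L may vanish at `p` itself. A nearby direction where it does not allows the proportionality
  -- factor to be written as a smooth quotient on the base.
  obtain ⟨y₀, hy₀, hLy₀⟩ := hLne p hp _ ((hslice p.1).mem_nhds hp)
  let O₁ : Set (E n) := {x | (x, y₀) ∈ W ∩ L ⁻¹' {0}ᶜ}
  have hO₁ : IsOpen O₁ :=
    (hL.continuousOn.isOpen_inter_preimage S.isOpen isOpen_compl_singleton).preimage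
      (Continuous.prodMk_left y₀)
  let c : E n → ℝ := fun x => R (x, y₀) / L (x, y₀)
  have hsl : ContDiff ℝ ∞ fun x : E n => (x, y₀) := contDiff_id.prodMk contDiff_const
  have hc : ContDiffOn ℝ ∞ c O₁ :=
    (I.smooth.comp hsl.contDiffOn fun x hx => hx.1).div
      (hL.comp hsl.contDiffOn fun x hx => hx.1) fun x hx => hx.2
  have hcL : ∀ x ∈ O₁, ∀ y, (x, y) ∈ W → R (x, y) = c x * L (x, y) := by
    intro x hx y hxy
    obtain ⟨k, hk⟩ := I.exists_eq_mul S hL hom hor nd hy (hconn x)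
    have h1 := hk y₀ hx.1
    have h2 : c x = k := by
      simp only [c, h1]
      exact mul_div_cancel_right₀ _ hx.2
    rw [hk y hxy, h2]
  have hc0 : ∀ x ∈ O₁, c x ≠ 0 := by
    intro x hx h0
    obtain ⟨z, hz, hz0⟩ := hRne _ hx.1 _ ((hslice x).mem_nhds hx.1)
    refine hz0 ?_
    rw [hcL x hx z hz, h0, zero_mul]
  obtain ⟨O₂, B, hO₂, hB, hpO₂, hpB, hOB⟩ := isOpen_prod_iff.1 S.isOpen p.1 p.2 hp
  have hsub : (O₁ ∩ O₂) ×ˢ B ⊆ W := (prod_mono inter_subset_right subset_rfl).trans hOB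
  -- The factor may be negative: `Real.log` is the logarithm of the absolute value, so nonvanishing
  -- suffices.
  refine ⟨O₁ ∩ O₂, B, fun x => Real.log (c x), hO₁.inter hO₂, ⟨⟨hy₀, hLy₀⟩, hpO₂⟩, hB, hpB,
    hsub, (hc.mono inter_subset_left).log fun x hx => hc0 x hx.1, fun q hq w => ?_⟩
  have hqW := hsub hq
  have hcd : DifferentiableAt ℝ c q.1 :=
    (hc.contDiffAt (hO₁.mem_nhds hq.1.1)).differentiableAt (by simp)
  have heq : EqOn R (fun q => c q.1 * L q) ((O₁ ∩ O₂) ×ˢ B) := fun q hq =>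
    hcL q.1 hq.1.1 q.2 (hsub hq)
  rw [horDeriv, fderiv_congr_of_eqOn ((hO₁.inter hO₂).prod hB) heq hq, ← horDeriv,
    horDeriv_fst_mul hcd (smooth_diff S.isOpen hL hqW), hor q hqW,
    (hcd.hasFDerivAt.log (hc0 _ hq.1.1)).fderiv, heq hq]
  have := hc0 _ hq.1.1
  simp only [smul_apply, smul_eq_mul]
  field_simp
  ring

end LocalPotential

/-! ### From local metrizability to a closed 1-form, and back. -/

section Necessity

variable {n : ℕ} {M : Type*} [TopologicalSpace M] [ChartedSpace (E n) M] [IsManifold (𝓡 n) ∞ M]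
  {e : OpenPartialHomeomorph M (E n)} {G : Spray n M} {R : TangentBundle (𝓡 n) M → ℝ}

lemma IsFinslerMetric.exists_ne_zero {U : Set M} {D : Set (TangentBundle (𝓡 n) M)}
    {L : TangentBundle (𝓡 n) M → ℝ} (hL : IsFinslerMetric D L) (hD : IsConicalRegion U D)
    (he : IsCoord e) {p : E n × E n} (hp : p ∈ chartDom e D) {B : Set (E n)} (hB : B ∈ 𝓝 p.2) :
    ∃ z ∈ B, rep e L p.1 z ≠ 0 :=
  exists_ne_zero_of_det (hL.nondegenerate e he p hp) (hD.snd_ne_zero hp) hB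

lemma Spray.IsLocallyMetrizable.exists_local_potential (h : G.IsLocallyMetrizable)
    (hR : G.IsIsotropic R) (hFR : IsFinslerMetric G.region R) (he : IsCoord e) {p : E n × E n}
    (hp : p ∈ chartDom e G.region) :
    ∃ (O B : Set (E n)) (l : E n → ℝ), IsOpen O ∧ p.1 ∈ O ∧ IsOpen B ∧ p.2 ∈ B ∧
      O ×ˢ B ⊆ chartDom e G.region ∧ ContDiffOn ℝ ∞ l O ∧ ∀ q ∈ O ×ˢ B, ∀ w,
        horDeriv (unc (G.coeff e)) w (unc (rep e R)) q = rep e R q.1 q.2 * fderiv ℝ l q.1 w := by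
  obtain ⟨U, D, hD, hDG, huD, L, hL⟩ := h _ hp.2
  obtain ⟨O, B, l, hO, hpO, hB, hpB, hOB, hl, hor⟩ :=
    ((hR.isLocallyIsotropic he).mono (chartDom_mono hDG)).exists_local_potential
      (G.isLocalSpray_of_subset he hD.isOpen hDG) (hL.1.smooth e he)
      (hL.1.homogeneous.homTwoOn e) (hL.coord he hD.isOpen hDG).1 (hL.coord he hD.isOpen hDG).2
      (fun _ hq => hD.snd_ne_zero hq) (hD.isPreconnected_coord he)
      (fun q hq B hB => hFR.exists_ne_zero G.isConicalRegion he (chartDom_mono hDG hq) hB)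
      (fun q hq B hB => hL.1.exists_ne_zero hD he hq hB) (p := p) ⟨hp.1, huD⟩
  exact ⟨O, B, l, hO, hpO, hB, hpB, hOB.trans (chartDom_mono hDG), hl, hor⟩

/-- The logarithmic horizontal derivative at a point of the base is determined by the directions
near a given one. -/
lemma IsFinslerMetric.covector_unique (hFR : IsFinslerMetric G.region R) (he : IsCoord e)
    {p : E n × E n} (hp : p ∈ chartDom e G.region) {a b : E n →L[ℝ] ℝ}
    (h : ∀ᶠ y in 𝓝 p.2, ∀ w, rep e R p.1 y * a w = rep e R p.1 y * b w) : a = b := by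
  obtain ⟨z, hz, hz0⟩ := hFR.exists_ne_zero G.isConicalRegion he hp h
  ext w
  exact mul_left_cancel₀ hz0 (hz w)

/-- Different directions may use different local metrics. Their covectors agree on overlaps because
R vanishes on no open set of directions, and connectedness of the fibre propagates one of them
everywhere. -/
lemma Spray.IsLocallyMetrizable.exists_covector (h : G.IsLocallyMetrizable)
    (hR : G.IsIsotropic R) (hFR : IsFinslerMetric G.region R) (he : IsCoord e) (ξ : E n) :
    ∃ a : E n →L[ℝ] ℝ, ∀ η, (ξ, η) ∈ chartDom e G.region → ∀ w,
      horDeriv (unc (G.coeff e)) w (unc (rep e R)) (ξ, η) = rep e R ξ η * a w := by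
  have hloc : ∀ η, (ξ, η) ∈ chartDom e G.region → ∃ a : E n →L[ℝ] ℝ, ∀ᶠ z in 𝓝 η, ∀ w,
      horDeriv (unc (G.coeff e)) w (unc (rep e R)) (ξ, z) = rep e R ξ z * a w := by
    intro η hη
    obtain ⟨O, B, l, hO, hpO, hB, hpB, hOB, hl, hor⟩ := h.exists_local_potential hR hFR he hη
    refine ⟨fderiv ℝ l ξ, ?_⟩
    filter_upwards [hB.mem_nhds hpB] with z hz w using hor (ξ, z) ⟨hpO, hz⟩ w
  rcases Set.eq_empty_or_nonempty {η | (ξ, η) ∈ chartDom e G.region} with h0 | ⟨η₀, hη₀⟩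
  · refine ⟨0, fun η hη => ?_⟩
    have : η ∈ {η | (ξ, η) ∈ chartDom e G.region} := hη
    rw [h0] at this
    exact this.elim
  obtain ⟨a, ha⟩ := hloc η₀ hη₀
  let A : Set (E n) := {η | ∀ᶠ z in 𝓝 η, ∀ w,
    horDeriv (unc (G.coeff e)) w (unc (rep e R)) (ξ, z) = rep e R ξ z * a w}
  have hsub : {η | (ξ, η) ∈ chartDom e G.region} ⊆ A := by
    refine (G.isConicalRegion.isPreconnected_coord he ξ).subset_of_closure_inter_subset
      isOpen_setOfPred_eventually_nhds ⟨η₀, hη₀, ha⟩ fun η hη => ?_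
    obtain ⟨b, hb⟩ := hloc η hη.2
    have hW : ∀ᶠ z in 𝓝 η, (ξ, z) ∈ chartDom e G.region :=
      ((isOpen_chartDom he G.isConicalRegion.isOpen).preimage
        (Continuous.prodMk_right ξ)).mem_nhds hη.2
    obtain ⟨z, ⟨hz1, hz2⟩, hz3⟩ := mem_closure_iff_nhds.1 hη.1 _ (hb.eventually_nhds.and hW)
    have hab : a = b := hFR.covector_unique he hz2 (by
      filter_upwards [hz1, hz3] with y h1 h2 w
      rw [← h1 w, ← h2 w])
    rw [← hab] at hb
    exact hb
  exact ⟨a, fun η hη w => (hsub hη : η ∈ A).self_of_nhds w⟩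

/-- If the curvature function of a locally metrizable spray is a Finsler metric, then its
logarithmic horizontal derivative is a closed 1-form on the base. -/
theorem Spray.IsLocallyMetrizable.exists_closedOneForm (h : G.IsLocallyMetrizable)
    (hR : G.IsIsotropic R) (hFR : IsFinslerMetric G.region R) :
    ∃ θ : OneForm n M, IsClosedOneForm θ ∧ G.HorizontalLog R θ := by
  choose a ha using fun x : M => h.exists_covector hR hFR (isCoord_chartAt (n := n) x)
    (chartAt (E n) x x)
  -- The form is defined pointwise in the preferred chart at each point. Invariance of horizontal
  -- derivatives yields its formula in all charts, and smoothness and closedness follow from the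
  -- local potentials.
  let θ : OneForm n M := fun x =>
    ((a x).comp (mfderiv (𝓡 n) (𝓡 n) (chartAt (E n) x) x : E n →L[ℝ] E n) : E n →L[ℝ] ℝ)
  have key : ∀ e : OpenPartialHomeomorph M (E n), IsCoord e → ∀ p ∈ chartDom e G.region, ∀ w,
      horDeriv (unc (G.coeff e)) w (unc (rep e R)) p = rep e R p.1 p.2 * formAt e θ p.1 w := by
    intro e he p hp w
    set e₀ := chartAt (E n) (e.symm p.1) with he₀_def
    have he₀ : IsCoord e₀ := isCoord_chartAt _
    have hx : e.symm p.1 ∈ e₀.source := mem_chart_source (E n) (e.symm p.1)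
    have hp₀ : p.1 ∈ transitionDom e e₀ := ⟨hp.1, hx⟩
    have hov : p ∈ overlap e e₀ G.region := ⟨hp, hp₀⟩
    have h1 := rep_eqOn he he₀ R hp₀
    rw [G.horDeriv_rep he he₀ G.isConicalRegion.isOpen subset_rfl (hFR.smooth e₀ he₀) hov]
    refine (ha (e.symm p.1) _ (mapsTo_overlap he he₀ hov) _).trans ?_
    exact congrArg₂ (· * ·) h1.symm (congrArg (a _) (fderiv_transition he he₀ hp₀ w))
  have hloc : ∀ e : OpenPartialHomeomorph M (E n), IsCoord e → ∀ ξ ∈ e.target,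
      ∃ (O : Set (E n)) (l : E n → ℝ), IsOpen O ∧ ξ ∈ O ∧ ContDiffOn ℝ ∞ l O ∧
        ∀ i, EqOn (formComp e θ i) (fun x => fderiv ℝ l x (coordVec i)) O := by
    intro e he ξ hξ
    obtain ⟨η, hη⟩ := (G.isConicalRegion.isConnected_coord he hξ (mem_univ _)).nonempty
    obtain ⟨O, B, l, hO, hpO, hB, hpB, hOB, hl, hor⟩ := h.exists_local_potential hR hFR he hη
    refine ⟨O, l, hO, hpO, hl, fun i x hx => ?_⟩
    -- Both covectors represent the horizontal derivative of R for all directions in `B`, so the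
    -- local potential has differential θ throughout `O`.
    have huniq : formAt e θ x = fderiv ℝ l x :=
      hFR.covector_unique he (p := (x, η)) (hOB ⟨hx, hpB⟩) (by
        filter_upwards [hB.mem_nhds hpB] with y hy w
        rw [← hor (x, y) ⟨hx, hy⟩, key e he _ (hOB ⟨hx, hy⟩)])
    rw [← formAt_coordVec, huniq]
  refine ⟨θ, ⟨fun e he i ξ hξ => ?_, fun e he ξ hξ i j => ?_⟩, fun e he p hp i => ?_⟩
  · obtain ⟨O, l, hO, hξO, hl, heq⟩ := hloc e he ξ hξ
    exact ((((hl.fderiv_apply_of_isOpen hO contDiffOn_const).congr (heq i)).contDiffAt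
      (hO.mem_nhds hξO))).contDiffWithinAt
  · obtain ⟨O, l, hO, hξO, hl, heq⟩ := hloc e he ξ hξ
    have hlξ := hl.contDiffAt (hO.mem_nhds hξO)
    rw [fderiv_congr_of_eqOn hO (heq i) hξO, fderiv_congr_of_eqOn hO (heq j) hξO,
      fderiv_fderiv_const hlξ, fderiv_fderiv_const hlξ, fderiv_fderiv_symm hlξ]
  · have S := G.isLocalSpray he
    rw [hderiv_eq S.isOpen S.smooth (hFR.smooth e he) hp, key e he p hp, formAt_coordVec]

/-- Conversely, a closed logarithmic horizontal derivative makes the spray locally metrizable. -/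
theorem Spray.isLocallyMetrizable_of_closedOneForm {θ : OneForm n M} (hθ : IsClosedOneForm θ)
    (hFR : IsFinslerMetric G.region R) (hlog : G.HorizontalLog R θ) : G.IsLocallyMetrizable := by
  intro u hu
  obtain ⟨U, lam, hU, hxU, hlam⟩ := hθ.exists_isLogPotential u.1
  exact ⟨U, restrictTo G.region U, G.isConicalRegion_restrictTo hU, fun v hv => hv.1, ⟨hu, hxU⟩,
    _, Spray.isInducedBy_div hFR hlog hU hlam⟩

/-- A horizontally constant curvature function that is a Finsler metric induces the spray and has
flag curvature one. -/
theorem Spray.IsIsotropic.isInducedBy_self (hR : G.IsIsotropic R)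
    (hFR : IsFinslerMetric G.region R) (hlog : G.HorizontalLog R 0) :
    G.IsInducedBy G.region R ∧ HasFlagCurvature G.region R (fun _ => 1) := by
  have h1 := Spray.isInducedBy_div hFR hlog isOpen_univ isLogPotential_one
  have h2 := hR.hasFlagCurvature_div isOpen_univ (fun _ _ => one_ne_zero) h1
  have hres : restrictTo G.region univ = G.region := by
    ext u
    exact ⟨fun hu => hu.1, fun hu => ⟨hu, mem_univ _⟩⟩
  simp only [div_one, hres] at h1 h2
  exact ⟨h1, h2⟩

end Necessity

end SprayGeometry

end

theorem theorem1p1 {n : ℕ} (hn : 2 ≤ n) {M : Type*} [TopologicalSpace M]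
    [ChartedSpace (SprayGeometry.E n) M] [IsManifold (𝓡 n) ∞ M]
    (G : SprayGeometry.Spray n M) (R : TangentBundle (𝓡 n) M → ℝ) (hR : G.IsIsotropic R) :
    -- (i)
    ((∀ u ∈ G.region, R u = 0) → G.IsLocallyMetrizable) ∧
    -- (ii)
    ((∀ x : M, ∃ y ∈ SprayGeometry.fibre G.region x, R ⟨x, y⟩ ≠ 0) →
      ¬ SprayGeometry.IsFinslerMetric G.region R →
        ¬ G.IsMetrizable ∧ ¬ G.IsLocallyMetrizable) ∧
    -- (iii)
    (SprayGeometry.IsFinslerMetric G.region R →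
      (G.IsLocallyMetrizable ↔
        ∃ θ : SprayGeometry.OneForm n M, SprayGeometry.IsClosedOneForm θ ∧ G.HorizontalLog R θ) ∧
      ∀ θ : SprayGeometry.OneForm n M, SprayGeometry.IsClosedOneForm θ → G.HorizontalLog R θ →
        (3 ≤ n → G.HorizontallyConstant R ∧ θ = 0) ∧
        (θ = 0 → G.IsInducedBy G.region R ∧
          SprayGeometry.HasFlagCurvature G.region R (fun _ => 1)) ∧
        (∀ x : M, ∃ (U : Set M) (lam : M → ℝ), IsOpen U ∧ x ∈ U ∧
          SprayGeometry.IsLogPotential U θ lam) ∧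
        (∀ (U : Set M) (lam : M → ℝ), IsOpen U → SprayGeometry.IsLogPotential U θ lam →
          G.IsInducedBy (SprayGeometry.restrictTo G.region U) (fun u => R u / lam u.1) ∧
          SprayGeometry.HasFlagCurvature (SprayGeometry.restrictTo G.region U)
            (fun u => R u / lam u.1) (fun u => lam u.1)) ∧
        (θ ≠ 0 → n = 2)) := by
  refine ⟨fun h0 => hR.isLocallyMetrizable_of_eq_zero h0, fun hne hnF => ?_, fun hFR => ⟨?_, ?_⟩⟩
  · have h : ¬ G.IsLocallyMetrizable := fun h => hnF (h.isFinslerMetric hR hne)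
    exact ⟨fun hm => h hm.isLocallyMetrizable, h⟩
  · exact ⟨fun h => h.exists_closedOneForm hR hFR,
      fun ⟨θ, hθ, hlog⟩ => SprayGeometry.Spray.isLocallyMetrizable_of_closedOneForm hθ hFR hlog⟩
  · intro θ hθ hlog
    have hzero : 3 ≤ n → θ = 0 := fun h3 => hR.form_eq_zero h3 hFR hlog
    refine ⟨fun h3 => ?_, fun h0 => ?_, hθ.exists_isLogPotential, fun U lam hU hlam => ?_,
      fun hne => ?_⟩
    · obtain rfl := hzero h3
      exact ⟨hlog.horizontallyConstant, rfl⟩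
    · subst h0
      exact hR.isInducedBy_self hFR hlog
    · have h := SprayGeometry.Spray.isInducedBy_div hFR hlog hU hlam
      exact ⟨h, hR.hasFlagCurvature_div hU hlam.ne_zero h⟩
    · by_contra h2
      exact hne (hzero (by omega))
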